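/- \textbf{Setting.} Let $I=\mathbb{N}=\{0,1,2,\dots\}$ or $I=\mathbb{Z}$, and let $X$ be the birth and death chain on $I$ with birth rates $\lambda(x)$ and death rates $\mu(x)$. All rates are strictly positive, except that $\mu(0)=0$ if $I=\mathbb{N}$. Let $\pi(x)=\prod_{i=1}^{x}\frac{\lambda(i-1)}{\mu(i)}$ for $x\ge 0$ and $\pi(x)=\prod_{i=1}^{-x}\frac{\mu(x+i)}{\lambda(x+i-1)}$ for $x<0$. The infinite endpoints are assumed natural: if $I=\mathbb{N}$, $$\sum_{j\ge 0}\frac{1}{\lambda(j)\pi(j)}\sum_{i=0}^{j}\pi(i)=\infty,\qquad \sum_{j\ge 0}\frac{1}{\lambda(j)\pi(j)}\sum_{i>j}\pi(i)=\infty ,$$ and if $I=\mathbb{Z}$, $$\sum_{j\ge 1}\frac{1}{\lambda(j)\pi(j)}\sum_{i=1}^{j}\pi(i)=\sum_{j\ge 1}\pi(j)\sum_{i=1}^{j-1}\frac{1}{\lambda(i)\pi(i)}=\sum_{j\le -1}\frac{1}{\lambda(j)\pi(j)}\sum_{i=j+1}^{-1}\pi(i)=\sum_{j\le -1}\pi(j)\sum_{i=j}^{-1}\frac{1}{\lambda(i)\pi(i)}=\infty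 .$$ Let $p_t(x,y)$ be the transition density of $X$. The dual chain has birth rates $\hat\lambda(x)=\mu(x+1)$ and death rates $\hat\mu(x)=\lambda(x)$ (and is killed at $-1$ if $I=\mathbb{N}$); $\hat p_t$ is its transition density and $\hat\pi$ its symmetrizing measure, given by the formula for $\pi$ with $(\hat\lambda,\hat\mu)$ in place of $(\lambda,\mu)$. Let $W^n=\{x\in I^n: x_1<\dots<x_n\}$ and $W^{n,n+1}=\{(x,y)\in I^{n+1}\times I^n: x_1\le y_1<x_2\le y_2<\dots\le y_n<x_{n+1}\}$. The Karlin–McGregor kernels are $p^n_t(x,y)=\det(p_t(x_i,y_j))_{i,j=1}^n$ and $\hat p^n_t(x,y)=\det(\hat p_t(x_i,y_j))_{i,j=1}^n$ on $W^n$, with operators $P^n_t$, $\hat P^n_t$. Let $\Phi_{0,t}$ be the coalescing flow of $X$: at every site $x$ there are independent Poisson clocks of rates $\lambda(x)$ and $\mu(x)$, at whose rings all particles present at $x$ jump together to $x+1$, respectively $x-1$. The two-level (block-determinant) operators $\mathsf{Q}^{n,n+1}_t$ have kernel, for $(x,y),(x',y')\in W^{n,n+1}$, $$\mathsf{q}_t^{n,n+1}((x,y),(x',y'))=\prod_{i=1}^n\frac{\hat\pi(y_i')}{\hat\pi(y_i)}\,(-1)^n\nabla_{y_1}\cdots\nabla_{y_n}(-1)^{n+1}\bar\nabla_{x_1'}\cdots\bar\nabla_{x_{n+1}'}\,\mathbb{P}\big(\Phi_{0,t}(x_i)\le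 x_i',\ \Phi_{0,t}(y_j)\le y_j'\ \text{for all } i,j\big),$$ where $\nabla f(z)=f(z+1)-f(z)$ and $\bar\nabla f(z)=f(z-1)-f(z)$. For a function $f$ on $W^{n,n+1}$ and $x\in W^{n+1}$ let $$(\Lambda_{n,n+1}f)(x)=\sum_{y:(x,y)\in W^{n,n+1}}\ \prod_{i=1}^n\hat\pi(y_i)\,f(x,y).$$ A function on $W^n$ is also regarded as the function $(x,y)\mapsto f(y)$ on $W^{n,n+1}$. \textbf{Theorem.} Let $n\ge 0$ and let $\hat h_n:W^n\to(0,\infty)$ be a strictly positive eigenfunction of $\hat P^n_t$, i.e. $\hat P^n_t\hat h_n=e^{ct}\hat h_n$ for all $t\ge0$ and some $c\in\mathbb{R}$, the sums being convergent. Put $h_{n+1}=\Lambda_{n,n+1}\hat h_n$ and $$(\Lambda^{\hat h_n}_{n,n+1}f)(x)=\frac{1}{h_{n+1}(x)}\sum_{y:(x,y)\in W^{n,n+1}}\ \prod_{i=1}^n\hat\pi(y_i)\,\hat h_n(y)\,f(x,y).$$ Then $h_{n+1}$ is a strictly positive eigenfunction of $P^{n+1}_t$, and $(x,y)\mapsto\hat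 h_n(y)$ is one of $\mathsf{Q}^{n,n+1}_t$, both with eigenvalue $e^{ct}$; the kernel $\Lambda^{\hat h_n}_{n,n+1}$ is Markov, and so are, for every $t\ge 0$, the Doob transforms $$P_t^{n+1,h_{n+1}}=e^{-ct}h_{n+1}^{-1}P_t^{n+1}h_{n+1},\qquad \mathsf{Q}_t^{n,n+1,\hat h_n}=e^{-ct}\hat h_n^{-1}\mathsf{Q}_t^{n,n+1}\hat h_n,\qquad \hat P_t^{n,\hat h_n}=e^{-ct}\hat h_n^{-1}\hat P_t^{n}\hat h_n .$$ Moreover, for all $t\ge0$, $$P_t^{n+1,h_{n+1}}\Lambda^{\hat h_n}_{n,n+1}=\Lambda^{\hat h_n}_{n,n+1}\mathsf{Q}_t^{n,n+1,\hat h_n}\quad\text{on bounded functions on } W^{n,n+1},$$ $$P_t^{n+1,h_{n+1}}\Lambda^{\hat h_n}_{n,n+1}=\Lambda^{\hat h_n}_{n,n+1}\hat P_t^{n,\hat h_n}\quad\text{on bounded functions on } W^{n}.$$ -/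

import Mathlib

open scoped BigOperators ENNReal

noncomputable section

namespace InterlacingChains

/-! ### Continuous-time Markov chains from their rate matrices -/

/-- Transition function of the chain with rate matrix `G`, killed on leaving the finite set `F`:
the matrix exponential of `t` times the `F × F` block of `G`. -/
def killedDensity {S : Type*} [DecidableEq S] (G : S → S → ℝ) (F : Finset S)
    (t : ℝ) (x y : S) : ℝ :=
  if h : x ∈ F ∧ y ∈ F then
    NormedSpace.exp (t • (Matrix.of fun a b : F => G a b)) ⟨x, h.1⟩ ⟨y, h.2⟩
  else 0

/-- Transition density `(t, x, y) ↦ ℙ_x(X(t) = y)` of the (minimal) continuous-time Markov chain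
on the countable set `S` with rate matrix `G`: the supremum over finite sets `F` of
`ℙ_x(X(t) = y, X stays in F during [0, t])`. It is the minimal nonnegative solution of the
Kolmogorov backward equation, hence the only sub-stochastic one for a non-explosive chain. -/
def transitionDensity {S : Type*} [DecidableEq S] (G : S → S → ℝ) (t : ℝ) (x y : S) : ℝ :=
  ⨆ F : Finset S, killedDensity G F t x y

/-! ### Birth and death chains -/

/-- The rate matrix of the chain with birth rates `lam` and death rates `mu`. -/
def bdGenerator (lam mu : ℤ → ℝ) (x y : ℤ) : ℝ :=
  if y = x + 1 then lam x
  else if y = x then -lam x - mu x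
  else if y = x - 1 then mu x
  else 0

/-- The symmetrizing measure of the chain with birth rates `lam` and death rates `mu`. -/
def symmMeasure (lam mu : ℤ → ℝ) (x : ℤ) : ℝ :=
  if 0 ≤ x then ∏ i ∈ Finset.Icc 1 x, lam (i - 1) / mu i
  else ∏ i ∈ Finset.Icc 1 (-x), mu (x + i) / lam (x + i - 1)

/-- Birth and death chain on `ℕ`, reflecting at `0`, with `∞` a natural boundary.
The rates are extended by `0` to the negative integers. -/
structure HalfLineRates (lam mu : ℤ → ℝ) : Prop where
  birth_pos : ∀ x, 0 ≤ x → 0 < lam x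
  death_pos : ∀ x, 1 ≤ x → 0 < mu x
  death_zero : mu 0 = 0
  birth_neg : ∀ x, x < 0 → lam x = 0
  death_neg : ∀ x, x < 0 → mu x = 0
  not_exit : ∑' j : Set.Ici (0 : ℤ), ENNReal.ofReal (1 / (lam j * symmMeasure lam mu j)) *
      ∑ i ∈ Finset.Icc (0 : ℤ) j, ENNReal.ofReal (symmMeasure lam mu i) = ∞
  not_entrance : ∑' j : Set.Ici (0 : ℤ), ENNReal.ofReal (1 / (lam j * symmMeasure lam mu j)) *
      ∑' i : Set.Ici ((j : ℤ) + 1), ENNReal.ofReal (symmMeasure lam mu i) = ∞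

/-- Bilateral birth and death chain on `ℤ`, with `∞` and `-∞` natural boundaries. -/
structure BilateralRates (lam mu : ℤ → ℝ) : Prop where
  birth_pos : ∀ x, 0 < lam x
  death_pos : ∀ x, 0 < mu x
  not_exit_top : ∑' j : Set.Ici (1 : ℤ), ENNReal.ofReal (1 / (lam j * symmMeasure lam mu j)) *
      ∑ i ∈ Finset.Icc (1 : ℤ) j, ENNReal.ofReal (symmMeasure lam mu i) = ∞
  not_entrance_top : ∑' j : Set.Ici (1 : ℤ), ENNReal.ofReal (symmMeasure lam mu j) *
      ∑ i ∈ Finset.Ico (1 : ℤ) j, ENNReal.ofReal (1 / (lam i * symmMeasure lam mu i)) = ∞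
  not_exit_bot : ∑' j : Set.Iic (-1 : ℤ), ENNReal.ofReal (1 / (lam j * symmMeasure lam mu j)) *
      ∑ i ∈ Finset.Icc ((j : ℤ) + 1) (-1), ENNReal.ofReal (symmMeasure lam mu i) = ∞
  not_entrance_bot : ∑' j : Set.Iic (-1 : ℤ), ENNReal.ofReal (symmMeasure lam mu j) *
      ∑ i ∈ Finset.Icc (j : ℤ) (-1),
        ENNReal.ofReal (1 / (lam i * symmMeasure lam mu i)) = ∞

/-- The chain lives on `I = ℕ` (inside `ℤ`) or on `I = ℤ`. -/
def IsChainOn (I : Set ℤ) (lam mu : ℤ → ℝ) : Prop :=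
  (I = Set.Ici 0 ∧ HalfLineRates lam mu) ∨ (I = Set.univ ∧ BilateralRates lam mu)

/-- Transition density of the chain with birth rates `lam` and death rates `mu`. -/
def chainDensity (lam mu : ℤ → ℝ) : ℝ → ℤ → ℤ → ℝ :=
  transitionDensity (bdGenerator lam mu)

/-- Birth rates of the dual chain. -/
def dualBirth (mu : ℤ → ℝ) (x : ℤ) : ℝ := mu (x + 1)

/-- Death rates of the dual chain. -/
def dualDeath (lam : ℤ → ℝ) (x : ℤ) : ℝ := lam x

/-- Transition density of the dual chain. In the case `I = ℕ` the point `-1` is absorbing, and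
between points of `ℕ` this is the density of the chain killed at `-1`. -/
def dualDensity (lam mu : ℤ → ℝ) : ℝ → ℤ → ℤ → ℝ :=
  chainDensity (dualBirth mu) (dualDeath lam)

/-- Symmetrizing measure of the dual chain. -/
def dualSymm (lam mu : ℤ → ℝ) : ℤ → ℝ :=
  symmMeasure (dualBirth mu) (dualDeath lam)

/-! ### The coalescing flow -/

/-- All particles of the configuration `z` that sit at the site `s` jump by `d`. -/
def moveCluster {ι : Type*} (s d : ℤ) (z : ι → ℤ) : ι → ℤ :=
  fun i => if z i = s then z i + d else z i

/-- Rate matrix of the motion of the points `i ∈ ι` under the coalescing flow: at each occupied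
site `s`, independently of the other sites, all particles at `s` jump together to `s + 1` at rate
`lam s` and to `s - 1` at rate `mu s`. -/
def coalescingGenerator {ι : Type*} [Fintype ι] (lam mu : ℤ → ℝ) (z w : ι → ℤ) : ℝ :=
  ∑ s ∈ Finset.univ.image z,
    (lam s * ((if w = moveCluster s 1 z then 1 else 0) - (if w = z then 1 else 0)) +
      mu s * ((if w = moveCluster s (-1) z then 1 else 0) - (if w = z then 1 else 0)))

/-- `ℙ(Φ_{0,t}(z i) ≤ z' i for all i)` for the coalescing flow `Φ`. -/
def flowCDF {ι : Type*} [Fintype ι] (lam mu : ℤ → ℝ) (t : ℝ) (z z' : ι → ℤ) : ℝ :=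
  ∑' w : ι → ℤ, if ∀ i, w i ≤ z' i then
    transitionDensity (coalescingGenerator lam mu) t z w else 0

/-- Forward difference in the `i`-th coordinate. -/
def fwdDiffAt {n : ℕ} (i : Fin n) (f : (Fin n → ℤ) → ℝ) : (Fin n → ℤ) → ℝ :=
  fun z => f (Function.update z i (z i + 1)) - f z

/-- Backward difference in the `i`-th coordinate. -/
def bwdDiffAt {n : ℕ} (i : Fin n) (f : (Fin n → ℤ) → ℝ) : (Fin n → ℤ) → ℝ :=
  fun z => f (Function.update z i (z i - 1)) - f z

/-- Forward differences in all the coordinates. -/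
def fwdDiffAll {n : ℕ} (f : (Fin n → ℤ) → ℝ) : (Fin n → ℤ) → ℝ :=
  (List.finRange n).foldr fwdDiffAt f

/-- Backward differences in all the coordinates. -/
def bwdDiffAll {n : ℕ} (f : (Fin n → ℤ) → ℝ) : (Fin n → ℤ) → ℝ :=
  (List.finRange n).foldr bwdDiffAt f

/-! ### Interlacing spaces -/

/-- `W^n(I)`. -/
def Weyl (I : Set ℤ) (n : ℕ) : Type :=
  {x : Fin n → ℤ // StrictMono x ∧ ∀ i, x i ∈ I}

instance (I : Set ℤ) (n : ℕ) : DecidableEq (Weyl I n) :=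
  inferInstanceAs (DecidableEq {x : Fin n → ℤ // StrictMono x ∧ ∀ i, x i ∈ I})

/-- `W^{n,n+1}(I)`: pairs `(x, y)` with `x₁ ≤ y₁ < x₂ ≤ y₂ < ⋯ ≤ yₙ < xₙ₊₁`. -/
structure TwoLevel (I : Set ℤ) (n : ℕ) : Type where
  x : Fin (n + 1) → ℤ
  y : Fin n → ℤ
  x_mem : ∀ i, x i ∈ I
  y_mem : ∀ i, y i ∈ I
  le : ∀ i : Fin n, x i.castSucc ≤ y i
  lt : ∀ i : Fin n, y i < x i.succ

theorem TwoLevel.x_strictMono {I : Set ℤ} {n : ℕ} (w : TwoLevel I n) : StrictMono w.x :=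
  Fin.strictMono_iff_lt_succ.2 fun i => (w.le i).trans_lt (w.lt i)

theorem TwoLevel.y_strictMono {I : Set ℤ} {n : ℕ} (w : TwoLevel I n) : StrictMono w.y := by
  cases n with
  | zero => exact fun i => i.elim0
  | succ n => exact Fin.strictMono_iff_lt_succ.2 fun i => (w.lt i.castSucc).trans_le (w.le i.succ)

/-- The `X`-level. -/
def TwoLevel.projX {I : Set ℤ} {n : ℕ} (w : TwoLevel I n) : Weyl I (n + 1) :=
  ⟨w.x, w.x_strictMono, w.x_mem⟩

/-- The `Y`-level. -/
def TwoLevel.projY {I : Set ℤ} {n : ℕ} (w : TwoLevel I n) : Weyl I n :=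
  ⟨w.y, w.y_strictMono, w.y_mem⟩

/-! ### Kernels -/

/-- A kernel acting on functions. -/
def act {A B : Type*} (K : A → B → ℝ) (f : B → ℝ) (a : A) : ℝ := ∑' b, K a b * f b

/-- Markov kernels between countable sets. -/
def IsMarkov {A B : Type*} (K : A → B → ℝ) : Prop :=
  ∀ a, (∀ b, 0 ≤ K a b) ∧ HasSum (K a) 1

/-- `h` is a strictly positive eigenfunction of `(K_t)`, with eigenvalue `e^{ct}`. -/
def IsPosEigenfunction {A : Type*} (K : ℝ → A → A → ℝ) (h : A → ℝ) (c : ℝ) : Prop :=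
  (∀ a, 0 < h a) ∧
    ∀ t, 0 ≤ t → ∀ a, HasSum (fun b => K t a b * h b) (Real.exp (c * t) * h a)

/-- Doob's `h`-transform of `(K_t)` by an eigenfunction `h` with eigenvalue `e^{ct}`. -/
def doob {A : Type*} (K : ℝ → A → A → ℝ) (h : A → ℝ) (c : ℝ) (t : ℝ) (a b : A) : ℝ :=
  Real.exp (-(c * t)) * (h a)⁻¹ * K t a b * h b

/-- Bounded functions. -/
def IsBoundedFun {A : Type*} (f : A → ℝ) : Prop := ∃ C : ℝ, ∀ a, |f a| ≤ C

/-- The Karlin-McGregor kernel `P_t^n` of `n` chains. -/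
def kmKernel (I : Set ℤ) (lam mu : ℤ → ℝ) (n : ℕ) (t : ℝ) (x y : Weyl I n) : ℝ :=
  Matrix.det (Matrix.of fun i j : Fin n => chainDensity lam mu t (x.1 i) (y.1 j))

/-- The Karlin-McGregor kernel of `n` dual chains, killed at `-1` if `I = ℕ`. -/
def dualKmKernel (I : Set ℤ) (lam mu : ℤ → ℝ) (n : ℕ) (t : ℝ) (x y : Weyl I n) : ℝ :=
  Matrix.det (Matrix.of fun i j : Fin n => dualDensity lam mu t (x.1 i) (y.1 j))

/-- The two-level kernel `q_t^{n,n+1}((x, y), (x', y'))`. -/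
def twoLevelKernel (I : Set ℤ) (lam mu : ℤ → ℝ) (n : ℕ) (t : ℝ) (w w' : TwoLevel I n) : ℝ :=
  (∏ i, dualSymm lam mu (w'.y i)) / (∏ i, dualSymm lam mu (w.y i)) *
    ((-1) ^ n * fwdDiffAll (fun y =>
      (-1) ^ (n + 1) * bwdDiffAll (fun x' =>
        flowCDF lam mu t (Sum.elim w.x y) (Sum.elim x' w'.y)) w'.x) w.y)

/-- The positive kernel `Λ_{n,n+1}` from `W^{n+1}(I)` to `W^{n,n+1}(I)`; the measure assigned to
`x` is supported on the pairs whose first component is `x`. -/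
def link (I : Set ℤ) (lam mu : ℤ → ℝ) (n : ℕ) (x : Weyl I (n + 1)) (w : TwoLevel I n) : ℝ :=
  if w.projX = x then ∏ i, dualSymm lam mu (w.y i) else 0

/-- `h_{n+1} = Λ_{n,n+1} ĥ_n`. -/
def linkFun (I : Set ℤ) (lam mu : ℤ → ℝ) (n : ℕ) (h : Weyl I n → ℝ) :
    Weyl I (n + 1) → ℝ :=
  act (link I lam mu n) (fun w => h w.projY)

/-- The normalized kernel `Λ^{ĥ_n}_{n,n+1}` from `W^{n+1}(I)` to `W^{n,n+1}(I)`. -/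
def markovLink (I : Set ℤ) (lam mu : ℤ → ℝ) (n : ℕ) (h : Weyl I n → ℝ)
    (x : Weyl I (n + 1)) (w : TwoLevel I n) : ℝ :=
  (linkFun I lam mu n h x)⁻¹ * link I lam mu n x w * h w.projY

end InterlacingChains

end

/-!
The theorem follows from two identities for the coalescing flow `Φ` of the chain, read at a fixed
time `t`. The signed differences in the two-level kernel `Q` turn the distribution function of the
flow into a probability (`FlowModel.diff_flowCDF`, `twoLevelKernel_eq`): up to the ratio
`∏ π̂(y') / ∏ π̂(y)`, the kernel is the probability of the event
`Φ x = x'` and `Φ (y j) ≤ y' j < Φ (y j + 1)` for all `j`. In particular it is nonnegative, and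

* summing over `x'` removes the condition `Φ x = x'`, because the flow is monotone and so `Φ x`
  interlaces with `y'` automatically; what remains is the Karlin-McGregor kernel of the dual chain
  (`ChainData.hasSum_twoLevelKernel`);
* summing over the `y` that interlace with `x` telescopes, and on `Φ x = x'` only a boundary term
  equal to `1` is left; what remains is the Karlin-McGregor kernel of the chain
  (`ChainData.sum_link_mul_twoLevelKernel`), which is the intertwining `P Λ = Λ Q`.

All kernels being nonnegative, the statements on eigenfunctions, Doob transforms and bounded
functions follow by rearranging sums; the sums over the link are finite.

Both determinants come from one formula (`flowCDF_eq_warrenDet`): for nondecreasing `z` and `z'`,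
`ℙ(Φ (z i) ≤ z' i for all i) = det (F (z i) (z' j) - 1(i < j))`, where `F x y = ℙ_x(X(t) ≤ y)`.
Both sides solve the backward equation of the coalescing motion. For the determinant this holds
because moving a whole cluster adds the same vector to several rows, and terms in which two rows
equal that vector vanish (`det_add_rows`). Taking differences in `z'` yields the transition density
`p` of the chain, and taking differences in `z` yields that of the dual chain by Siegmund duality
(`dualDensity_eq_sub`).

The backward equation has unique bounded solutions by a maximum principle based on a Lyapunov
function (`IsRateMatrix.backward_unique`). For one particle this function comes from Feller's test
and the boundary conditions (`exists_barrier_top`); the sum of its values at the particles serves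
the coalescing motion (`isLyapunov_coal`). Consistency and monotonicity of the flow are further
consequences of uniqueness, and they allow all the particles to be realized on one probability
space (`nonempty_flowModel`).
-/

noncomputable section

namespace InterlacingChains

/-! ### Exponentials of finite rate matrices -/

section MatrixExp

variable {m : Type*} [Fintype m] [DecidableEq m]

theorem exp_apply_nonneg_of_nonneg (A : Matrix m m ℝ) (hA : ∀ i j, 0 ≤ A i j) (i j : m) :
    0 ≤ NormedSpace.exp A i j := by
  let _ : NormedRing (Matrix m m ℝ) := Matrix.linftyOpNormedRing
  let _ : NormedAlgebra ℝ (Matrix m m ℝ) := Matrix.linftyOpNormedAlgebra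
  have hpow : ∀ n : ℕ, ∀ i j, 0 ≤ (A ^ n) i j := by
    intro n
    induction n with
    | zero => intro i j; rw [pow_zero, Matrix.one_apply]; split_ifs <;> norm_num
    | succ n ih =>
      intro i j
      rw [pow_succ, Matrix.mul_apply]
      exact Finset.sum_nonneg fun k _ => mul_nonneg (ih i k) (hA k j)
  have h := NormedSpace.exp_series_hasSum_exp' (𝕂 := ℝ) A
  have h2 : HasSum (fun n : ℕ => ((n.factorial : ℝ)⁻¹ • A ^ n) i j) (NormedSpace.exp A i j) :=
    h.map (Matrix.entryAddMonoidHom ℝ i j) (continuous_id.matrix_elem i j)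
  refine h2.nonneg fun n => ?_
  rw [Matrix.smul_apply, smul_eq_mul]
  exact mul_nonneg (by positivity) (hpow n i j)

/-- The diagonal is made nonnegative by adding a multiple of the identity, which commutes with
everything and hence only changes the exponential by a positive factor. -/
theorem exp_apply_nonneg (A : Matrix m m ℝ) (hA : ∀ i j, i ≠ j → 0 ≤ A i j) (i j : m) :
    0 ≤ NormedSpace.exp A i j := by
  set c : ℝ := ∑ k, |A k k|
  have hc : ∀ k, 0 ≤ A k k + c := fun k => by
    have : |A k k| ≤ c :=
      Finset.single_le_sum (f := fun k => |A k k|) (fun _ _ => abs_nonneg _) (Finset.mem_univ k)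
    have := neg_abs_le (A k k)
    linarith
  have hB : ∀ i j, 0 ≤ (A + c • (1 : Matrix m m ℝ)) i j := by
    intro i j
    rw [Matrix.add_apply, Matrix.smul_apply, Matrix.one_apply, smul_eq_mul]
    by_cases hij : i = j
    · subst hij; simpa using hc i
    · simpa [hij] using hA i j hij
  have hcomm : Commute ((-c) • (1 : Matrix m m ℝ)) (A + c • (1 : Matrix m m ℝ)) :=
    (Commute.one_left _).smul_left _
  have hA' : A = (-c) • (1 : Matrix m m ℝ) + (A + c • (1 : Matrix m m ℝ)) := by
    rw [neg_smul]; abel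
  have hdiag : (-c) • (1 : Matrix m m ℝ) = Matrix.diagonal fun _ => -c := by
    ext a b; simp [Matrix.diagonal_apply, Matrix.one_apply]
  rw [hA', Matrix.exp_add_of_commute _ _ hcomm, hdiag, Matrix.exp_diagonal,
    Matrix.diagonal_mul]
  refine mul_nonneg ?_ (exp_apply_nonneg_of_nonneg _ hB i j)
  rw [show NormedSpace.exp (fun _ : m => -c) i = Real.exp (-c) by
    rw [Pi.coe_exp, Real.exp_eq_exp_ℝ]]
  exact (Real.exp_pos _).le

theorem hasDerivAt_exp_smul_apply (A : Matrix m m ℝ) (t : ℝ) (i j : m) :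
    HasDerivAt (fun s : ℝ => NormedSpace.exp (s • A) i j)
      ((NormedSpace.exp (t • A) * A) i j) t := by
  let _ : NormedRing (Matrix m m ℝ) := Matrix.linftyOpNormedRing
  let _ : NormedAlgebra ℝ (Matrix m m ℝ) := Matrix.linftyOpNormedAlgebra
  have h := hasDerivAt_exp_smul_const (𝕂 := ℝ) A t
  let L : Matrix m m ℝ →L[ℝ] ℝ :=
    ⟨Matrix.entryLinearMap ℝ ℝ i j, continuous_id.matrix_elem i j⟩
  exact L.hasFDerivAt.comp_hasDerivAt t h

theorem hasDerivAt_exp_smul_apply' (A : Matrix m m ℝ) (t : ℝ) (i j : m) :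
    HasDerivAt (fun s : ℝ => NormedSpace.exp (s • A) i j)
      ((A * NormedSpace.exp (t • A)) i j) t := by
  let _ : NormedRing (Matrix m m ℝ) := Matrix.linftyOpNormedRing
  let _ : NormedAlgebra ℝ (Matrix m m ℝ) := Matrix.linftyOpNormedAlgebra
  have h := hasDerivAt_exp_smul_const' (𝕂 := ℝ) A t
  let L : Matrix m m ℝ →L[ℝ] ℝ :=
    ⟨Matrix.entryLinearMap ℝ ℝ i j, continuous_id.matrix_elem i j⟩
  exact L.hasFDerivAt.comp_hasDerivAt t h

end MatrixExp

/-! ### Rate matrices and their killed densities -/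

/-- `G` is a conservative rate matrix with finitely many non-zero entries in each row; those of
row `x` lie in `N x`. -/
structure IsRateMatrix {S : Type*} (G : S → S → ℝ) (N : S → Finset S) : Prop where
  offdiag : ∀ x y, x ≠ y → 0 ≤ G x y
  supp : ∀ x y, y ∉ N x → G x y = 0
  row_sum : ∀ x, ∑ y ∈ N x, G x y = 0

/-- The generator `f ↦ G f`. -/
def gen {S : Type*} (G : S → S → ℝ) (N : S → Finset S) (f : S → ℝ) (x : S) : ℝ :=
  ∑ y ∈ N x, G x y * f y

section Killed

variable {S : Type*} [DecidableEq S] {G : S → S → ℝ} {N : S → Finset S}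

theorem IsRateMatrix.sum_eq_gen (hG : IsRateMatrix G N) {f : S → ℝ} {F : Finset S}
    (hf : ∀ y ∉ F, f y = 0) (x : S) : ∑ y ∈ F, G x y * f y = gen G N f x := by
  unfold gen
  rw [← Finset.sum_subset (Finset.inter_subset_left : F ∩ N x ⊆ F),
    ← Finset.sum_subset (Finset.inter_subset_right : F ∩ N x ⊆ N x)]
  · intro y hy hy'
    rw [hf y (fun h => hy' (Finset.mem_inter.2 ⟨h, hy⟩)), mul_zero]
  · intro y hy hy'
    rw [hG.supp x y (fun h => hy' (Finset.mem_inter.2 ⟨hy, h⟩)), zero_mul]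

theorem IsRateMatrix.sum_nonpos (hG : IsRateMatrix G N) {F : Finset S} {x : S} (hx : x ∈ F) :
    ∑ y ∈ F, G x y ≤ 0 := by
  have h1 : ∑ y ∈ F, G x y ≤ ∑ y ∈ F ∪ N x, G x y := by
    refine Finset.sum_le_sum_of_subset_of_nonneg Finset.subset_union_left fun y _ hy => ?_
    exact hG.offdiag x y (fun h => hy (h ▸ hx))
  have h2 : ∑ y ∈ F ∪ N x, G x y = ∑ y ∈ N x, G x y :=
    (Finset.sum_subset Finset.subset_union_right fun y _ hy => hG.supp x y hy).symm
  rw [hG.row_sum] at h2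
  linarith

theorem killedDensity_of_notMem_left (F : Finset S) (t : ℝ) {x : S} (y : S) (hx : x ∉ F) :
    killedDensity G F t x y = 0 := by simp [killedDensity, hx]

theorem killedDensity_of_notMem_right (F : Finset S) (t : ℝ) (x : S) {y : S} (hy : y ∉ F) :
    killedDensity G F t x y = 0 := by simp [killedDensity, hy]

theorem killedDensity_of_mem {F : Finset S} (t : ℝ) {x y : S} (hx : x ∈ F) (hy : y ∈ F) :
    killedDensity G F t x y =
      NormedSpace.exp (t • (Matrix.of fun a b : F => G a b)) ⟨x, hx⟩ ⟨y, hy⟩ := by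
  simp [killedDensity, hx, hy]

theorem killedDensity_zero (F : Finset S) (x y : S) :
    killedDensity G F 0 x y = if x = y ∧ x ∈ F then 1 else 0 := by
  by_cases hx : x ∈ F
  · by_cases hy : y ∈ F
    · rw [killedDensity_of_mem 0 hx hy, zero_smul, NormedSpace.exp_zero, Matrix.one_apply]
      simp [hx]
    · rw [killedDensity_of_notMem_right F 0 x hy, if_neg]
      rintro ⟨rfl, h⟩; exact hy h
  · simp [killedDensity_of_notMem_left F 0 y hx, hx]

theorem IsRateMatrix.killedDensity_nonneg (hG : IsRateMatrix G N) (F : Finset S) {t : ℝ}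
    (ht : 0 ≤ t) (x y : S) : 0 ≤ killedDensity G F t x y := by
  unfold killedDensity
  split_ifs with h
  · refine exp_apply_nonneg _ (fun a b hab => ?_) _ _
    rw [Matrix.smul_apply, smul_eq_mul]
    exact mul_nonneg ht (hG.offdiag _ _ fun e => hab (Subtype.ext e))
  · exact le_rfl

/-- Kolmogorov's forward equation of the killed chain. -/
theorem hasDerivAt_killedDensity_forward (F : Finset S) (t : ℝ) (x : S) {y : S} (hy : y ∈ F) :
    HasDerivAt (fun s => killedDensity G F s x y)
      (∑ z ∈ F, killedDensity G F t x z * G z y) t := by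
  by_cases hx : x ∈ F
  · simp only [killedDensity_of_mem _ hx hy]
    convert hasDerivAt_exp_smul_apply (Matrix.of fun a b : F => G a b) t ⟨x, hx⟩ ⟨y, hy⟩ using 1
    rw [Matrix.mul_apply, ← Finset.sum_coe_sort F]
    refine Finset.sum_congr rfl fun z _ => ?_
    rw [killedDensity_of_mem _ hx z.2]
    rfl
  · simp only [killedDensity_of_notMem_left F _ _ hx, zero_mul, Finset.sum_const_zero]
    exact hasDerivAt_const _ _

/-- Kolmogorov's backward equation of the killed chain. -/
theorem hasDerivAt_killedDensity_backward (F : Finset S) (t : ℝ) {x : S} (y : S) (hx : x ∈ F) :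
    HasDerivAt (fun s => killedDensity G F s x y)
      (∑ z ∈ F, G x z * killedDensity G F t z y) t := by
  by_cases hy : y ∈ F
  · simp only [killedDensity_of_mem _ hx hy]
    convert hasDerivAt_exp_smul_apply' (Matrix.of fun a b : F => G a b) t ⟨x, hx⟩ ⟨y, hy⟩ using 1
    rw [Matrix.mul_apply, ← Finset.sum_coe_sort F]
    refine Finset.sum_congr rfl fun z _ => ?_
    rw [killedDensity_of_mem _ z.2 hy]
    rfl
  · simp only [killedDensity_of_notMem_right F _ _ hy, mul_zero, Finset.sum_const_zero]
    exact hasDerivAt_const _ _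

theorem continuous_killedDensity (F : Finset S) (x y : S) :
    Continuous fun t => killedDensity G F t x y := by
  by_cases hy : y ∈ F
  · exact continuous_iff_continuousAt.2 fun t =>
      (hasDerivAt_killedDensity_forward F t x hy).continuousAt
  · simp only [killedDensity_of_notMem_right F _ _ hy]
    exact continuous_const

theorem IsRateMatrix.sum_killedDensity_le_one (hG : IsRateMatrix G N) (F : Finset S) {t : ℝ}
    (ht : 0 ≤ t) (x : S) : ∑ y ∈ F, killedDensity G F t x y ≤ 1 := by
  have hd : ∀ s, HasDerivAt (fun s => ∑ y ∈ F, killedDensity G F s x y)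
      (∑ y ∈ F, ∑ z ∈ F, killedDensity G F s x z * G z y) s := fun s =>
    HasDerivAt.fun_sum fun y hy => hasDerivAt_killedDensity_forward F s x hy
  have hanti : AntitoneOn (fun s => ∑ y ∈ F, killedDensity G F s x y) (Set.Ici 0) := by
    refine antitoneOn_of_deriv_nonpos (convex_Ici 0)
      (fun s _ => (hd s).continuousAt.continuousWithinAt)
      (fun s _ => (hd s).differentiableAt.differentiableWithinAt) fun s hs => ?_
    rw [interior_Ici, Set.mem_Ioi] at hs
    rw [(hd s).deriv, Finset.sum_comm]
    refine Finset.sum_nonpos fun z hz => ?_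
    rw [← Finset.mul_sum]
    exact mul_nonpos_of_nonneg_of_nonpos (hG.killedDensity_nonneg F hs.le x z)
      (hG.sum_nonpos hz)
  refine (hanti (Set.mem_Ici.2 le_rfl) (Set.mem_Ici.2 ht) ht).trans ?_
  simp only [killedDensity_zero]
  by_cases hx : x ∈ F
  · simp [hx]
  · simp [hx]

/-- A nonnegative supersolution of the forward equation dominates the killed densities:
`s ↦ ∑ z, g s z * K (t - s) z x` is monotone. -/
theorem IsRateMatrix.killed_le_of_forward (hG : IsRateMatrix G N) (F : Finset S)
    {g : ℝ → S → ℝ} {g' : ℝ → S → ℝ} (hc : ∀ z ∈ F, ContinuousOn (fun s => g s z) (Set.Ici 0))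
    (hd : ∀ z ∈ F, ∀ s, 0 < s → HasDerivAt (fun s => g s z) (g' s z) s)
    (hg : ∀ z ∈ F, ∀ s, 0 < s → ∑ u ∈ F, g s u * G u z ≤ g' s z)
    {t : ℝ} (ht : 0 ≤ t) {x : S} (hx : x ∈ F) :
    ∑ z ∈ F, g 0 z * killedDensity G F t z x ≤ g t x := by
  set ψ : ℝ → ℝ := fun s => ∑ z ∈ F, g s z * killedDensity G F (t - s) z x with hψ
  have hψd : ∀ s, 0 < s → HasDerivAt ψ (∑ z ∈ F, (g' s z * killedDensity G F (t - s) z x +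
      g s z * (∑ u ∈ F, G z u * killedDensity G F (t - s) u x * (-1)))) s := by
    intro s hs
    refine HasDerivAt.fun_sum fun z hz => ?_
    refine (hd z hz s hs).mul ?_
    rw [← Finset.sum_mul]
    exact (hasDerivAt_killedDensity_backward F (t - s) x hz).comp s
      ((hasDerivAt_id s).const_sub t)
  have hmono : MonotoneOn ψ (Set.Icc 0 t) := by
    refine monotoneOn_of_deriv_nonneg (convex_Icc 0 t) ?_ ?_ ?_
    · refine continuousOn_finsetSum _ fun z hz => ?_
      refine ((hc z hz).mono Set.Icc_subset_Ici_self).mul ?_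
      exact ((continuous_killedDensity F z x).comp (continuous_const.sub continuous_id)).continuousOn
    · intro s hs
      rw [interior_Icc] at hs
      exact (hψd s hs.1).differentiableAt.differentiableWithinAt
    · intro s hs
      rw [interior_Icc] at hs
      rw [(hψd s hs.1).deriv, Finset.sum_add_distrib]
      have e : ∑ z ∈ F, g s z * (∑ u ∈ F, G z u * killedDensity G F (t - s) u x * (-1)) =
          - ∑ u ∈ F, (∑ z ∈ F, g s z * G z u) * killedDensity G F (t - s) u x := by
        simp_rw [Finset.mul_sum, Finset.sum_mul]
        rw [Finset.sum_comm, ← Finset.sum_neg_distrib]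
        refine Finset.sum_congr rfl fun u _ => ?_
        rw [← Finset.sum_neg_distrib]
        exact Finset.sum_congr rfl fun z _ => by ring
      rw [e, ← sub_eq_add_neg, ← Finset.sum_sub_distrib]
      refine Finset.sum_nonneg fun z hz => ?_
      rw [← sub_mul]
      exact mul_nonneg (sub_nonneg.2 (hg z hz s hs.1))
        (hG.killedDensity_nonneg F (sub_nonneg.2 hs.2.le) z x)
  have h := hmono (Set.left_mem_Icc.2 ht) (Set.right_mem_Icc.2 ht) ht
  simp only [hψ, sub_zero, sub_self, killedDensity_zero] at h
  refine h.trans_eq ?_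
  rw [Finset.sum_eq_single x]
  · simp [hx]
  · intro z _ hzx; simp [hzx]
  · exact fun h => absurd hx h

theorem IsRateMatrix.killedDensity_mono (hG : IsRateMatrix G N) {F F' : Finset S} (hF : F ⊆ F')
    {t : ℝ} (ht : 0 ≤ t) (x y : S) : killedDensity G F t x y ≤ killedDensity G F' t x y := by
  by_cases hx : x ∈ F
  · by_cases hy : y ∈ F
    · have h := hG.killed_le_of_forward F (g := fun s z => killedDensity G F' s x z)
        (g' := fun s z => ∑ u ∈ F', killedDensity G F' s x u * G u z)
        (fun z _ => (continuous_killedDensity F' x z).continuousOn)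
        (fun z hz s _ => hasDerivAt_killedDensity_forward F' s x (hF hz))
        (fun z hz s hs => Finset.sum_le_sum_of_subset_of_nonneg hF fun u _ hu =>
          mul_nonneg (hG.killedDensity_nonneg F' hs.le x u)
            (hG.offdiag u z fun e => hu (e ▸ hz))) ht hy
      refine le_trans (le_of_eq ?_) h
      rw [Finset.sum_eq_single x]
      · simp [killedDensity_zero, hF hx]
      · intro z _ hzx; simp [killedDensity_zero, Ne.symm hzx]
      · exact fun h => absurd hx h
    · rw [killedDensity_of_notMem_right F t x hy]
      exact hG.killedDensity_nonneg F' ht x y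
  · rw [killedDensity_of_notMem_left F t y hx]
    exact hG.killedDensity_nonneg F' ht x y

end Killed

/-! ### The minimal transition density and the backward equation -/

section Minimal

open Filter Topology

variable {S : Type*} [DecidableEq S] {G : S → S → ℝ} {N : S → Finset S}

theorem IsRateMatrix.killedDensity_le_one (hG : IsRateMatrix G N) (F : Finset S) {t : ℝ}
    (ht : 0 ≤ t) (x y : S) : killedDensity G F t x y ≤ 1 := by
  by_cases hy : y ∈ F
  · exact (Finset.single_le_sum (f := fun y => killedDensity G F t x y)
      (fun z _ => hG.killedDensity_nonneg F ht x z) hy).trans (hG.sum_killedDensity_le_one F ht x)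
  · rw [killedDensity_of_notMem_right F t x hy]; exact zero_le_one

theorem IsRateMatrix.bddAbove_killedDensity (hG : IsRateMatrix G N) {t : ℝ}
    (ht : 0 ≤ t) (x y : S) : BddAbove (Set.range fun F : Finset S => killedDensity G F t x y) :=
  ⟨1, by rintro _ ⟨F, rfl⟩; exact hG.killedDensity_le_one F ht x y⟩

theorem IsRateMatrix.killedDensity_le (hG : IsRateMatrix G N) (F : Finset S) {t : ℝ}
    (ht : 0 ≤ t) (x y : S) : killedDensity G F t x y ≤ transitionDensity G t x y :=
  le_ciSup (hG.bddAbove_killedDensity ht x y) F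

theorem IsRateMatrix.transitionDensity_nonneg (hG : IsRateMatrix G N) {t : ℝ}
    (ht : 0 ≤ t) (x y : S) : 0 ≤ transitionDensity G t x y :=
  (hG.killedDensity_nonneg ∅ ht x y).trans (hG.killedDensity_le ∅ ht x y)

theorem IsRateMatrix.tendsto_killedDensity (hG : IsRateMatrix G N) {t : ℝ}
    (ht : 0 ≤ t) (x y : S) : Tendsto (fun F : Finset S => killedDensity G F t x y) atTop
      (𝓝 (transitionDensity G t x y)) :=
  tendsto_atTop_ciSup (fun _ _ h => hG.killedDensity_mono h ht x y)
    (hG.bddAbove_killedDensity ht x y)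

theorem transitionDensity_zero (x y : S) :
    transitionDensity G 0 x y = if x = y then 1 else 0 := by
  unfold transitionDensity
  simp only [killedDensity_zero]
  split_ifs with h
  · refine le_antisymm (ciSup_le fun F => ?_) ?_
    · split_ifs <;> norm_num
    · refine le_ciSup_of_le ⟨1, ?_⟩ {x} (by simp [h])
      rintro _ ⟨F, rfl⟩
      dsimp only
      split_ifs <;> norm_num
  · simp [h]

theorem IsRateMatrix.sum_transitionDensity_le_one (hG : IsRateMatrix G N) {t : ℝ}
    (ht : 0 ≤ t) (x : S) (s : Finset S) : ∑ y ∈ s, transitionDensity G t x y ≤ 1 := by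
  have h : Tendsto (fun F : Finset S => ∑ y ∈ s, killedDensity G F t x y) atTop
      (𝓝 (∑ y ∈ s, transitionDensity G t x y)) :=
    tendsto_finsetSum _ fun y _ => hG.tendsto_killedDensity ht x y
  refine le_of_tendsto h (Eventually.of_forall fun F => ?_)
  refine le_trans ?_ (hG.sum_killedDensity_le_one F ht x)
  rw [← Finset.sum_subset (Finset.inter_subset_left : s ∩ F ⊆ s)]
  · exact Finset.sum_le_sum_of_subset_of_nonneg Finset.inter_subset_right fun y _ _ =>
      hG.killedDensity_nonneg F ht x y
  · intro y hy hy'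
    exact killedDensity_of_notMem_right F t x fun h => hy' (Finset.mem_inter.2 ⟨hy, h⟩)

theorem IsRateMatrix.summable_transitionDensity (hG : IsRateMatrix G N) {t : ℝ}
    (ht : 0 ≤ t) (x : S) : Summable fun y => transitionDensity G t x y :=
  summable_of_sum_le (fun y => hG.transitionDensity_nonneg ht x y)
    (fun s => hG.sum_transitionDensity_le_one ht x s)

theorem IsRateMatrix.summable_transitionDensity_mul (hG : IsRateMatrix G N) {t : ℝ}
    (ht : 0 ≤ t) (x : S) {f : S → ℝ} {M : ℝ} (hf : ∀ y, |f y| ≤ M) :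
    Summable fun y => transitionDensity G t x y * f y := by
  refine Summable.of_norm_bounded ((hG.summable_transitionDensity ht x).mul_right M) fun y => ?_
  rw [norm_mul, Real.norm_eq_abs, Real.norm_eq_abs,
    abs_of_nonneg (hG.transitionDensity_nonneg ht x y)]
  exact mul_le_mul_of_nonneg_left (hf y) (hG.transitionDensity_nonneg ht x y)

/-- The semigroup `(P_t f)(x)` of the minimal chain with rate matrix `G`. -/
def semi (G : S → S → ℝ) (f : S → ℝ) (t : ℝ) (x : S) : ℝ :=
  ∑' y, transitionDensity G t x y * f y

theorem semi_zero (f : S → ℝ) (x : S) : semi G f 0 x = f x := by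
  unfold semi
  rw [tsum_eq_single x]
  · simp [transitionDensity_zero]
  · intro y hy; simp [transitionDensity_zero, Ne.symm hy]

/-- A bounded solution, on the set `C` of states, of Kolmogorov's backward equation. -/
structure IsBackwardSolution (G : S → S → ℝ) (N : S → Finset S) (C : Set S)
    (u : ℝ → S → ℝ) : Prop where
  cont : ∀ x ∈ C, ContinuousOn (fun t => u t x) (Set.Ici 0)
  deriv : ∀ x ∈ C, ∀ t, 0 < t → HasDerivAt (fun s => u s x) (gen G N (u t) x) t
  bdd : ∃ M, ∀ x ∈ C, ∀ t, 0 ≤ t → |u t x| ≤ M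

variable [Countable S]

/-- The integrated backward equations of the killed chains pass to the limit. -/
theorem IsRateMatrix.isBackwardSolution_semi (hG : IsRateMatrix G N) {f : S → ℝ} {M : ℝ}
    (hf : ∀ y, |f y| ≤ M) : IsBackwardSolution G N Set.univ (semi G f) := by
  have hM : ∀ x : S, 0 ≤ M := fun x => (abs_nonneg _).trans (hf x)
  set v : Finset S → ℝ → S → ℝ := fun F t x => ∑ y ∈ F, killedDensity G F t x y * f y with hv
  have hv0 : ∀ F t x, x ∉ F → v F t x = 0 := fun F t x hx =>
    Finset.sum_eq_zero fun y _ => by rw [killedDensity_of_notMem_left F t y hx, zero_mul]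
  have hvb : ∀ F t x, 0 ≤ t → |v F t x| ≤ M := by
    intro F t x ht
    refine (Finset.abs_sum_le_sum_abs _ _).trans ?_
    calc ∑ y ∈ F, |killedDensity G F t x y * f y| ≤ ∑ y ∈ F, killedDensity G F t x y * M := by
          refine Finset.sum_le_sum fun y _ => ?_
          rw [abs_mul, abs_of_nonneg (hG.killedDensity_nonneg F ht x y)]
          exact mul_le_mul_of_nonneg_left (hf y) (hG.killedDensity_nonneg F ht x y)
      _ = (∑ y ∈ F, killedDensity G F t x y) * M := by rw [Finset.sum_mul]
      _ ≤ 1 * M := mul_le_mul_of_nonneg_right (hG.sum_killedDensity_le_one F ht x) (hM x)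
      _ = M := one_mul M
  have hvlim : ∀ t x, 0 ≤ t → Tendsto (fun F => v F t x) atTop (𝓝 (semi G f t x)) := by
    intro t x ht
    have h1 : ∀ F, v F t x = ∑' y, killedDensity G F t x y * f y := fun F => by
      rw [tsum_eq_sum (s := F)]
      intro y hy
      rw [killedDensity_of_notMem_right F t x hy, zero_mul]
    simp only [h1]
    refine tendsto_tsum_of_dominated_convergence
      (bound := fun y => transitionDensity G t x y * M)
      ((hG.summable_transitionDensity ht x).mul_right M)
      (fun y => (hG.tendsto_killedDensity ht x y).mul_const _) (Eventually.of_forall fun F y => ?_)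
    rw [norm_mul, Real.norm_eq_abs, Real.norm_eq_abs,
      abs_of_nonneg (hG.killedDensity_nonneg F ht x y)]
    exact mul_le_mul (hG.killedDensity_le F ht x y) (hf y) (abs_nonneg _)
      (hG.transitionDensity_nonneg ht x y)
  have hvd : ∀ F t x, x ∈ F → HasDerivAt (fun s => v F s x) (gen G N (v F t) x) t := by
    intro F t x hx
    rw [← hG.sum_eq_gen (fun y hy => hv0 F t y hy)]
    have : HasDerivAt (fun s => v F s x)
        (∑ y ∈ F, (∑ z ∈ F, G x z * killedDensity G F t z y) * f y) t :=
      HasDerivAt.fun_sum fun y _ => (hasDerivAt_killedDensity_backward F t y hx).mul_const _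
    convert this using 1
    simp_rw [hv, Finset.mul_sum, Finset.sum_mul]
    rw [Finset.sum_comm]
    exact Finset.sum_congr rfl fun y _ => Finset.sum_congr rfl fun z _ => by ring
  have hvc : ∀ F x, Continuous fun t => v F t x := fun F x =>
    continuous_finsetSum _ fun y _ => (continuous_killedDensity F x y).mul continuous_const
  have hgc : ∀ F x, Continuous fun t => gen G N (v F t) x := fun F x =>
    continuous_finsetSum _ fun y _ => continuous_const.mul (hvc F y)
  set B : S → ℝ := fun x => ∑ y ∈ N x, |G x y| * M with hB
  have hgenb : ∀ (w : S → ℝ) x, (∀ y, |w y| ≤ M) → |gen G N w x| ≤ B x := by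
    intro w x hw
    refine (Finset.abs_sum_le_sum_abs _ _).trans (Finset.sum_le_sum fun y _ => ?_)
    rw [abs_mul]
    exact mul_le_mul_of_nonneg_left (hw y) (abs_nonneg _)
  have hub : ∀ t x, 0 ≤ t → |semi G f t x| ≤ M := fun t x ht =>
    le_of_tendsto (hvlim t x ht).abs (Eventually.of_forall fun F => hvb F t x ht)
  -- The solution is Lipschitz in time, uniformly over the finite sets `F`.
  have hlip : ∀ x s t, 0 ≤ s → s ≤ t → |semi G f t x - semi G f s x| ≤ B x * (t - s) := by
    intro x s t hs hst
    refine le_of_tendsto ((hvlim t x (hs.trans hst)).sub (hvlim s x hs)).abs ?_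
    filter_upwards [eventually_ge_atTop ({x} : Finset S)] with F hF
    have hxF : x ∈ F := hF (Finset.mem_singleton_self x)
    have := norm_image_sub_le_of_norm_deriv_le_segment' (f := fun s => v F s x)
      (f' := fun s => gen G N (v F s) x) (a := s) (b := t) (C := B x)
      (fun r _ => (hvd F r x hxF).hasDerivWithinAt)
      (fun r hr => hgenb _ x fun y => hvb F r y (hs.trans hr.1)) t (Set.right_mem_Icc.2 hst)
    simpa [Real.norm_eq_abs] using this
  have hcont : ∀ x, ContinuousOn (fun t => semi G f t x) (Set.Ici 0) := by
    intro x
    have hl : LipschitzOnWith (Real.toNNReal (B x)) (fun t => semi G f t x) (Set.Ici 0) := by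
      refine LipschitzOnWith.of_dist_le_mul fun t ht s hs => ?_
      have hB0 : 0 ≤ B x := Finset.sum_nonneg fun y _ => mul_nonneg (abs_nonneg _) (hM x)
      rw [Real.coe_toNNReal _ hB0, Real.dist_eq, Real.dist_eq]
      rcases le_total s t with h | h
      · rw [abs_of_nonneg (sub_nonneg.2 h)]
        exact hlip x s t hs h
      · rw [abs_sub_comm, abs_sub_comm t s, abs_of_nonneg (sub_nonneg.2 h)]
        exact hlip x t s ht h
    exact hl.continuousOn
  -- The solution is frozen at negative times, to work with continuous functions on the line.
  set w : ℝ → S → ℝ := fun t x => semi G f (max t 0) x with hw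
  have hwc : ∀ x, Continuous fun t => w t x := fun x =>
    (hcont x).comp_continuous (continuous_id.max continuous_const) fun t => le_max_right t 0
  have hwg : ∀ x, Continuous fun t => gen G N (w t) x := fun x =>
    continuous_finsetSum _ fun y _ => continuous_const.mul (hwc y)
  have hint : ∀ x t, 0 ≤ t → w t x = f x + ∫ s in (0 : ℝ)..t, gen G N (w s) x := by
    intro x t ht
    have hl : Tendsto (fun F => ∫ s in (0 : ℝ)..t, gen G N (v F s) x) atTop
        (𝓝 (∫ s in (0 : ℝ)..t, gen G N (w s) x)) := by
      refine intervalIntegral.tendsto_integral_filter_of_dominated_convergence (fun _ => B x)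
        (Eventually.of_forall fun F => (hgc F x).aestronglyMeasurable)
        (Eventually.of_forall fun F => MeasureTheory.ae_of_all _ fun s hs => ?_)
        intervalIntegrable_const (MeasureTheory.ae_of_all _ fun s hs => ?_)
      · rw [Set.uIoc_of_le ht] at hs
        exact hgenb _ x fun y => hvb F s y hs.1.le
      · rw [Set.uIoc_of_le ht] at hs
        refine tendsto_finsetSum _ fun y _ => ?_
        simp only [hw, max_eq_left hs.1.le]
        exact (hvlim s y hs.1.le).const_mul _
    have hr : Tendsto (fun F => ∫ s in (0 : ℝ)..t, gen G N (v F s) x) atTop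
        (𝓝 (w t x - f x)) := by
      have h1 : Tendsto (fun F => v F t x - v F 0 x) atTop (𝓝 (w t x - f x)) := by
        have h2 := (hvlim t x ht).sub (hvlim 0 x le_rfl)
        rw [semi_zero] at h2
        simpa only [hw, max_eq_left ht] using h2
      refine h1.congr' ?_
      filter_upwards [eventually_ge_atTop ({x} : Finset S)] with F hF
      exact (intervalIntegral.integral_eq_sub_of_hasDerivAt
        (fun s _ => hvd F s x (hF (Finset.mem_singleton_self x)))
        ((hgc F x).intervalIntegrable _ _)).symm
    rw [tendsto_nhds_unique hl hr]; ring
  refine ⟨fun x _ => hcont x, fun x _ t ht => ?_, M, fun x _ t ht => hub t x ht⟩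
  have hd : HasDerivAt (fun r => f x + ∫ s in (0 : ℝ)..r, gen G N (w s) x)
      (gen G N (w t) x) t :=
    ((hwg x).integral_hasStrictDerivAt 0 t).hasDerivAt.const_add _
  have e : gen G N (w t) x = gen G N (semi G f t) x := by
    simp only [hw, max_eq_left ht.le]
  rw [e] at hd
  refine hd.congr_of_eventuallyEq ?_
  filter_upwards [eventually_gt_nhds ht] with r hr
  rw [← hint x r hr.le]
  simp only [hw, max_eq_left hr.le]

end Minimal

/-! ### Uniqueness for the backward equation -/

section Uniqueness

open Filter Topology

variable {S : Type*} {G : S → S → ℝ} {N : S → Finset S}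

/-- A Lyapunov function: `φ ≥ 1` has finite sublevel sets and `G φ ≤ φ`. It forbids explosion. -/
structure IsLyapunov (G : S → S → ℝ) (N : S → Finset S) (φ : S → ℝ) : Prop where
  one_le : ∀ x, 1 ≤ φ x
  finite : ∀ M : ℝ, {x | φ x ≤ M}.Finite
  gen_le : ∀ x, gen G N φ x ≤ φ x

/-- `C` cannot be left by the chain with rate matrix `G`. -/
def IsClosedFor (G : S → S → ℝ) (C : Set S) : Prop := ∀ x ∈ C, ∀ y, G x y ≠ 0 → y ∈ C

theorem isClosedFor_univ (G : S → S → ℝ) : IsClosedFor G Set.univ := fun _ _ y _ => Set.mem_univ y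

theorem gen_sub (f g : S → ℝ) (x : S) :
    gen G N (fun y => f y - g y) x = gen G N f x - gen G N g x := by
  simp only [gen, mul_sub, Finset.sum_sub_distrib]

theorem gen_const_mul (c : ℝ) (f : S → ℝ) (x : S) :
    gen G N (fun y => c * f y) x = c * gen G N f x := by
  simp only [gen, Finset.mul_sum]
  exact Finset.sum_congr rfl fun y _ => by ring

theorem IsRateMatrix.gen_nonpos_of_max (hG : IsRateMatrix G N) {C : Set S}
    (hC : IsClosedFor G C) {f : S → ℝ} {x : S} (hx : x ∈ C) (hmax : ∀ y ∈ C, f y ≤ f x) :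
    gen G N f x ≤ 0 := by
  have h : gen G N f x = ∑ y ∈ N x, G x y * (f y - f x) := by
    simp only [mul_sub, Finset.sum_sub_distrib]
    rw [← Finset.sum_mul, hG.row_sum, zero_mul, sub_zero]; rfl
  rw [h]
  refine Finset.sum_nonpos fun y _ => ?_
  by_cases hxy : x = y
  · rw [hxy]; simp
  · by_cases h0 : G x y = 0
    · rw [h0, zero_mul]
    · exact mul_nonpos_of_nonneg_of_nonpos (hG.offdiag x y hxy)
        (sub_nonpos.2 (hmax y (hC x hx y h0)))

/-- Maximum principle: `w = v - ε e^{2t} φ` cannot reach `0`. It is negative off a finite set of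
states, and since `G φ ≤ φ < 2 φ`, its time derivative would be negative at a nonnegative
maximum. -/
theorem IsRateMatrix.backward_nonpos (hG : IsRateMatrix G N) {φ : S → ℝ}
    (hφ : IsLyapunov G N φ) {C : Set S} (hC : IsClosedFor G C) {v : ℝ → S → ℝ}
    (hv : IsBackwardSolution G N C v) (h0 : ∀ x ∈ C, v 0 x ≤ 0) {t : ℝ} (ht : 0 ≤ t) {x : S}
    (hx : x ∈ C) : v t x ≤ 0 := by
  obtain ⟨M, hM⟩ := hv.bdd
  have key : ∀ ε : ℝ, 0 < ε → v t x < ε * (Real.exp (2 * t) * φ x) := by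
    intro ε hε
    by_contra! hcon
    set w : ℝ → S → ℝ := fun s y => v s y - ε * Real.exp (2 * s) * φ y with hw
    have hwneg : ∀ s, 0 ≤ s → ∀ y ∈ C, M / ε < φ y → w s y < 0 := by
      intro s hs y hy hyM
      have h1 : v s y ≤ M := (le_abs_self _).trans (hM y hy s hs)
      have h2 : M < ε * φ y := by rwa [div_lt_iff₀' hε] at hyM
      have h3 : ε * φ y ≤ ε * Real.exp (2 * s) * φ y := by
        have : 1 ≤ Real.exp (2 * s) := Real.one_le_exp (by linarith)
        have h4 : 0 < ε * φ y := mul_pos hε (by linarith [hφ.one_le y])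
        nlinarith
      simp only [hw]; linarith
    have hfin : (C ∩ {y | φ y ≤ M / ε}).Finite := (hφ.finite (M / ε)).subset Set.inter_subset_right
    have hwx : 0 ≤ w t x := by simp only [hw]; linarith
    have hxA : x ∈ C ∩ {y | φ y ≤ M / ε} := by
      refine ⟨hx, ?_⟩
      by_contra h
      exact absurd (hwneg t ht x hx (not_le.1 h)) (not_lt.2 hwx)
    -- the maximum of `w` over time and the finitely many relevant states
    have hmaxy : ∀ y ∈ C, ∃ s ∈ Set.Icc 0 t, ∀ r ∈ Set.Icc 0 t, w r y ≤ w s y := by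
      intro y hy
      have hcont : ContinuousOn (fun s => w s y) (Set.Icc 0 t) :=
        ((hv.cont y hy).mono Set.Icc_subset_Ici_self).sub (by fun_prop)
      obtain ⟨s, hs, hm⟩ := isCompact_Icc.exists_isMaxOn (Set.nonempty_Icc.2 ht) hcont
      exact ⟨s, hs, fun r hr => hm hr⟩
    choose! σ hσ hσmax using hmaxy
    obtain ⟨y, hyA, hymax⟩ := Set.exists_max_image _ (fun y => w (σ y) y) hfin ⟨x, hxA⟩
    have hyC : y ∈ C := hyA.1
    have hpos : 0 ≤ w (σ y) y :=
      hwx.trans ((hσmax x hx t (Set.right_mem_Icc.2 ht)).trans (hymax x hxA))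
    have hσ0 : 0 < σ y := by
      rcases (hσ y hyC).1.lt_or_eq with h | h
      · exact h
      · exfalso
        rw [← h] at hpos
        have h5 : 0 < ε * Real.exp (2 * 0) * φ y :=
          mul_pos (mul_pos hε (Real.exp_pos _)) (by linarith [hφ.one_le y])
        have := h0 y hyC
        simp only [hw] at hpos
        linarith
    set s := σ y with hs
    have hmaxS : ∀ z ∈ C, w s z ≤ w s y := by
      intro z hz
      by_cases hzA : φ z ≤ M / ε
      · exact (hσmax z hz s (hσ y hyC)).trans (hymax z ⟨hz, hzA⟩)
      · exact (hwneg s hσ0.le z hz (not_le.1 hzA)).le.trans hpos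
    have hwd : HasDerivAt (fun r => w r y)
        (gen G N (v s) y - ε * (Real.exp (2 * s) * 2) * φ y) s := by
      refine (hv.deriv y hyC s hσ0).sub ?_
      have h6 : HasDerivAt (fun r : ℝ => Real.exp (2 * r)) (Real.exp (2 * s) * 2) s := by
        simpa using ((hasDerivAt_id s).const_mul 2).exp
      exact (h6.const_mul ε).mul_const _
    have hdpos : 0 ≤ gen G N (v s) y - ε * (Real.exp (2 * s) * 2) * φ y := by
      have hslope := (hasDerivAt_iff_tendsto_slope_left_right.1 hwd).1
      refine ge_of_tendsto hslope ?_
      have : Set.Ioo 0 s ∈ 𝓝[<] s := Ioo_mem_nhdsLT hσ0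
      filter_upwards [this] with r hr
      have h7 := hσmax y hyC r ⟨hr.1.le, hr.2.le.trans (hσ y hyC).2⟩
      rw [slope_def_field]
      exact div_nonneg_of_nonpos (sub_nonpos.2 h7) (sub_nonpos.2 hr.2.le)
    have hgen : gen G N (w s) y ≤ 0 := hG.gen_nonpos_of_max hC hyC hmaxS
    rw [hw, gen_sub, gen_const_mul] at hgen
    have h8 := hφ.gen_le y
    have h9 : 0 < ε * Real.exp (2 * s) := mul_pos hε (Real.exp_pos _)
    have h10 := hφ.one_le y
    nlinarith
  have hpos : 0 < Real.exp (2 * t) * φ x :=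
    mul_pos (Real.exp_pos _) (by linarith [hφ.one_le x])
  by_contra! hcon
  have := key (v t x / (Real.exp (2 * t) * φ x)) (div_pos hcon hpos)
  rw [div_mul_cancel₀ _ hpos.ne'] at this
  exact lt_irrefl _ this

theorem IsBackwardSolution.sub {C : Set S} {u v : ℝ → S → ℝ} (hu : IsBackwardSolution G N C u)
    (hv : IsBackwardSolution G N C v) : IsBackwardSolution G N C fun t x => u t x - v t x := by
  obtain ⟨M, hM⟩ := hu.bdd
  obtain ⟨M', hM'⟩ := hv.bdd
  refine ⟨fun x hx => (hu.cont x hx).sub (hv.cont x hx), fun x hx t ht => ?_, M + M',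
    fun x hx t ht => ?_⟩
  · rw [gen_sub]; exact (hu.deriv x hx t ht).sub (hv.deriv x hx t ht)
  · exact (abs_sub _ _).trans (add_le_add (hM x hx t ht) (hM' x hx t ht))

theorem IsBackwardSolution.mono {C C' : Set S} {u : ℝ → S → ℝ} (hu : IsBackwardSolution G N C u)
    (h : C' ⊆ C) : IsBackwardSolution G N C' u :=
  ⟨fun x hx => hu.cont x (h hx), fun x hx => hu.deriv x (h hx),
    hu.bdd.imp fun _ hM x hx => hM x (h hx)⟩

theorem IsRateMatrix.backward_unique (hG : IsRateMatrix G N) {φ : S → ℝ}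
    (hφ : IsLyapunov G N φ) {C : Set S} (hC : IsClosedFor G C) {u v : ℝ → S → ℝ}
    (hu : IsBackwardSolution G N C u) (hv : IsBackwardSolution G N C v)
    (h0 : ∀ x ∈ C, u 0 x = v 0 x) {t : ℝ} (ht : 0 ≤ t) {x : S} (hx : x ∈ C) : u t x = v t x :=
  le_antisymm
    (sub_nonpos.1 (hG.backward_nonpos hφ hC (hu.sub hv) (fun y hy => by rw [h0 y hy, sub_self])
      ht hx))
    (sub_nonpos.1 (hG.backward_nonpos hφ hC (hv.sub hu) (fun y hy => by rw [h0 y hy, sub_self])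
      ht hx))

variable [DecidableEq S] [Countable S]

theorem IsRateMatrix.semi_eq (hG : IsRateMatrix G N) {φ : S → ℝ} (hφ : IsLyapunov G N φ)
    {C : Set S} (hC : IsClosedFor G C) {u : ℝ → S → ℝ} (hu : IsBackwardSolution G N C u)
    {f : S → ℝ} {M : ℝ} (hf : ∀ y, |f y| ≤ M) (h0 : ∀ x ∈ C, u 0 x = f x) {t : ℝ} (ht : 0 ≤ t)
    {x : S} (hx : x ∈ C) : semi G f t x = u t x :=
  hG.backward_unique hφ hC ((hG.isBackwardSolution_semi hf).mono (Set.subset_univ C)) hu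
    (fun y hy => by rw [semi_zero, h0 y hy]) ht hx

/-- A chain with a Lyapunov function does not explode. -/
theorem IsRateMatrix.hasSum_transitionDensity (hG : IsRateMatrix G N) {φ : S → ℝ}
    (hφ : IsLyapunov G N φ) {t : ℝ} (ht : 0 ≤ t) (x : S) :
    HasSum (fun y => transitionDensity G t x y) 1 := by
  have h1 : IsBackwardSolution G N Set.univ fun _ _ => (1 : ℝ) := by
    refine ⟨fun _ _ => continuousOn_const, fun y _ s _ => ?_, 1, fun _ _ _ _ => by simp⟩
    have : gen G N (fun _ => (1 : ℝ)) y = 0 := by simpa [gen] using hG.row_sum y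
    rw [this]
    exact hasDerivAt_const _ _
  have h2 := hG.semi_eq hφ (isClosedFor_univ G) h1 (f := fun _ => 1) (M := 1) (by simp)
    (fun _ _ => rfl) ht (Set.mem_univ x)
  rw [← h2]
  simpa [semi] using (hG.summable_transitionDensity ht x).hasSum

/-- A closed set is never left. -/
theorem IsRateMatrix.transitionDensity_eq_zero (hG : IsRateMatrix G N) {φ : S → ℝ}
    (hφ : IsLyapunov G N φ) {C : Set S} (hC : IsClosedFor G C) {t : ℝ} (ht : 0 ≤ t) {x y : S}
    (hx : x ∈ C) (hy : y ∉ C) : transitionDensity G t x y = 0 := by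
  have h1 : IsBackwardSolution G N C fun _ _ => (0 : ℝ) := by
    refine ⟨fun _ _ => continuousOn_const, fun y _ s _ => ?_, 0, fun _ _ _ _ => by simp⟩
    have : gen G N (fun _ => (0 : ℝ)) y = 0 := by simp [gen]
    rw [this]
    exact hasDerivAt_const _ _
  have h2 := hG.semi_eq hφ hC h1 (f := fun z => if z = y then 1 else 0) (M := 1)
    (fun z => by split_ifs <;> simp) (fun z hz => by
      rw [if_neg]; rintro rfl; exact hy hz) ht hx
  rw [← h2]
  simp [semi]

end Uniqueness

/-! ### Generators of the chain and of the coalescing flow -/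

section Generators

variable {lam mu : ℤ → ℝ}

/-- The support of row `x` of `bdGenerator`. -/
def bdSupp (x : ℤ) : Finset ℤ := {x - 1, x, x + 1}

theorem gen_bd (f : ℤ → ℝ) (x : ℤ) : gen (bdGenerator lam mu) bdSupp f x =
    lam x * (f (x + 1) - f x) + mu x * (f (x - 1) - f x) := by
  have h1 : x - 1 ∉ ({x, x + 1} : Finset ℤ) := by simp; omega
  have h2 : x ∉ ({x + 1} : Finset ℤ) := by simp
  rw [gen, bdSupp, Finset.sum_insert h1, Finset.sum_insert h2, Finset.sum_singleton]
  have e1 : bdGenerator lam mu x (x - 1) = mu x := by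
    rw [bdGenerator, if_neg (by omega), if_neg (by omega), if_pos rfl]
  have e2 : bdGenerator lam mu x x = -lam x - mu x := by
    rw [bdGenerator, if_neg (by omega), if_pos rfl]
  have e3 : bdGenerator lam mu x (x + 1) = lam x := by rw [bdGenerator, if_pos rfl]
  rw [e1, e2, e3]; ring

theorem isRateMatrix_bd (hl : ∀ x, 0 ≤ lam x) (hm : ∀ x, 0 ≤ mu x) :
    IsRateMatrix (bdGenerator lam mu) bdSupp where
  offdiag x y hxy := by
    unfold bdGenerator
    split_ifs with h1 h2 h3
    · exact hl x
    · exact absurd h2.symm hxy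
    · exact hm x
    · exact le_rfl
  supp x y hy := by
    simp only [bdSupp, Finset.mem_insert, Finset.mem_singleton, not_or] at hy
    rw [bdGenerator, if_neg hy.2.2, if_neg hy.2.1, if_neg hy.1]
  row_sum x := by
    have h := gen_bd (lam := lam) (mu := mu) (fun _ => 1) x
    simpa [gen] using h

variable {ι κ : Type*} [Fintype ι] [Fintype κ]

/-- The support of row `z` of `coalescingGenerator`. -/
def coalSupp (z : ι → ℤ) : Finset (ι → ℤ) :=
  insert z ((Finset.univ.image z).biUnion fun s => {moveCluster s 1 z, moveCluster s (-1) z})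

theorem gen_coal (f : (ι → ℤ) → ℝ) (z : ι → ℤ) :
    gen (coalescingGenerator lam mu) coalSupp f z = ∑ s ∈ Finset.univ.image z,
      (lam s * (f (moveCluster s 1 z) - f z) + mu s * (f (moveCluster s (-1) z) - f z)) := by
  unfold gen coalescingGenerator
  simp_rw [Finset.sum_mul]
  rw [Finset.sum_comm]
  refine Finset.sum_congr rfl fun s hs => ?_
  have hz : z ∈ coalSupp z := Finset.mem_insert_self _ _
  have h1 : moveCluster s 1 z ∈ coalSupp z :=
    Finset.mem_insert_of_mem (Finset.mem_biUnion.2 ⟨s, hs, by simp⟩)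
  have h2 : moveCluster s (-1) z ∈ coalSupp z :=
    Finset.mem_insert_of_mem (Finset.mem_biUnion.2 ⟨s, hs, by simp⟩)
  have hsum : ∀ a ∈ coalSupp z,
      ∑ w ∈ coalSupp z, (if w = a then (1 : ℝ) else 0) * f w = f a := by
    intro a ha
    simp [ha]
  rw [← hsum _ h1, ← hsum _ h2, ← hsum _ hz, ← Finset.sum_sub_distrib, ← Finset.sum_sub_distrib,
    Finset.mul_sum, Finset.mul_sum, ← Finset.sum_add_distrib]
  exact Finset.sum_congr rfl fun w _ => by ring

theorem isRateMatrix_coal (hl : ∀ x, 0 ≤ lam x) (hm : ∀ x, 0 ≤ mu x) :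
    IsRateMatrix (coalescingGenerator (ι := ι) lam mu) coalSupp where
  offdiag z w hzw := by
    refine Finset.sum_nonneg fun s _ => ?_
    rw [if_neg (Ne.symm hzw), sub_zero, sub_zero]
    exact add_nonneg (mul_nonneg (hl s) (by split_ifs <;> norm_num))
      (mul_nonneg (hm s) (by split_ifs <;> norm_num))
  supp z w hw := by
    simp only [coalSupp, Finset.mem_insert, Finset.mem_biUnion, Finset.mem_singleton, not_or,
      not_exists, not_and] at hw
    refine Finset.sum_eq_zero fun s hs => ?_
    rw [if_neg (hw.2 s hs).1, if_neg (hw.2 s hs).2, if_neg hw.1]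
    ring
  row_sum z := by
    have h := gen_coal (lam := lam) (mu := mu) (fun _ => 1) z
    simpa [gen] using h

/-- The only transitions of the coalescing motion are jumps of clusters. -/
theorem coal_closed {C : Set (ι → ℤ)}
    (h1 : ∀ z ∈ C, ∀ i, lam (z i) ≠ 0 → moveCluster (z i) 1 z ∈ C)
    (h2 : ∀ z ∈ C, ∀ i, mu (z i) ≠ 0 → moveCluster (z i) (-1) z ∈ C) :
    IsClosedFor (coalescingGenerator lam mu) C := by
  intro z hz w hw
  by_contra hwC
  refine hw (Finset.sum_eq_zero fun s hs => ?_)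
  obtain ⟨i, _, rfl⟩ := Finset.mem_image.1 hs
  rw [if_neg (show w ≠ z from fun e => hwC (e ▸ hz))]
  have e1 : lam (z i) * ((if w = moveCluster (z i) 1 z then 1 else 0) - 0) = 0 := by
    by_cases h : lam (z i) = 0
    · rw [h, zero_mul]
    · rw [if_neg (by rintro rfl; exact hwC (h1 z hz i h))]; ring
  have e2 : mu (z i) * ((if w = moveCluster (z i) (-1) z then 1 else 0) - 0) = 0 := by
    by_cases h : mu (z i) = 0
    · rw [h, zero_mul]
    · rw [if_neg (by rintro rfl; exact hwC (h2 z hz i h))]; ring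
  rw [e1, e2, add_zero]

theorem coal_closed_le (i j : ι) :
    IsClosedFor (coalescingGenerator lam mu) {z : ι → ℤ | z i ≤ z j} := by
  refine coal_closed (fun z hz k _ => ?_) (fun z hz k _ => ?_) <;>
  · simp only [Set.mem_ofPred_eq, moveCluster] at hz ⊢
    split_ifs <;> omega

theorem coal_closed_mem {I : Set ℤ} (hl : ∀ x ∈ I, lam x ≠ 0 → x + 1 ∈ I)
    (hm : ∀ x ∈ I, mu x ≠ 0 → x - 1 ∈ I) (i : ι) :
    IsClosedFor (coalescingGenerator lam mu) {z : ι → ℤ | z i ∈ I} := by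
  refine coal_closed (fun z hz k hk => ?_) (fun z hz k hk => ?_)
  · simp only [Set.mem_ofPred_eq, moveCluster] at hz ⊢
    split_ifs with h
    · exact hl _ hz (h ▸ hk)
    · exact hz
  · simp only [Set.mem_ofPred_eq, moveCluster] at hz ⊢
    split_ifs with h
    · exact hm _ hz (h ▸ hk)
    · exact hz

theorem coal_closed_monotone {n : ℕ} :
    IsClosedFor (coalescingGenerator lam mu) {z : Fin n → ℤ | Monotone z} := by
  intro z hz w hw i j hij
  exact coal_closed_le i j z (hz hij) w hw

/-- Each particle of a cluster contributes the one-particle generator to a sum. -/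
theorem gen_coal_sum (φ : ℤ → ℝ) (z : ι → ℤ) :
    gen (coalescingGenerator lam mu) coalSupp (fun z => 1 + ∑ i, φ (z i)) z =
      ∑ i, gen (bdGenerator lam mu) bdSupp φ (z i) := by
  have hfib := Finset.sum_fiberwise_of_maps_to (s := Finset.univ) (g := z)
    (t := Finset.univ.image z) (fun i _ => Finset.mem_image_of_mem z (Finset.mem_univ i))
    fun i => gen (bdGenerator lam mu) bdSupp φ (z i)
  rw [gen_coal, ← hfib]
  refine Finset.sum_congr rfl fun s _ => ?_
  have hmove : ∀ d : ℤ, (1 + ∑ i, φ (moveCluster s d z i)) - (1 + ∑ i, φ (z i)) =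
      ∑ i ∈ Finset.univ.filter (fun i => z i = s), (φ (s + d) - φ s) := by
    intro d
    rw [add_sub_add_left_eq_sub, ← Finset.sum_sub_distrib, Finset.sum_filter]
    refine Finset.sum_congr rfl fun i _ => ?_
    by_cases h : z i = s
    · simp [moveCluster, h]
    · simp [moveCluster, h]
  rw [hmove, hmove, Finset.mul_sum, Finset.mul_sum, ← Finset.sum_add_distrib]
  refine Finset.sum_congr rfl fun i hi => ?_
  rw [(Finset.mem_filter.1 hi).2, gen_bd]
  rfl

theorem isLyapunov_coal {φ : ℤ → ℝ} (hφ : IsLyapunov (bdGenerator lam mu) bdSupp φ) :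
    IsLyapunov (coalescingGenerator (ι := ι) lam mu) coalSupp
      (fun z => 1 + ∑ i, φ (z i)) where
  one_le z := by
    have : 0 ≤ ∑ i, φ (z i) := Finset.sum_nonneg fun i _ => by linarith [hφ.one_le (z i)]
    linarith
  finite M := by
    refine (Set.Finite.pi (t := fun _ : ι => {x | φ x ≤ M}) fun _ => hφ.finite M).subset ?_
    intro z hz i _
    have : φ (z i) ≤ ∑ i, φ (z i) :=
      Finset.single_le_sum (f := fun i => φ (z i))
        (fun i _ => by linarith [hφ.one_le (z i)]) (Finset.mem_univ i)
    simp only [Set.mem_ofPred_eq] at hz ⊢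
    linarith
  gen_le z := by
    rw [gen_coal_sum]
    have := Finset.sum_le_sum fun i (_ : i ∈ Finset.univ) => hφ.gen_le (z i)
    linarith

theorem gen_coal_comp (σ : κ → ι) (g : (κ → ℤ) → ℝ) (z : ι → ℤ) :
    gen (coalescingGenerator lam mu) coalSupp (fun z : ι → ℤ => g (z ∘ σ)) z =
      gen (coalescingGenerator lam mu) coalSupp g (z ∘ σ) := by
  have hm : ∀ s d, moveCluster s d z ∘ σ = moveCluster s d (z ∘ σ) := fun s d => rfl
  rw [gen_coal, gen_coal]
  simp only [hm]
  symm
  refine Finset.sum_subset (fun s hs => ?_) fun s _ hs => ?_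
  · obtain ⟨k, _, rfl⟩ := Finset.mem_image.1 hs
    exact Finset.mem_image_of_mem z (Finset.mem_univ (σ k))
  · have hfix : ∀ d, moveCluster s d (z ∘ σ) = z ∘ σ := by
      intro d
      funext k
      unfold moveCluster
      rw [if_neg]
      exact fun h => hs (h ▸ Finset.mem_image_of_mem _ (Finset.mem_univ k))
    rw [hfix, hfix]; ring

/-- Consistency of the coalescing flow: the motion of a subfamily of the particles. -/
theorem semi_coal_comp (hl : ∀ x, 0 ≤ lam x) (hm : ∀ x, 0 ≤ mu x) {φ : ℤ → ℝ}
    (hφ : IsLyapunov (bdGenerator lam mu) bdSupp φ) (σ : κ → ι) {f : (κ → ℤ) → ℝ} {M : ℝ}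
    (hf : ∀ w, |f w| ≤ M) {t : ℝ} (ht : 0 ≤ t) (z : ι → ℤ) :
    semi (coalescingGenerator lam mu) f t (z ∘ σ) =
      semi (coalescingGenerator lam mu) (fun w : ι → ℤ => f (w ∘ σ)) t z := by
  have hs := (isRateMatrix_coal (ι := κ) hl hm).isBackwardSolution_semi hf
  symm
  refine (isRateMatrix_coal (ι := ι) hl hm).semi_eq (isLyapunov_coal hφ) (isClosedFor_univ _)
    (u := fun t z => semi (coalescingGenerator lam mu) f t (z ∘ σ)) ⟨?_, ?_, ?_⟩
    (fun w => hf (w ∘ σ)) (fun z _ => semi_zero f (z ∘ σ)) ht (Set.mem_univ z)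
  · exact fun z _ => hs.cont (z ∘ σ) (Set.mem_univ _)
  · intro z _ t ht
    rw [gen_coal_comp σ (semi (coalescingGenerator lam mu) f t) z]
    exact hs.deriv (z ∘ σ) (Set.mem_univ _) t ht
  · exact hs.bdd.imp fun M hM z _ => hM (z ∘ σ) (Set.mem_univ _)

end Generators

/-! ### A realization of the flow on an interval -/

section Flow

variable {lam mu : ℤ → ℝ}

theorem flowCDF_eq_semi {κ : Type*} [Fintype κ] (t : ℝ) (z z' : κ → ℤ) :
    flowCDF lam mu t z z' = semi (coalescingGenerator lam mu)
      (fun w : κ → ℤ => if ∀ i, w i ≤ z' i then 1 else 0) t z := by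
  unfold flowCDF semi
  refine tsum_congr fun w => ?_
  dsimp only
  by_cases h : ∀ i, w i ≤ z' i
  · rw [if_pos h, if_pos h, mul_one]
  · rw [if_neg h, if_neg h, mul_zero]

/-- The indicator of `a ≤ b`. -/
def leInd (a b : ℤ) : ℝ := if a ≤ b then 1 else 0

theorem leInd_nonneg (a b : ℤ) : 0 ≤ leInd a b := by unfold leInd; split_ifs <;> norm_num

theorem leInd_le_one (a b : ℤ) : leInd a b ≤ 1 := by unfold leInd; split_ifs <;> norm_num

theorem leInd_antitone_left {a a' : ℤ} (h : a ≤ a') (b : ℤ) : leInd a' b ≤ leInd a b := by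
  unfold leInd
  split_ifs with h1 h2
  · exact le_rfl
  · exact absurd (h.trans h1) h2
  · exact zero_le_one
  · exact le_rfl

theorem prod_leInd {κ : Type*} [Fintype κ] (a b : κ → ℤ) :
    ∏ k, leInd (a k) (b k) = if ∀ k, a k ≤ b k then 1 else 0 := by
  unfold leInd
  split_ifs with h
  · exact Finset.prod_eq_one fun k _ => if_pos (h k)
  · push Not at h
    obtain ⟨k, hk⟩ := h
    exact Finset.prod_eq_zero (Finset.mem_univ k) (if_neg (not_le.2 hk))

/-- A realization of the coalescing flow at time `t` from the starting points in `[a, b]`: a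
random nondecreasing map `Φ ω`, preserving `I`, on a discrete probability space `Ω` whose points
have the masses `p ω`. -/
structure FlowModel (I : Set ℤ) (lam mu : ℤ → ℝ) (t : ℝ) (a b : ℤ) where
  Ω : Type
  p : Ω → ℝ
  Φ : Ω → ℤ → ℤ
  p_nonneg : ∀ ω, 0 ≤ p ω
  p_sum : HasSum p 1
  mono : ∀ ω, Monotone (Φ ω)
  mem : ∀ ω, ∀ x ∈ I, a ≤ x → x ≤ b → Φ ω x ∈ I
  cdf : ∀ (κ : Type) [Fintype κ] (z z' : κ → ℤ), (∀ k, a ≤ z k) → (∀ k, z k ≤ b) →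
    flowCDF lam mu t z z' = ∑' ω, p ω * ∏ k, leInd (Φ ω (z k)) (z' k)

/-- The probability space consists of the configurations charged by the law of the motion of all
the particles started in `[a, b]`. -/
theorem nonempty_flowModel (hl : ∀ x, 0 ≤ lam x) (hm : ∀ x, 0 ≤ mu x) {φ : ℤ → ℝ}
    (hφ : IsLyapunov (bdGenerator lam mu) bdSupp φ) {I : Set ℤ}
    (hlI : ∀ x ∈ I, lam x ≠ 0 → x + 1 ∈ I) (hmI : ∀ x ∈ I, mu x ≠ 0 → x - 1 ∈ I)
    {a b : ℤ} (hab : a ≤ b) {t : ℝ} (ht : 0 ≤ t) : Nonempty (FlowModel I lam mu t a b) := by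
  set ι : Type := ↥(Set.Icc a b) with hι
  set Z : ι → ℤ := fun i => i.1 with hZ
  set G := coalescingGenerator (ι := ι) lam mu with hGdef
  have hG : IsRateMatrix G coalSupp := isRateMatrix_coal hl hm
  have hL := isLyapunov_coal (ι := ι) hφ
  set Ω : Type := {w : ι → ℤ // transitionDensity G t Z w ≠ 0} with hΩ
  have hsub : Function.support (fun w => transitionDensity G t Z w) ⊆
      Set.range (Subtype.val : Ω → ι → ℤ) := by
    intro w hw
    exact ⟨⟨w, hw⟩, rfl⟩
  have hinC : ∀ C : Set (ι → ℤ), IsClosedFor G C → Z ∈ C → ∀ ω : Ω, ω.1 ∈ C := by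
    intro C hC hZC ω
    by_contra h
    exact ω.2 (hG.transitionDensity_eq_zero hL hC ht hZC h)
  refine ⟨⟨Ω, fun ω => transitionDensity G t Z ω.1, fun ω x => ω.1 (Set.projIcc a b hab x),
    fun ω => hG.transitionDensity_nonneg ht Z ω.1, ?_, ?_, ?_, ?_⟩⟩
  · exact (Function.Injective.hasSum_iff Subtype.val_injective (by
      intro w hw
      by_contra h
      exact hw (hsub h))).2 (hG.hasSum_transitionDensity hL ht Z)
  · intro ω x y hxy
    exact hinC _ (coal_closed_le (Set.projIcc a b hab x) (Set.projIcc a b hab y))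
      (Set.monotone_projIcc hab hxy) ω
  · intro ω x hx hax hxb
    refine hinC _ (coal_closed_mem hlI hmI (Set.projIcc a b hab x)) ?_ ω
    simp only [hZ, Set.projIcc_of_mem hab ⟨hax, hxb⟩]
    exact hx
  · intro κ _ z z' hza hzb
    have hz : z = Z ∘ fun k => Set.projIcc a b hab (z k) := by
      funext k
      simp only [hZ, Function.comp, Set.projIcc_of_mem hab ⟨hza k, hzb k⟩]
    simp only [prod_leInd]
    rw [flowCDF_eq_semi]
    conv_lhs => rw [hz]
    rw [semi_coal_comp hl hm hφ (fun k => Set.projIcc a b hab (z k)) (M := 1)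
      (fun w => by split_ifs <;> simp) ht Z]
    unfold semi
    symm
    refine Function.Injective.tsum_eq (g := (Subtype.val : Ω → ι → ℤ)) Subtype.val_injective
      (f := fun w : ι → ℤ => transitionDensity G t Z w *
        if ∀ k, (w ∘ fun k => Set.projIcc a b hab (z k)) k ≤ z' k then 1 else 0) ?_
    intro w hw
    exact hsub fun h => hw (by simp only [h, zero_mul])

end Flow

/-! ### Determinants -/

section Det

variable {m : Type*} [Fintype m] [DecidableEq m]

/-- Adding one and the same vector to several rows changes the determinant by a sum of
determinants in which a single row is replaced: two equal rows contribute nothing. -/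
theorem det_add_rows {R : Type*} [CommRing R] (M : Matrix m m R) (v : m → R) (s : Finset m) :
    Matrix.det (Matrix.of fun i => if i ∈ s then M i + v else M i) =
      M.det + ∑ i ∈ s, (M.updateRow i v).det := by
  induction s using Finset.induction_on with
  | empty => simp; rfl
  | insert a s ha ih =>
    set A : Matrix m m R := Matrix.of fun i => if i ∈ s then M i + v else M i with hA
    have h1 : (Matrix.of fun i => if i ∈ insert a s then M i + v else M i) =
        A.updateRow a (M a + v) := by
      ext i j
      by_cases hi : i = a
      · subst hi; simp
      · simp [hA, hi, Matrix.updateRow_apply]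
    have h2 : A.updateRow a (M a) = A := by
      ext i j
      by_cases hi : i = a
      · subst hi; simp [hA, ha]
      · simp [Matrix.updateRow_apply, hi]
    have h3 : (A.updateRow a v).det = (M.updateRow a v).det := by
      refine Matrix.det_eq_of_forall_row_eq_smul_add_const (fun i => if i ∈ s then 1 else 0) a
        (by simp [ha]) fun i j => ?_
      by_cases hi : i = a
      · subst hi; simp [ha]
      · by_cases his : i ∈ s <;> simp [hA, his, hi, Matrix.updateRow_apply]
    rw [h1, Matrix.det_updateRow_add, h2, h3, ih, Finset.sum_insert ha]
    ring

theorem hasDerivAt_det {M : ℝ → Matrix m m ℝ} {M' : Matrix m m ℝ} {t : ℝ}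
    (h : ∀ i j, HasDerivAt (fun s => M s i j) (M' i j) t) :
    HasDerivAt (fun s => (M s).det) (∑ i, ((M t).updateRow i (M' i)).det) t := by
  have h1 : HasDerivAt (fun s => ∑ σ : Equiv.Perm m, (Equiv.Perm.sign σ : ℝ) *
      ∏ i, M s i (σ i)) (∑ σ : Equiv.Perm m, (Equiv.Perm.sign σ : ℝ) *
        ∑ i, (∏ j ∈ Finset.univ.erase i, M t j (σ j)) • M' i (σ i)) t :=
    HasDerivAt.fun_sum fun σ _ => HasDerivAt.const_mul _
      (HasDerivAt.fun_finsetProd fun i _ => h i (σ i))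
  have e : ∀ A : Matrix m m ℝ, A.det = ∑ σ : Equiv.Perm m, (Equiv.Perm.sign σ : ℝ) *
      ∏ i, A i (σ i) := fun A => by
    rw [← Matrix.det_transpose, Matrix.det_apply']; rfl
  simp only [e]
  convert h1 using 1
  rw [Finset.sum_comm]
  refine Finset.sum_congr rfl fun σ _ => ?_
  rw [← Finset.mul_sum]
  congr 1
  refine Finset.sum_congr rfl fun i _ => ?_
  rw [← Finset.mul_prod_erase _ _ (Finset.mem_univ i), Matrix.updateRow_self, smul_eq_mul,
    mul_comm]
  congr 1
  refine Finset.prod_congr rfl fun j hj => ?_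
  rw [Matrix.updateRow_ne (Finset.ne_of_mem_erase hj)]

/-- For nondecreasing `z`, `z'` the matrix is triangular if `z ≤ z'`, and otherwise has a block of
zeros too large for a non-zero determinant. -/
theorem det_indicator_sub_indicator {n : ℕ} {z z' : Fin n → ℤ} (hz : Monotone z)
    (hz' : Monotone z') :
    Matrix.det (Matrix.of fun i j : Fin n =>
      (if z i ≤ z' j then (1 : ℝ) else 0) - if i < j then 1 else 0) =
      if ∀ i, z i ≤ z' i then 1 else 0 := by
  split_ifs with h
  · rw [Matrix.det_of_isLowerTriangular]
    · refine Finset.prod_eq_one fun i _ => ?_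
      simp [h i]
    · intro i j hij
      have hij' : i < j := hij
      simp [(h i).trans (hz' hij'.le), hij']
  · push Not at h
    obtain ⟨k, hk⟩ := h
    rw [Matrix.det_apply]
    refine Finset.sum_eq_zero fun σ _ => ?_
    obtain ⟨i, hik, hki⟩ : ∃ i, i ≤ k ∧ k ≤ σ i := by
      by_contra! hcon
      have := Finset.card_le_card_of_injOn (s := Finset.Iic k) (t := Finset.Iio k) σ
        (fun i hi => Finset.mem_coe.2 (Finset.mem_Iio.2 (hcon i (Finset.mem_Iic.1 hi))))
        σ.injective.injOn
      simp at this
    rw [Finset.prod_eq_zero (Finset.mem_univ i), smul_zero]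
    have h1 : ¬ z (σ i) ≤ z' i := by
      have := hz hki
      have := hz' hik
      omega
    have h2 : ¬ σ i < i := not_lt.2 (hik.trans hki)
    simp [h1, h2]

end Det

/-! ### A determinantal formula for the coalescing flow -/

section Warren

variable {lam mu : ℤ → ℝ}

/-- `ℙ_x(X(t) ≤ y)`. -/
def chainCDF (lam mu : ℤ → ℝ) (t : ℝ) (x y : ℤ) : ℝ :=
  semi (bdGenerator lam mu) (fun w => if w ≤ y then 1 else 0) t x

theorem isBackwardSolution_chainCDF (hl : ∀ x, 0 ≤ lam x) (hm : ∀ x, 0 ≤ mu x) (y : ℤ) :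
    IsBackwardSolution (bdGenerator lam mu) bdSupp Set.univ
      fun t x => chainCDF lam mu t x y :=
  (isRateMatrix_bd hl hm).isBackwardSolution_semi (M := 1) fun w => by split_ifs <;> simp

theorem chainCDF_zero (x y : ℤ) : chainCDF lam mu 0 x y = if x ≤ y then 1 else 0 :=
  semi_zero _ _

theorem summable_chainCDF (hl : ∀ x, 0 ≤ lam x) (hm : ∀ x, 0 ≤ mu x) {t : ℝ} (ht : 0 ≤ t)
    (x y : ℤ) : Summable fun w =>
      transitionDensity (bdGenerator lam mu) t x w * if w ≤ y then 1 else 0 :=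
  (isRateMatrix_bd hl hm).summable_transitionDensity_mul ht x (M := 1)
    fun w => by split_ifs <;> simp

theorem chainCDF_nonneg (hl : ∀ x, 0 ≤ lam x) (hm : ∀ x, 0 ≤ mu x) {t : ℝ} (ht : 0 ≤ t)
    (x y : ℤ) : 0 ≤ chainCDF lam mu t x y :=
  tsum_nonneg fun w => mul_nonneg ((isRateMatrix_bd hl hm).transitionDensity_nonneg ht x w)
    (by dsimp only; split_ifs <;> norm_num)

theorem chainCDF_le_one (hl : ∀ x, 0 ≤ lam x) (hm : ∀ x, 0 ≤ mu x) {t : ℝ} (ht : 0 ≤ t)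
    (x y : ℤ) : chainCDF lam mu t x y ≤ 1 := by
  have hG := isRateMatrix_bd hl hm
  refine (Summable.tsum_le_tsum (fun w => ?_) (summable_chainCDF hl hm ht x y)
    (hG.summable_transitionDensity ht x)).trans
    ((hG.summable_transitionDensity ht x).tsum_le_of_sum_le
      fun s => hG.sum_transitionDensity_le_one ht x s)
  have := hG.transitionDensity_nonneg ht x w
  split_ifs <;> linarith

theorem chainDensity_eq_sub (hl : ∀ x, 0 ≤ lam x) (hm : ∀ x, 0 ≤ mu x) {t : ℝ} (ht : 0 ≤ t)
    (x y : ℤ) : chainDensity lam mu t x y = chainCDF lam mu t x y - chainCDF lam mu t x (y - 1) := by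
  unfold chainCDF semi
  rw [← (summable_chainCDF hl hm ht x y).tsum_sub (summable_chainCDF hl hm ht x (y - 1)),
    tsum_eq_single y]
  · simp [chainDensity]
  · intro w hw
    rcases lt_or_gt_of_ne hw with h | h
    · rw [if_pos h.le, if_pos (by omega), sub_self]
    · rw [if_neg (by omega), if_neg (by omega), sub_self]

/-- The determinant `det (ℙ(X(t) ≤ z'_j | X(0) = z_i) - 1(i < j))`. -/
def warrenDet (lam mu : ℤ → ℝ) {n : ℕ} (t : ℝ) (z z' : Fin n → ℤ) : ℝ :=
  Matrix.det (Matrix.of fun i j : Fin n =>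
    chainCDF lam mu t (z i) (z' j) - if i < j then 1 else 0)

theorem gen_coal_warrenDet {n : ℕ} (t : ℝ) (z z' : Fin n → ℤ) :
    gen (coalescingGenerator lam mu) coalSupp (fun z => warrenDet lam mu t z z') z =
      ∑ i, ((Matrix.of fun i j : Fin n =>
        chainCDF lam mu t (z i) (z' j) - if i < j then 1 else 0).updateRow i
          (fun j => gen (bdGenerator lam mu) bdSupp
            (fun x => chainCDF lam mu t x (z' j)) (z i))).det := by
  set M : Matrix (Fin n) (Fin n) ℝ := Matrix.of fun i j : Fin n =>
        chainCDF lam mu t (z i) (z' j) - if i < j then 1 else 0 with hM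
  have hmove : ∀ s d, warrenDet lam mu t (moveCluster s d z) z' - warrenDet lam mu t z z' =
      ∑ i ∈ Finset.univ.filter (fun i => z i = s), (M.updateRow i fun j =>
        chainCDF lam mu t (s + d) (z' j) - chainCDF lam mu t s (z' j)).det := by
    intro s d
    have h := det_add_rows M (fun j =>
      chainCDF lam mu t (s + d) (z' j) - chainCDF lam mu t s (z' j))
      (Finset.univ.filter fun i => z i = s)
    rw [← sub_eq_iff_eq_add'] at h
    rw [← h]
    unfold warrenDet
    congr 2
    ext i j
    by_cases hi : z i = s
    · simp [moveCluster, hi, hM]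
    · simp [moveCluster, hi, hM]
  have hfib := Finset.sum_fiberwise_of_maps_to (s := Finset.univ) (g := z)
    (t := Finset.univ.image z) (fun i _ => Finset.mem_image_of_mem z (Finset.mem_univ i))
    fun i => (M.updateRow i (fun j => gen (bdGenerator lam mu) bdSupp
            (fun x => chainCDF lam mu t x (z' j)) (z i))).det
  rw [gen_coal, ← hfib]
  refine Finset.sum_congr rfl fun s _ => ?_
  rw [hmove, hmove, Finset.mul_sum, Finset.mul_sum, ← Finset.sum_add_distrib]
  refine Finset.sum_congr rfl fun i hi => ?_
  rw [← Matrix.det_updateRow_smul, ← Matrix.det_updateRow_smul, ← Matrix.det_updateRow_add]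
  congr 2
  funext j
  rw [(Finset.mem_filter.1 hi).2, gen_bd]
  rfl

theorem isBackwardSolution_warrenDet (hl : ∀ x, 0 ≤ lam x) (hm : ∀ x, 0 ≤ mu x) {n : ℕ}
    (z' : Fin n → ℤ) : IsBackwardSolution (coalescingGenerator lam mu) coalSupp Set.univ
      fun t z => warrenDet lam mu t z z' := by
  refine ⟨fun z _ => ?_, fun z _ t ht => ?_, (Nat.factorial n : ℝ), fun z _ t ht => ?_⟩
  · simp only [warrenDet, Matrix.det_apply']
    refine continuousOn_finsetSum _ fun σ _ => continuousOn_const.mul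
      (continuousOn_finsetProd _ fun i _ => ?_)
    exact ((isBackwardSolution_chainCDF hl hm (z' i)).cont _ (Set.mem_univ _)).sub
      continuousOn_const
  · rw [gen_coal_warrenDet]
    exact hasDerivAt_det (M := fun t => Matrix.of fun i j : Fin n =>
        chainCDF lam mu t (z i) (z' j) - if i < j then 1 else 0) (M' := Matrix.of fun i j =>
        gen (bdGenerator lam mu) bdSupp (fun x => chainCDF lam mu t x (z' j)) (z i))
      fun i j => ((isBackwardSolution_chainCDF hl hm (z' j)).deriv _ (Set.mem_univ _) t
        ht).sub_const _
  · have h := Matrix.det_le (A := Matrix.of fun i j : Fin n =>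
        chainCDF lam mu t (z i) (z' j) - if i < j then 1 else 0)
      (abv := AbsoluteValue.abs) (x := 1) fun i j => ?_
    · simpa [warrenDet] using h
    · have h0 := chainCDF_nonneg hl hm ht (z i) (z' j)
      have h1 := chainCDF_le_one hl hm ht (z i) (z' j)
      rw [AbsoluteValue.abs_apply, abs_le, Matrix.of_apply]
      split_ifs <;> constructor <;> linarith

/-- Warren's formula: both sides solve the backward equation of the coalescing motion, with the
same initial value on nondecreasing configurations. -/
theorem flowCDF_eq_warrenDet (hl : ∀ x, 0 ≤ lam x) (hm : ∀ x, 0 ≤ mu x) {φ : ℤ → ℝ}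
    (hφ : IsLyapunov (bdGenerator lam mu) bdSupp φ) {n : ℕ} {t : ℝ} (ht : 0 ≤ t)
    {z z' : Fin n → ℤ} (hz : Monotone z) (hz' : Monotone z') :
    flowCDF lam mu t z z' = warrenDet lam mu t z z' := by
  rw [flowCDF_eq_semi]
  refine (isRateMatrix_coal hl hm).semi_eq (isLyapunov_coal hφ) coal_closed_monotone
    (u := fun t z => warrenDet lam mu t z z')
    ((isBackwardSolution_warrenDet hl hm z').mono (Set.subset_univ _)) (M := 1)
    (fun w => by split_ifs <;> simp) (fun w hw => ?_) ht hz
  simp only [warrenDet, chainCDF_zero]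
  convert det_indicator_sub_indicator hw hz'

end Warren

/-! ### Reversibility and Siegmund duality -/

section Reversible

variable {S : Type*} [DecidableEq S] {G : S → S → ℝ} {N : S → Finset S}

theorem transitionDensity_eq_semi (t : ℝ) (x y : S) :
    transitionDensity G t x y = semi G (fun z => if z = y then 1 else 0) t x := by
  simp [semi]

variable [Countable S]

/-- For fixed `y`, the function `x ↦ w x * p t x y` on `I` solves the forward equation, hence
dominates `w y * p t y x`. Outside `I`, where the chain is absorbed, it is replaced by a function
growing so fast that the forward inequality holds there as well. -/
theorem IsRateMatrix.reversible_le (hG : IsRateMatrix G N) {I : Set S} {w : S → ℝ}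
    (habs : ∀ u, u ∉ I → ∀ z, G u z = 0) (hw : ∀ x ∈ I, 0 < w x)
    (hbal : ∀ x ∈ I, ∀ y ∈ I, w x * G x y = w y * G y x) {t : ℝ} (ht : 0 ≤ t) {x y : S}
    (hx : x ∈ I) (hy : y ∈ I) :
    w y * transitionDensity G t y x ≤ w x * transitionDensity G t x y := by
  classical
  have hsol : IsBackwardSolution G N Set.univ fun s z => transitionDensity G s z y := by
    have e : (fun s z => transitionDensity G s z y) = semi G (fun z => if z = y then 1 else 0) :=
      funext fun s => funext fun z => transitionDensity_eq_semi s z y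
    rw [e]
    exact hG.isBackwardSolution_semi (M := 1) fun z => by split_ifs <;> simp
  have hp0 : ∀ {s : ℝ}, 0 ≤ s → ∀ a b, 0 ≤ transitionDensity G s a b :=
    fun hs a b => hG.transitionDensity_nonneg hs a b
  have hp1 : ∀ {s : ℝ}, 0 ≤ s → ∀ a b, transitionDensity G s a b ≤ 1 := fun {s} hs a b => by
    simpa using hG.sum_transitionDensity_le_one hs a {b}
  suffices h : ∀ F : Finset S, w y * killedDensity G F t y x ≤ w x * transitionDensity G t x y by
    rw [mul_comm, ← le_div_iff₀ (hw y hy)]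
    refine ciSup_le fun F => ?_
    rw [le_div_iff₀ (hw y hy), mul_comm]
    exact h F
  intro F
  by_cases hxF : x ∈ F
  swap
  · rw [killedDensity_of_notMem_right F t y hxF, mul_zero]
    exact mul_nonneg (hw x hx).le (hp0 ht x y)
  set B : S → ℝ := fun z => ∑ u ∈ F with u ∈ I, w u * |G u z| with hB
  set g : ℝ → S → ℝ := fun s z =>
    if z ∈ I then w z * transitionDensity G s z y else s * B z with hg
  have h := hG.killed_le_of_forward F (g := g)
    (g' := fun s z => if z ∈ I then w z * gen G N (fun u => transitionDensity G s u y) z else B z)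
    ?_ ?_ ?_ ht hxF
  · simp only [hg, if_pos hx] at h
    refine le_trans ?_ h
    by_cases hyF : y ∈ F
    · refine le_trans (le_of_eq ?_) (Finset.single_le_sum (fun z _ => ?_) hyF)
      · rw [if_pos hy, transitionDensity_zero, if_pos rfl, mul_one]
      · split_ifs with hz
        · exact mul_nonneg (mul_nonneg (hw z hz).le (hp0 le_rfl z y))
            (hG.killedDensity_nonneg F ht z x)
        · simp
    · rw [killedDensity_of_notMem_left F t x hyF, mul_zero]
      refine Finset.sum_nonneg fun z _ => ?_
      split_ifs with hz
      · exact mul_nonneg (mul_nonneg (hw z hz).le (hp0 le_rfl z y))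
          (hG.killedDensity_nonneg F ht z x)
      · simp
  · intro z _
    by_cases hz : z ∈ I
    · simp only [hg, if_pos hz]
      exact continuousOn_const.mul (hsol.cont z (Set.mem_univ z))
    · simp only [hg, if_neg hz]
      fun_prop
  · intro z _ s hs
    by_cases hz : z ∈ I
    · simp only [hg, if_pos hz]
      exact (hsol.deriv z (Set.mem_univ z) s hs).const_mul _
    · simp only [hg, if_neg hz]
      simpa using (hasDerivAt_id s).mul_const (B z)
  · intro z hzF s hs
    have e : ∑ u ∈ F, g s u * G u z =
        ∑ u ∈ F with u ∈ I, w u * G u z * transitionDensity G s u y := by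
      rw [Finset.sum_filter]
      refine Finset.sum_congr rfl fun u _ => ?_
      by_cases hu : u ∈ I
      · simp only [hg, if_pos hu]; ring
      · simp only [if_neg hu, habs u hu z, mul_zero]
    rw [e]
    by_cases hz : z ∈ I
    · rw [if_pos hz]
      have e2 : w z * gen G N (fun u => transitionDensity G s u y) z =
          ∑ u ∈ N z ∪ (F.filter fun u => u ∈ I), w z * G z u * transitionDensity G s u y := by
        rw [gen, Finset.mul_sum]
        refine (Finset.sum_congr rfl fun u _ => by ring).trans
          (Finset.sum_subset Finset.subset_union_left fun u _ hu => ?_)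
        rw [hG.supp z u hu]; ring
      rw [e2]
      refine (Finset.sum_congr rfl fun u hu => ?_).trans_le
        (Finset.sum_le_sum_of_subset_of_nonneg Finset.subset_union_right fun u _ hu => ?_)
      · rw [hbal u (Finset.mem_filter.1 hu).2 z hz]
      · have hzu : z ≠ u := by
          rintro rfl
          exact hu (Finset.mem_filter.2 ⟨hzF, hz⟩)
        exact mul_nonneg (mul_nonneg (hw z hz).le (hG.offdiag z u hzu)) (hp0 hs.le u y)
    · rw [if_neg hz]
      refine Finset.sum_le_sum fun u hu => ?_
      have hwu := (hw u (Finset.mem_filter.1 hu).2).le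
      calc w u * G u z * transitionDensity G s u y
          ≤ w u * |G u z| * transitionDensity G s u y := by
            gcongr
            · exact hp0 hs.le u y
            · exact le_abs_self _
        _ ≤ w u * |G u z| * 1 := by
            gcongr
            exact hp1 hs.le u y
        _ = w u * |G u z| := mul_one _

theorem IsRateMatrix.reversible (hG : IsRateMatrix G N) {I : Set S} {w : S → ℝ}
    (habs : ∀ u, u ∉ I → ∀ z, G u z = 0) (hw : ∀ x ∈ I, 0 < w x)
    (hbal : ∀ x ∈ I, ∀ y ∈ I, w x * G x y = w y * G y x) {t : ℝ} (ht : 0 ≤ t) {x y : S}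
    (hx : x ∈ I) (hy : y ∈ I) :
    w x * transitionDensity G t x y = w y * transitionDensity G t y x :=
  le_antisymm (hG.reversible_le habs hw hbal ht hy hx) (hG.reversible_le habs hw hbal ht hx hy)

end Reversible

section Duality

variable {lam mu : ℤ → ℝ}

theorem chainCDF_antitone (hl : ∀ x, 0 ≤ lam x) (hm : ∀ x, 0 ≤ mu x) {φ : ℤ → ℝ}
    (hφ : IsLyapunov (bdGenerator lam mu) bdSupp φ) {t : ℝ} (ht : 0 ≤ t) (x y : ℤ) :
    chainCDF lam mu t (x + 1) y ≤ chainCDF lam mu t x y := by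
  obtain ⟨m⟩ := nonempty_flowModel hl hm hφ (I := Set.univ)
    (fun _ _ _ => Set.mem_univ _) (fun _ _ _ => Set.mem_univ _) (a := x) (b := x + 1)
    (by omega) ht
  have key : ∀ u, x ≤ u → u ≤ x + 1 →
      chainCDF lam mu t u y = ∑' ω, m.p ω * leInd (m.Φ ω u) y := by
    intro u h1 h2
    have e : chainCDF lam mu t u y = flowCDF lam mu t (fun _ : Fin 1 => u) (fun _ => y) := by
      rw [flowCDF_eq_warrenDet hl hm hφ ht monotone_const monotone_const, warrenDet,
        Matrix.det_fin_one]
      simp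
    rw [e, m.cdf (Fin 1) _ _ (fun _ => h1) (fun _ => h2)]
    simp
  have hs : ∀ u, Summable fun ω => m.p ω * leInd (m.Φ ω u) y := fun u =>
    Summable.of_nonneg_of_le (fun ω => mul_nonneg (m.p_nonneg ω) (leInd_nonneg _ _))
      (fun ω => mul_le_of_le_one_right (m.p_nonneg ω) (leInd_le_one _ _)) m.p_sum.summable
  rw [key x le_rfl (by omega), key (x + 1) (by omega) le_rfl]
  exact (hs _).tsum_le_tsum (fun ω => mul_le_mul_of_nonneg_left
    (leInd_antitone_left (m.mono ω (by omega)) y) (m.p_nonneg ω)) (hs _)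

/-- The forward operator of a birth and death chain; restricting the sum to a finite set loses
only nonnegative inflow. -/
theorem sum_bdGenerator_le {a b : ℤ → ℝ} (ha : ∀ x, 0 ≤ a x) (hb : ∀ x, 0 ≤ b x) {g : ℤ → ℝ}
    (hg : ∀ x, 0 ≤ g x) {F : Finset ℤ} {z : ℤ} (hz : z ∈ F) :
    ∑ u ∈ F, g u * bdGenerator a b u z ≤
      a (z - 1) * g (z - 1) + b (z + 1) * g (z + 1) - (a z + b z) * g z := by
  have h1 : ∑ u ∈ F, g u * bdGenerator a b u z ≤
      ∑ u ∈ F ∪ bdSupp z, g u * bdGenerator a b u z := by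
    refine Finset.sum_le_sum_of_subset_of_nonneg Finset.subset_union_left fun u _ hu =>
      mul_nonneg (hg u) ((isRateMatrix_bd ha hb).offdiag u z ?_)
    rintro rfl
    exact hu hz
  have h2 : ∑ u ∈ F ∪ bdSupp z, g u * bdGenerator a b u z =
      ∑ u ∈ bdSupp z, g u * bdGenerator a b u z := by
    refine (Finset.sum_subset Finset.subset_union_right fun u _ hu => ?_).symm
    rw [(isRateMatrix_bd ha hb).supp u z, mul_zero]
    simp only [bdSupp, Finset.mem_insert, Finset.mem_singleton, not_or] at hu ⊢
    omega
  refine h1.trans (le_of_eq (h2.trans ?_))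
  have h1 : z - 1 ∉ ({z, z + 1} : Finset ℤ) := by simp; omega
  have h2 : z ∉ ({z + 1} : Finset ℤ) := by simp
  rw [bdSupp, Finset.sum_insert h1, Finset.sum_insert h2, Finset.sum_singleton]
  have e1 : bdGenerator a b (z - 1) z = a (z - 1) := by
    rw [bdGenerator, if_pos (by omega)]
  have e2 : bdGenerator a b z z = -a z - b z := by
    rw [bdGenerator, if_neg (by omega), if_pos rfl]
  have e3 : bdGenerator a b (z + 1) z = b (z + 1) := by
    rw [bdGenerator, if_neg (by omega), if_neg (by omega), if_pos (by omega)]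
  rw [e1, e2, e3]; ring

theorem dualBirth_nonneg (hm : ∀ x, 0 ≤ mu x) (x : ℤ) : 0 ≤ dualBirth mu x := hm (x + 1)

theorem dualDeath_nonneg (hl : ∀ x, 0 ≤ lam x) (x : ℤ) : 0 ≤ dualDeath lam x := hl x

theorem sum_Ico_sub (f : ℤ → ℝ) {a b : ℤ} (hab : a ≤ b) :
    ∑ x ∈ Finset.Ico a b, (f x - f (x + 1)) = f a - f b := by
  induction b, hab using Int.leInduction with
  | base => simp
  | succ b hab ih =>
    have : Finset.Ico a (b + 1) = insert b (Finset.Ico a b) := by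
      ext x; simp only [Finset.mem_Ico, Finset.mem_insert]; omega
    rw [this, Finset.sum_insert (by simp), ih]
    ring

/-- Siegmund duality. As a function of `x`, the right-hand side solves the forward equation of the
dual chain, so it dominates the minimal solution on the left; it has total mass at most `1` by
telescoping, and the left-hand side has mass `1`, since the dual chain does not explode. -/
theorem dualDensity_eq_sub (hl : ∀ x, 0 ≤ lam x) (hm : ∀ x, 0 ≤ mu x) {φ ψ : ℤ → ℝ}
    (hφ : IsLyapunov (bdGenerator lam mu) bdSupp φ)
    (hψ : IsLyapunov (bdGenerator (dualBirth mu) (dualDeath lam)) bdSupp ψ)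
    {t : ℝ} (ht : 0 ≤ t) (x y : ℤ) :
    dualDensity lam mu t y x = chainCDF lam mu t x y - chainCDF lam mu t (x + 1) y := by
  have hĜ := isRateMatrix_bd (dualBirth_nonneg hm) (dualDeath_nonneg hl)
  set g : ℝ → ℤ → ℝ := fun s x => chainCDF lam mu s x y - chainCDF lam mu s (x + 1) y with hg
  have hg0 : ∀ s, 0 ≤ s → ∀ x, 0 ≤ g s x := fun s hs x =>
    sub_nonneg.2 (chainCDF_antitone hl hm hφ hs x y)
  have hsol := isBackwardSolution_chainCDF hl hm y
  have hle : ∀ x, dualDensity lam mu t y x ≤ g t x := by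
    intro x
    refine ciSup_le fun F => ?_
    by_cases hx : x ∈ F
    swap
    · rw [killedDensity_of_notMem_right F t y hx]; exact hg0 t ht x
    by_cases hy : y ∈ F
    swap
    · rw [killedDensity_of_notMem_left F t x hy]; exact hg0 t ht x
    refine le_trans (le_of_eq ?_) (hĜ.killed_le_of_forward F (g := g)
      (g' := fun s z => gen (bdGenerator lam mu) bdSupp (fun x => chainCDF lam mu s x y) z -
        gen (bdGenerator lam mu) bdSupp (fun x => chainCDF lam mu s x y) (z + 1))
      (fun z _ => (hsol.cont z (Set.mem_univ _)).sub (hsol.cont (z + 1) (Set.mem_univ _)))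
      (fun z _ s hs => (hsol.deriv z (Set.mem_univ _) s hs).sub
        (hsol.deriv (z + 1) (Set.mem_univ _) s hs)) (fun z hz s hs => ?_) ht hx)
    · rw [Finset.sum_eq_single y]
      · simp [hg, chainCDF_zero]
      · intro z _ hzy
        have : g 0 z = 0 := by
          simp only [hg, chainCDF_zero]
          rcases lt_or_gt_of_ne hzy with h | h
          · rw [if_pos h.le, if_pos (by omega), sub_self]
          · rw [if_neg (by omega), if_neg (by omega), sub_self]
        rw [this, zero_mul]
      · exact fun h => absurd hy h
    · refine (sum_bdGenerator_le (dualBirth_nonneg hm) (dualDeath_nonneg hl) (hg0 s hs.le)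
        hz).trans (le_of_eq ?_)
      rw [gen_bd, gen_bd]
      simp only [hg, dualBirth, dualDeath, sub_add_cancel, add_sub_cancel_right]
      ring
  have hsum : HasSum (fun x => dualDensity lam mu t y x) 1 :=
    hĜ.hasSum_transitionDensity hψ ht y
  refine le_antisymm (hle x) ?_
  -- a strict inequality at `x` would leave the dual chain with a mass less than `1`
  have hfin : ∀ s : Finset ℤ, ∑ z ∈ s, g t z ≤ 1 := by
    intro s
    obtain ⟨k, hk⟩ : ∃ k : ℕ, s ⊆ Finset.Ico (-(k : ℤ)) k := by
      refine ⟨s.sup fun z => z.natAbs + 1, fun z hz => ?_⟩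
      have : z.natAbs + 1 ≤ s.sup fun z => z.natAbs + 1 :=
        Finset.le_sup (f := fun z : ℤ => z.natAbs + 1) hz
      rw [Finset.mem_Ico]
      omega
    refine (Finset.sum_le_sum_of_subset_of_nonneg hk fun z _ _ => hg0 t ht z).trans ?_
    rw [sum_Ico_sub (fun x => chainCDF lam mu t x y) (by omega)]
    have h1 := chainCDF_le_one hl hm ht (-(k : ℤ)) y
    have h2 := chainCDF_nonneg hl hm ht k y
    linarith
  have hlim : Filter.Tendsto (fun s : Finset ℤ => dualDensity lam mu t y x + 1 -
      ∑ z ∈ s, dualDensity lam mu t y z) Filter.atTop (nhds (dualDensity lam mu t y x)) := by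
    have := (tendsto_const_nhds (x := dualDensity lam mu t y x + 1)).sub hsum
    simpa using this
  refine ge_of_tendsto hlim ?_
  filter_upwards [Filter.eventually_ge_atTop ({x} : Finset ℤ)] with s hs
  have hxs : x ∈ s := hs (Finset.mem_singleton_self x)
  have h1 := hfin s
  rw [← Finset.add_sum_erase _ _ hxs] at h1 ⊢
  have h2 := Finset.sum_le_sum fun z (_ : z ∈ s.erase x) => hle z
  change g t x ≤ _
  linarith

end Duality

/-! ### Non-explosion from the boundary conditions -/

section Barriers

/-- Feller's test: with speed measure `a` and scale `b`, the function
`x ↦ ∑_{k ≤ j < x} b j ∑_{k ≤ i ≤ j} a i` is mapped by the generator to the indicator function of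
`[k, ∞)`. -/
theorem exists_barrier_top {α β a b : ℤ → ℝ} {k : ℤ} (ha : ∀ x, k ≤ x → 0 < a x)
    (hb : ∀ x, k ≤ x → 0 < b x) (h1 : ∀ x, k ≤ x → α x * b x * a x = 1)
    (h2 : ∀ x, k < x → β x * b (x - 1) * a x = 1)
    (hdiv : ∑' j : ℤ, ENNReal.ofReal (b j) * ∑ i ∈ Finset.Icc k j, ENNReal.ofReal (a i) = ∞) :
    ∃ S : ℤ → ℝ, (∀ x, 0 ≤ S x) ∧ (∀ x, gen (bdGenerator α β) bdSupp S x ≤ 1) ∧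
      ∀ M : ℝ, ∃ m : ℤ, ∀ x, S x ≤ M → x ≤ m := by
  set D : ℤ → ℝ := fun j => b j * ∑ i ∈ Finset.Icc k j, a i with hD
  set S : ℤ → ℝ := fun x => ∑ j ∈ Finset.Ico k x, D j with hS
  have hDlt : ∀ j, j < k → D j = 0 := fun j hj => by
    simp only [hD]; rw [Finset.Icc_eq_empty (not_le.2 hj)]; simp
  have hD0 : ∀ j, 0 ≤ D j := by
    intro j
    rcases lt_or_ge j k with hj | hj
    · exact (hDlt j hj).ge
    · exact mul_nonneg (hb j hj).le
        (Finset.sum_nonneg fun i hi => (ha i (Finset.mem_Icc.1 hi).1).le)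
  have hstep : ∀ x, S (x + 1) - S x = D x := by
    intro x
    rcases lt_or_ge x k with hx | hx
    · simp only [hS]
      rw [Finset.Ico_eq_empty (by omega), Finset.Ico_eq_empty (by omega), hDlt x hx]; simp
    · have : Finset.Ico k (x + 1) = insert x (Finset.Ico k x) := by
        ext y; simp only [Finset.mem_Ico, Finset.mem_insert]; omega
      simp only [hS]
      rw [this, Finset.sum_insert (by simp)]; ring
  have hS0 : ∀ x, 0 ≤ S x := fun x => Finset.sum_nonneg fun j _ => hD0 j
  have hSmono : ∀ x y, x ≤ y → S x ≤ S y := fun x y hxy =>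
    Finset.sum_le_sum_of_subset_of_nonneg (Finset.Ico_subset_Ico le_rfl hxy) fun j _ _ => hD0 j
  refine ⟨S, hS0, fun x => ?_, fun M => ?_⟩
  · have e1 := hstep x
    have e2 := hstep (x - 1)
    rw [sub_add_cancel] at e2
    have e3 : gen (bdGenerator α β) bdSupp S x = α x * D x - β x * D (x - 1) := by
      rw [gen_bd, ← e1, ← e2]; ring
    rw [e3]
    rcases lt_trichotomy x k with hx | hx | hx
    · rw [hDlt x hx, hDlt (x - 1) (by omega)]; simp
    · subst hx
      rw [hDlt (x - 1) (by omega)]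
      simp only [hD, Finset.Icc_self, Finset.sum_singleton]
      rw [← mul_assoc, h1 x le_rfl]; simp
    · have hIcc : Finset.Icc k x = insert x (Finset.Icc k (x - 1)) := by
        ext y; simp only [Finset.mem_Icc, Finset.mem_insert]; omega
      have hax := ha x hx.le
      have hαb : α x * b x = 1 / a x := by rw [eq_div_iff hax.ne']; exact h1 x hx.le
      have hβb : β x * b (x - 1) = 1 / a x := by rw [eq_div_iff hax.ne']; exact h2 x hx
      simp only [hD]
      rw [hIcc, Finset.sum_insert (by simp), ← mul_assoc, ← mul_assoc, hαb, hβb]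
      field_simp
      linarith
  · by_contra! hcon
    have hSM : ∀ x, S x ≤ M := fun x => by
      obtain ⟨y, hy, hxy⟩ := hcon x
      exact (hSmono x y hxy.le).trans hy
    have hterm : ∀ j, ENNReal.ofReal (b j) * ∑ i ∈ Finset.Icc k j, ENNReal.ofReal (a i) =
        ENNReal.ofReal (D j) := by
      intro j
      rcases lt_or_ge j k with hj | hj
      · rw [hDlt j hj, Finset.Icc_eq_empty (not_le.2 hj)]; simp
      · simp only [hD]
        rw [ENNReal.ofReal_mul (hb j hj).le, ENNReal.ofReal_sum_of_nonneg
          fun i hi => (ha i (Finset.mem_Icc.1 hi).1).le]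
    have hle : ∑' j : ℤ, ENNReal.ofReal (D j) ≤ ENNReal.ofReal M := by
      rw [ENNReal.tsum_eq_iSup_sum]
      refine iSup_le fun s => ?_
      rw [← ENNReal.ofReal_sum_of_nonneg fun j _ => hD0 j]
      refine ENNReal.ofReal_le_ofReal ?_
      obtain ⟨m, hm⟩ := s.bddAbove
      refine le_trans ?_ (hSM (m + 1))
      rw [← Finset.sum_filter_add_sum_filter_not s (fun j => k ≤ j)]
      rw [Finset.sum_eq_zero (s := s.filter fun j => ¬ k ≤ j)
        (fun j hj => hDlt j (not_le.1 (Finset.mem_filter.1 hj).2)), add_zero]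
      refine Finset.sum_le_sum_of_subset_of_nonneg (fun j hj => ?_) fun j _ _ => hD0 j
      rw [Finset.mem_filter] at hj
      exact Finset.mem_Ico.2 ⟨hj.2, Int.lt_add_one_of_le (hm (Finset.mem_coe.2 hj.1))⟩
    simp only [hterm] at hdiv
    rw [hdiv] at hle
    exact absurd hle (not_le.2 ENNReal.ofReal_lt_top)

/-- The reflection of `exists_barrier_top`. -/
theorem exists_barrier_bot {α β a b : ℤ → ℝ} {k : ℤ} (ha : ∀ x, k ≤ -x → 0 < a x)
    (hb : ∀ x, k ≤ -x → 0 < b (x - 1)) (h1 : ∀ x, k < -x → α x * b x * a x = 1)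
    (h2 : ∀ x, k ≤ -x → β x * b (x - 1) * a x = 1)
    (hdiv : ∑' j : ℤ, ENNReal.ofReal (b (-j - 1)) *
      ∑ i ∈ Finset.Icc k j, ENNReal.ofReal (a (-i)) = ∞) :
    ∃ S : ℤ → ℝ, (∀ x, 0 ≤ S x) ∧ (∀ x, gen (bdGenerator α β) bdSupp S x ≤ 1) ∧
      ∀ M : ℝ, ∃ m : ℤ, ∀ x, S x ≤ M → m ≤ x := by
  obtain ⟨S, hS0, hSg, hSM⟩ := exists_barrier_top (α := fun x => β (-x)) (β := fun x => α (-x))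
    (a := fun x => a (-x)) (b := fun x => b (-x - 1)) (k := k)
    (fun x hx => ha (-x) (by simpa using hx)) (fun x hx => hb (-x) (by simpa using hx))
    (fun x hx => h2 (-x) (by simpa using hx))
    (fun x hx => by
      have := h1 (-x) (by simpa using hx)
      rwa [show -(x - 1) - 1 = -x by ring]) hdiv
  refine ⟨fun x => S (-x), fun x => hS0 _, fun x => ?_, fun M => ?_⟩
  · have h := hSg (-x)
    rw [gen_bd] at h ⊢
    rw [neg_neg, show -x + 1 = -(x - 1) by ring, show -x - 1 = -(x + 1) by ring] at h
    linarith
  · obtain ⟨m, hm⟩ := hSM M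
    exact ⟨-m, fun x hx => by have := hm (-x) hx; omega⟩

/-- A half line of absorbing states is harmless. -/
theorem exists_barrier_bot_of_absorbing {α β : ℤ → ℝ} (hα : ∀ x, x < 0 → α x = 0)
    (hβ : ∀ x, x < 0 → β x = 0) :
    ∃ S : ℤ → ℝ, (∀ x, 0 ≤ S x) ∧ (∀ x, gen (bdGenerator α β) bdSupp S x ≤ 1) ∧
      ∀ M : ℝ, ∃ m : ℤ, ∀ x, S x ≤ M → m ≤ x := by
  refine ⟨fun x => ((max (-1 - x) 0 : ℤ) : ℝ), fun x => ?_, fun x => ?_, fun M => ?_⟩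
  · exact Int.cast_nonneg (le_max_right (-1 - x) 0)
  · rw [gen_bd]
    rcases lt_or_ge x 0 with hx | hx
    · rw [hα x hx, hβ x hx]; norm_num
    · rw [max_eq_right (by omega : -1 - (x + 1) ≤ 0), max_eq_right (by omega : -1 - x ≤ 0),
        max_eq_right (by omega : -1 - (x - 1) ≤ 0)]
      norm_num
  · refine ⟨-1 - ⌈M⌉, fun x hx => ?_⟩
    have h1 : ((-1 - x : ℤ) : ℝ) ≤ M := le_trans (Int.cast_le.2 (le_max_left (-1 - x) 0)) hx
    have h2 : -1 - x ≤ ⌈M⌉ := by exact_mod_cast h1.trans (Int.le_ceil M)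
    omega

theorem exists_isLyapunov_of_barriers {α β : ℤ → ℝ}
    (htop : ∃ S : ℤ → ℝ, (∀ x, 0 ≤ S x) ∧ (∀ x, gen (bdGenerator α β) bdSupp S x ≤ 1) ∧
      ∀ M : ℝ, ∃ m : ℤ, ∀ x, S x ≤ M → x ≤ m)
    (hbot : ∃ S : ℤ → ℝ, (∀ x, 0 ≤ S x) ∧ (∀ x, gen (bdGenerator α β) bdSupp S x ≤ 1) ∧
      ∀ M : ℝ, ∃ m : ℤ, ∀ x, S x ≤ M → m ≤ x) :
    ∃ φ, IsLyapunov (bdGenerator α β) bdSupp φ := by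
  obtain ⟨S, hS0, hSg, hSM⟩ := htop
  obtain ⟨T, hT0, hTg, hTM⟩ := hbot
  -- each barrier contributes at most `1` to the generator, which the constant `2` absorbs
  refine ⟨fun x => 2 + S x + T x, fun x => ?_, fun M => ?_, fun x => ?_⟩
  · have := hS0 x; have := hT0 x; linarith
  · obtain ⟨m, hm⟩ := hSM M
    obtain ⟨m', hm'⟩ := hTM M
    refine (Set.finite_Icc m' m).subset fun x hx => ?_
    have hx' : 2 + S x + T x ≤ M := hx
    have := hS0 x; have := hT0 x
    exact ⟨hm' x (by linarith), hm x (by linarith)⟩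
  · have h1 := hSg x
    have h2 := hTg x
    rw [gen_bd] at h1 h2 ⊢
    have := hS0 x; have := hT0 x
    linarith

end Barriers

/-! ### The symmetrizing measure -/

section Symm

variable {lam mu : ℤ → ℝ}

theorem symmMeasure_pos_of_nonneg (hl : ∀ x, 0 ≤ x → 0 < lam x) (hm : ∀ x, 1 ≤ x → 0 < mu x)
    {x : ℤ} (hx : 0 ≤ x) : 0 < symmMeasure lam mu x := by
  rw [symmMeasure, if_pos hx]
  refine Finset.prod_pos fun i hi => ?_
  rw [Finset.mem_Icc] at hi
  exact div_pos (hl _ (by omega)) (hm _ (by omega))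

theorem symmMeasure_balance_of_nonneg (hm : ∀ x, 1 ≤ x → 0 < mu x) {x : ℤ} (hx : 0 ≤ x) :
    symmMeasure lam mu x * lam x = symmMeasure lam mu (x + 1) * mu (x + 1) := by
  rw [symmMeasure, symmMeasure, if_pos hx, if_pos (by omega)]
  have : Finset.Icc 1 (x + 1) = insert (x + 1) (Finset.Icc 1 x) := by
    ext y; simp only [Finset.mem_Icc, Finset.mem_insert]; omega
  have h0 := (hm (x + 1) (by omega)).ne'
  rw [this, Finset.prod_insert (by simp), add_sub_cancel_right]
  field_simp

theorem symmMeasure_of_nonpos {x : ℤ} (hx : x ≤ 0) :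
    symmMeasure lam mu x = ∏ k ∈ Finset.Icc (x + 1) 0, mu k / lam (k - 1) := by
  rcases hx.lt_or_eq with h | rfl
  · rw [symmMeasure, if_neg (by omega)]
    refine Finset.prod_nbij' (fun i => x + i) (fun k => k - x) ?_ ?_ ?_ ?_ ?_
    · intro i hi; rw [Finset.mem_Icc] at hi ⊢; omega
    · intro i hi; rw [Finset.mem_Icc] at hi ⊢; omega
    · intro i _; ring
    · intro i _; ring
    · intro i _; rfl
  · simp [symmMeasure]

theorem symmMeasure_pos (hl : ∀ x, 0 < lam x) (hm : ∀ x, 0 < mu x) (x : ℤ) :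
    0 < symmMeasure lam mu x := by
  rcases le_total 0 x with h | h
  · exact symmMeasure_pos_of_nonneg (fun x _ => hl x) (fun x _ => hm x) h
  · rw [symmMeasure_of_nonpos h]
    exact Finset.prod_pos fun i _ => div_pos (hm _) (hl _)

theorem symmMeasure_balance (hl : ∀ x, 0 < lam x) (hm : ∀ x, 0 < mu x) (x : ℤ) :
    symmMeasure lam mu x * lam x = symmMeasure lam mu (x + 1) * mu (x + 1) := by
  rcases le_or_gt 0 x with h | h
  · exact symmMeasure_balance_of_nonneg (fun x _ => hm x) h
  · rw [symmMeasure_of_nonpos h.le, symmMeasure_of_nonpos (by omega)]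
    have : Finset.Icc (x + 1) 0 = insert (x + 1) (Finset.Icc (x + 1 + 1) 0) := by
      ext y; simp only [Finset.mem_Icc, Finset.mem_insert]; omega
    have h0 := (hl x).ne'
    rw [this, Finset.prod_insert (by simp), add_sub_cancel_right]
    field_simp

end Symm

/-! ### Uniform description of the two kinds of chain -/

/-- The consequences of `IsChainOn` on which everything else rests. -/
structure ChainData (I : Set ℤ) (lam mu : ℤ → ℝ) : Prop where
  lam_nonneg : ∀ x, 0 ≤ lam x
  mu_nonneg : ∀ x, 0 ≤ mu x
  upper : ∀ x ∈ I, ∀ y, x ≤ y → y ∈ I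
  mu_mem : ∀ x ∈ I, mu x ≠ 0 → x - 1 ∈ I
  lyapunov : ∃ φ, IsLyapunov (bdGenerator lam mu) bdSupp φ
  dual_lyapunov : ∃ ψ, IsLyapunov (bdGenerator (dualBirth mu) (dualDeath lam)) bdSupp ψ
  dualSymm_pos : ∀ x ∈ I, 0 < dualSymm lam mu x
  dual_absorbing : ∀ x, x ∉ I → dualBirth mu x = 0 ∧ dualDeath lam x = 0
  dual_balance : ∀ x ∈ I, dualSymm lam mu x * dualBirth mu x =
    dualSymm lam mu (x + 1) * dualDeath lam (x + 1)

section ChainData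

variable {lam mu : ℤ → ℝ}

theorem HalfLineRates.chainData (h : HalfLineRates lam mu) :
    ChainData (Set.Ici 0) lam mu := by
  set π := symmMeasure lam mu with hπ
  have hπ0 : ∀ x, 0 ≤ x → 0 < π x := fun x hx =>
    symmMeasure_pos_of_nonneg h.birth_pos h.death_pos hx
  have hbal : ∀ x, 0 ≤ x → π x * lam x = π (x + 1) * mu (x + 1) := fun x hx =>
    symmMeasure_balance_of_nonneg h.death_pos hx
  have hdb : ∀ x, 0 ≤ x → 0 < dualBirth mu x := fun x hx => h.death_pos _ (by omega)
  have hlp : ∀ x, 0 ≤ x → 0 < 1 / (lam x * π x) := fun x hx =>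
    one_div_pos.2 (mul_pos (h.birth_pos x hx) (hπ0 x hx))
  refine ⟨fun x => ?_, fun x => ?_, fun x hx y hxy => le_trans (Set.mem_Ici.1 hx) hxy, ?_,
    ?_, ?_, ?_, ?_, ?_⟩
  · rcases lt_or_ge x 0 with hx | hx
    · exact (h.birth_neg x hx).ge
    · exact (h.birth_pos x hx).le
  · rcases lt_trichotomy x 0 with hx | hx | hx
    · exact (h.death_neg x hx).ge
    · rw [hx]; exact h.death_zero.ge
    · exact (h.death_pos x hx).le
  · intro x hx hmu
    rw [Set.mem_Ici] at hx ⊢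
    rcases hx.lt_or_eq with h1 | rfl
    · omega
    · exact absurd h.death_zero hmu
  · refine exists_isLyapunov_of_barriers
      (exists_barrier_top (k := 0) (a := π) (b := fun x => 1 / (lam x * π x)) hπ0 hlp
        (fun x hx => ?_) (fun x hx => ?_) ?_)
      (exists_barrier_bot_of_absorbing h.birth_neg h.death_neg)
    · have := (h.birth_pos x hx).ne'; have := (hπ0 x hx).ne'
      field_simp
    · have h1 := hbal (x - 1) (by omega)
      rw [sub_add_cancel] at h1
      have := (h.birth_pos (x - 1) (by omega)).ne'; have := (hπ0 (x - 1) (by omega)).ne'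
      field_simp
      linarith
    · rw [← h.not_exit]
      symm
      refine tsum_subtype_eq_of_support_subset (f := fun j : ℤ =>
        ENNReal.ofReal (1 / (lam j * π j)) * ∑ i ∈ Finset.Icc (0 : ℤ) j, ENNReal.ofReal (π i)) ?_
      intro j hj
      by_contra hcon
      rw [Set.mem_Ici] at hcon
      exact hj (by simp only [Finset.Icc_eq_empty hcon, Finset.sum_empty, mul_zero])
  · refine exists_isLyapunov_of_barriers
      (exists_barrier_top (k := 0) (a := fun x => 1 / (lam x * π x)) (b := fun x => π (x + 1))
        hlp (fun x hx => hπ0 _ (by omega)) (fun x hx => ?_) (fun x hx => ?_) ?_)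
      (exists_barrier_bot_of_absorbing (fun x hx => ?_) h.birth_neg)
    · have h1 := hbal x hx
      have := (h.birth_pos x hx).ne'; have := (hπ0 x hx).ne'
      simp only [dualBirth]
      field_simp
      linarith
    · have := (h.birth_pos x hx.le).ne'; have := (hπ0 x hx.le).ne'
      simp only [dualDeath, sub_add_cancel]
      field_simp
    · rw [← h.not_entrance]
      -- Tonelli, after writing both sides as double sums over `0 ≤ i < j`
      have e1 : ∀ j : ℤ, ENNReal.ofReal (π (j + 1)) *
          ∑ i ∈ Finset.Icc 0 j, ENNReal.ofReal (1 / (lam i * π i)) =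
          ∑' i : ℤ, if 0 ≤ i ∧ i < j + 1 then
            ENNReal.ofReal (1 / (lam i * π i)) * ENNReal.ofReal (π (j + 1)) else 0 := by
        intro j
        rw [tsum_eq_sum (s := Finset.Icc 0 j), Finset.mul_sum]
        · refine Finset.sum_congr rfl fun i hi => ?_
          rw [Finset.mem_Icc] at hi
          rw [if_pos (by omega), mul_comm]
        · intro i hi
          rw [Finset.mem_Icc] at hi
          rw [if_neg (by omega)]
      simp only [e1]
      refine ((Equiv.addRight (1 : ℤ)).tsum_eq (fun j : ℤ => ∑' i : ℤ, if 0 ≤ i ∧ i < j then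
            ENNReal.ofReal (1 / (lam i * π i)) * ENNReal.ofReal (π j) else 0)).trans ?_
      rw [ENNReal.tsum_comm, tsum_subtype (Set.Ici (0 : ℤ)) (fun j : ℤ =>
          ENNReal.ofReal (1 / (lam j * π j)) *
            ∑' i : Set.Ici (j + 1), ENNReal.ofReal (π i))]
      refine tsum_congr fun i => ?_
      by_cases hi : 0 ≤ i
      · rw [Set.indicator_of_mem (Set.mem_Ici.2 hi), tsum_subtype (Set.Ici (i + 1))
          (fun j => ENNReal.ofReal (π j)), ← ENNReal.tsum_mul_left]
        refine tsum_congr fun j => ?_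
        by_cases hj : i < j
        · rw [if_pos ⟨hi, hj⟩, Set.indicator_of_mem (Set.mem_Ici.2 (by omega))]
        · rw [if_neg (fun h => hj h.2), Set.indicator_of_notMem (fun h => hj (by
            have := Set.mem_Ici.1 h; omega)), mul_zero]
      · rw [Set.indicator_of_notMem (by rwa [Set.mem_Ici])]
        simp [hi]
    · rcases lt_or_ge (x + 1) 0 with h1 | h1
      · exact h.death_neg _ h1
      · have : x + 1 = 0 := by omega
        rw [dualBirth, this, h.death_zero]
  · exact fun x hx => symmMeasure_pos_of_nonneg hdb (fun x hx => h.birth_pos x (by omega)) hx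
  · intro x hx
    rw [Set.mem_Ici, not_le] at hx
    refine ⟨?_, h.birth_neg x hx⟩
    rcases lt_or_ge (x + 1) 0 with h1 | h1
    · exact h.death_neg _ h1
    · have : x + 1 = 0 := by omega
      rw [dualBirth, this, h.death_zero]
  · exact fun x hx => symmMeasure_balance_of_nonneg (fun x hx => h.birth_pos x (by omega)) hx

theorem BilateralRates.chainData (h : BilateralRates lam mu) :
    ChainData Set.univ lam mu := by
  set π := symmMeasure lam mu with hπ
  have hπ0 : ∀ x, 0 < π x := fun x => symmMeasure_pos h.birth_pos h.death_pos x
  have hbal : ∀ x, π x * lam x = π (x + 1) * mu (x + 1) := fun x =>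
    symmMeasure_balance h.birth_pos h.death_pos x
  have hlp : ∀ x, 0 < 1 / (lam x * π x) := fun x =>
    one_div_pos.2 (mul_pos (h.birth_pos x) (hπ0 x))
  have hp1 : ∀ x, lam x * (1 / (lam x * π x)) * π x = 1 := fun x => by
    have := (h.birth_pos x).ne'; have := (hπ0 x).ne'
    field_simp
  have hp2 : ∀ x, mu x * (1 / (lam (x - 1) * π (x - 1))) * π x = 1 := fun x => by
    have h1 := hbal (x - 1)
    rw [sub_add_cancel] at h1
    have := (h.birth_pos (x - 1)).ne'; have := (hπ0 (x - 1)).ne'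
    field_simp
    linarith
  have hd1 : ∀ x, dualBirth mu x * π (x + 1) * (1 / (lam x * π x)) = 1 := fun x => by
    have h1 := hbal x
    have := (h.birth_pos x).ne'; have := (hπ0 x).ne'
    simp only [dualBirth]
    field_simp
    linarith
  have hd2 : ∀ x, dualDeath lam x * π (x - 1 + 1) * (1 / (lam x * π x)) = 1 := fun x => by
    have := (h.birth_pos x).ne'; have := (hπ0 x).ne'
    simp only [dualDeath, sub_add_cancel]
    field_simp
  have hneg : ∀ (f : ℤ → ℝ≥0∞) (y : ℤ),
      ∑ i ∈ Finset.Icc 1 y, f (-i) = ∑ i ∈ Finset.Icc (-y) (-1), f i := by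
    intro f y
    refine Finset.sum_nbij' (fun i => -i) (fun i => -i) ?_ ?_ ?_ ?_ ?_
    · intro i hi; rw [Finset.mem_Icc] at hi ⊢; omega
    · intro i hi; rw [Finset.mem_Icc] at hi ⊢; omega
    · intro i _; ring
    · intro i _; ring
    · intro i _; rfl
  refine ⟨fun x => (h.birth_pos x).le, fun x => (h.death_pos x).le, fun _ _ y _ => Set.mem_univ y,
    fun x _ _ => Set.mem_univ _, ?_, ?_, fun x _ => ?_, fun x hx => absurd (Set.mem_univ x) hx,
    fun x _ => ?_⟩
  · refine exists_isLyapunov_of_barriers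
      (exists_barrier_top (k := 1) (a := π) (b := fun x => 1 / (lam x * π x)) (fun x _ => hπ0 x)
        (fun x _ => hlp x) (fun x _ => hp1 x) (fun x _ => hp2 x) ?_)
      (exists_barrier_bot (k := 1) (a := π) (b := fun x => 1 / (lam x * π x)) (fun x _ => hπ0 x)
        (fun x _ => hlp _) (fun x _ => hp1 x) (fun x _ => hp2 x) ?_)
    · rw [← h.not_exit_top]
      symm
      refine tsum_subtype_eq_of_support_subset (f := fun j : ℤ =>
        ENNReal.ofReal (1 / (lam j * π j)) * ∑ i ∈ Finset.Icc (1 : ℤ) j, ENNReal.ofReal (π i)) ?_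
      intro j hj
      by_contra hcon
      rw [Set.mem_Ici] at hcon
      exact hj (by simp only [Finset.Icc_eq_empty hcon, Finset.sum_empty, mul_zero])
    · rw [← h.not_exit_bot]
      have e : ∑' j : Set.Iic (-1 : ℤ), ENNReal.ofReal (1 / (lam j * π j)) *
          ∑ i ∈ Finset.Icc ((j : ℤ) + 1) (-1), ENNReal.ofReal (π i) =
          ∑' j : ℤ, ENNReal.ofReal (1 / (lam j * π j)) *
            ∑ i ∈ Finset.Icc (j + 1) (-1), ENNReal.ofReal (π i) := by
        refine tsum_subtype_eq_of_support_subset (f := fun j : ℤ =>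
          ENNReal.ofReal (1 / (lam j * π j)) *
            ∑ i ∈ Finset.Icc (j + 1) (-1), ENNReal.ofReal (π i)) ?_
        intro j hj
        by_contra hcon
        refine hj ?_
        rw [Set.mem_Iic] at hcon
        simp only [Finset.Icc_eq_empty (show ¬ j + 1 ≤ -1 by omega), Finset.sum_empty, mul_zero]
      rw [e]
      refine Eq.trans (tsum_congr fun j => ?_) ((Equiv.subLeft (-1 : ℤ)).tsum_eq _)
      rw [hneg (fun i => ENNReal.ofReal (π i)), Equiv.subLeft_apply,
        show (-1 : ℤ) - j = -j - 1 by ring, show -j - 1 + 1 = -j by ring]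
  · refine exists_isLyapunov_of_barriers
      (exists_barrier_top (k := 1) (a := fun x => 1 / (lam x * π x)) (b := fun x => π (x + 1))
        (fun x _ => hlp x) (fun x _ => hπ0 _) (fun x _ => hd1 x) (fun x _ => hd2 x) ?_)
      (exists_barrier_bot (k := 1) (a := fun x => 1 / (lam x * π x)) (b := fun x => π (x + 1))
        (fun x _ => hlp x) (fun x _ => hπ0 _) (fun x _ => hd1 x) (fun x _ => hd2 x) ?_)
    · rw [← h.not_entrance_top]
      have e : ∑' j : Set.Ici (1 : ℤ), ENNReal.ofReal (π j) *
          ∑ i ∈ Finset.Ico (1 : ℤ) j, ENNReal.ofReal (1 / (lam i * π i)) =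
          ∑' j : ℤ, ENNReal.ofReal (π j) *
            ∑ i ∈ Finset.Ico (1 : ℤ) j, ENNReal.ofReal (1 / (lam i * π i)) := by
        refine tsum_subtype_eq_of_support_subset (f := fun j : ℤ => ENNReal.ofReal (π j) *
            ∑ i ∈ Finset.Ico (1 : ℤ) j, ENNReal.ofReal (1 / (lam i * π i))) ?_
        intro j hj
        by_contra hcon
        refine hj ?_
        rw [Set.mem_Ici] at hcon
        simp only [Finset.Ico_eq_empty (show ¬ 1 < j by omega), Finset.sum_empty, mul_zero]
      rw [e]
      refine Eq.trans (tsum_congr fun j => ?_) ((Equiv.addRight (1 : ℤ)).tsum_eq _)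
      rw [Equiv.coe_addRight]
      congr 2
    · rw [← h.not_entrance_bot]
      have e : ∑' j : Set.Iic (-1 : ℤ), ENNReal.ofReal (π j) *
          ∑ i ∈ Finset.Icc (j : ℤ) (-1), ENNReal.ofReal (1 / (lam i * π i)) =
          ∑' j : ℤ, ENNReal.ofReal (π j) *
            ∑ i ∈ Finset.Icc j (-1), ENNReal.ofReal (1 / (lam i * π i)) := by
        refine tsum_subtype_eq_of_support_subset (f := fun j : ℤ => ENNReal.ofReal (π j) *
            ∑ i ∈ Finset.Icc j (-1), ENNReal.ofReal (1 / (lam i * π i))) ?_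
        intro j hj
        by_contra hcon
        refine hj ?_
        rw [Set.mem_Iic] at hcon
        simp only [Finset.Icc_eq_empty (show ¬ j ≤ -1 by omega), Finset.sum_empty, mul_zero]
      rw [e]
      refine Eq.trans (tsum_congr fun j => ?_) ((Equiv.neg ℤ).tsum_eq _)
      rw [hneg (fun i => ENNReal.ofReal (1 / (lam i * π i))), Equiv.neg_apply, sub_add_cancel]
  · exact symmMeasure_pos (fun x => h.death_pos _) (fun x => h.birth_pos x) x
  · exact symmMeasure_balance (fun x => h.death_pos _) (fun x => h.birth_pos x) x

theorem IsChainOn.chainData {I : Set ℤ} (h : IsChainOn I lam mu) : ChainData I lam mu := by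
  rcases h with ⟨rfl, h⟩ | ⟨rfl, h⟩
  · exact h.chainData
  · exact h.chainData

variable {I : Set ℤ}

/-- Reversibility of the dual chain. -/
theorem ChainData.dual_reversible (h : ChainData I lam mu) {t : ℝ} (ht : 0 ≤ t) {x y : ℤ}
    (hx : x ∈ I) (hy : y ∈ I) : dualSymm lam mu x * dualDensity lam mu t x y =
      dualSymm lam mu y * dualDensity lam mu t y x := by
  refine (isRateMatrix_bd (dualBirth_nonneg h.mu_nonneg)
    (dualDeath_nonneg h.lam_nonneg)).reversible (I := I) (fun u hu z => ?_) h.dualSymm_pos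
    (fun x hx y hy => ?_) ht hx hy
  · obtain ⟨h1, h2⟩ := h.dual_absorbing u hu
    simp [bdGenerator, h1, h2]
  · by_cases h1 : y = x + 1
    · subst h1
      rw [bdGenerator, bdGenerator, if_pos rfl, if_neg (by omega), if_neg (by omega),
        if_pos (by omega)]
      exact h.dual_balance x hx
    by_cases h2 : x = y + 1
    · subst h2
      rw [bdGenerator, bdGenerator, if_neg (by omega), if_neg (by omega), if_pos (by omega),
        if_pos rfl]
      exact (h.dual_balance y hy).symm
    by_cases h3 : x = y
    · rw [h3]
    · rw [bdGenerator, bdGenerator, if_neg (by omega), if_neg (by omega), if_neg (by omega),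
        if_neg (by omega), if_neg (by omega), if_neg (by omega), mul_zero, mul_zero]

end ChainData

/-! ### Iterated differences and multilinear maps -/

section Differences

/-- Inclusion-exclusion form of an iterated difference with step `d`. -/
theorem neg_one_pow_mul_foldr_diff {n : ℕ} (d : ℤ) (D : Fin n → ((Fin n → ℤ) → ℝ) → (Fin n → ℤ) → ℝ)
    (hD : ∀ i f z, D i f z = f (Function.update z i (z i + d)) - f z) (f : (Fin n → ℤ) → ℝ)
    (l : List (Fin n)) (hl : l.Nodup) (z : Fin n → ℤ) :
    (-1) ^ l.length * l.foldr D f z =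
      ∑ s ∈ l.toFinset.powerset, (-1) ^ s.card * f (s.piecewise (fun i => z i + d) z) := by
  induction l generalizing z with
  | nil => simp
  | cons i l ih =>
    rw [List.nodup_cons] at hl
    have hi : i ∉ l.toFinset := by simpa using hl.1
    rw [List.foldr_cons, hD, List.toFinset_cons, Finset.sum_powerset_insert hi, List.length_cons,
      pow_succ, mul_neg_one, neg_mul, mul_sub, neg_sub, ih hl.2, ih hl.2, sub_eq_add_neg,
      ← Finset.sum_neg_distrib]
    congr 1
    refine Finset.sum_congr rfl fun s hs => ?_
    have his : i ∉ s := fun h => hi (Finset.mem_powerset.1 hs h)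
    rw [Finset.card_insert_of_notMem his, pow_succ, mul_neg_one, neg_mul]
    congr 3
    funext j
    by_cases hj : j = i
    · subst hj; simp [his]
    · by_cases hjs : j ∈ s <;> simp [hj, hjs]

theorem neg_one_pow_mul_fwdDiffAll {n : ℕ} (f : (Fin n → ℤ) → ℝ) (z : Fin n → ℤ) :
    (-1) ^ n * fwdDiffAll f z =
      ∑ s : Finset (Fin n), (-1) ^ s.card * f (s.piecewise (fun i => z i + 1) z) := by
  have h := neg_one_pow_mul_foldr_diff 1 fwdDiffAt (fun _ _ _ => rfl) f (List.finRange n)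
    (List.nodup_finRange n) z
  rw [List.length_finRange, List.toFinset_finRange, Finset.powerset_univ] at h
  exact h

theorem neg_one_pow_mul_bwdDiffAll {n : ℕ} (f : (Fin n → ℤ) → ℝ) (z : Fin n → ℤ) :
    (-1) ^ n * bwdDiffAll f z =
      ∑ s : Finset (Fin n), (-1) ^ s.card * f (s.piecewise (fun i => z i - 1) z) := by
  have h := neg_one_pow_mul_foldr_diff (-1) bwdDiffAt (fun _ _ _ => rfl) f (List.finRange n)
    (List.nodup_finRange n) z
  rw [List.length_finRange, List.toFinset_finRange, Finset.powerset_univ] at h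
  exact h

/-- Differences in all the arguments of a multilinear map. -/
theorem sum_neg_one_pow_card_mul {n : ℕ} {E : Type*} [AddCommGroup E] [Module ℝ E]
    (M : MultilinearMap ℝ (fun _ : Fin n => E) ℝ) (a b : Fin n → E) :
    ∑ s : Finset (Fin n), (-1) ^ s.card * M (s.piecewise a b) = M (fun i => b i - a i) := by
  have h := M.map_add_univ (fun i => (-1 : ℝ) • a i) b
  have e : (fun i => (-1 : ℝ) • a i) + b = fun i => b i - a i := by
    funext i
    rw [Pi.add_apply, neg_one_smul, neg_add_eq_sub]
  rw [e] at h
  rw [h]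
  refine Finset.sum_congr rfl fun s _ => ?_
  have h2 := M.map_piecewise_smul (fun _ => (-1 : ℝ)) (s.piecewise a b) s
  rw [Finset.prod_const, smul_eq_mul] at h2
  rw [← h2]
  congr 1
  funext i
  by_cases hi : i ∈ s <;> simp [hi]

theorem sum_neg_one_pow_card_mul_prod {n : ℕ} (a b : Fin n → ℝ) :
    ∑ s : Finset (Fin n), (-1) ^ s.card * ∏ i, s.piecewise a b i = ∏ i, (b i - a i) := by
  simpa using sum_neg_one_pow_card_mul (MultilinearMap.mkPiAlgebra ℝ (Fin n) ℝ) a b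

theorem sum_neg_one_pow_card_mul_det {n : ℕ} (a b : Fin n → Fin n → ℝ) :
    ∑ s : Finset (Fin n), (-1) ^ s.card * Matrix.det (Matrix.of (s.piecewise a b)) =
      Matrix.det (Matrix.of fun i => b i - a i) :=
  sum_neg_one_pow_card_mul
    (Matrix.detRowAlternating (n := Fin n) (R := ℝ)).toMultilinearMap a b

end Differences

/-! ### Events of the flow -/

section Events

variable {I : Set ℤ} {lam mu : ℤ → ℝ} {t : ℝ} {a b : ℤ}

/-- The indicator of `a = b`. -/
def eqInd (a b : ℤ) : ℝ := if a = b then 1 else 0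

theorem leInd_sub_leInd_pred (a b : ℤ) : leInd a b - leInd a (b - 1) = eqInd a b := by
  unfold leInd eqInd
  rcases lt_trichotomy a b with h | h | h
  · rw [if_pos h.le, if_pos (by omega), if_neg h.ne, sub_self]
  · rw [if_pos h.le, if_neg (by omega), if_pos h, sub_zero]
  · rw [if_neg (by omega), if_neg (by omega), if_neg h.ne', sub_self]

theorem eqInd_nonneg (a b : ℤ) : 0 ≤ eqInd a b := by unfold eqInd; split_ifs <;> norm_num

theorem eqInd_le_one (a b : ℤ) : eqInd a b ≤ 1 := by unfold eqInd; split_ifs <;> norm_num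

theorem prod_eqInd {n : ℕ} (a b : Fin n → ℤ) :
    ∏ i, eqInd (a i) (b i) = if a = b then 1 else 0 := by
  unfold eqInd
  split_ifs with h
  · exact Finset.prod_eq_one fun k _ => if_pos (congrFun h k)
  · obtain ⟨k, hk⟩ := Function.ne_iff.1 h
    exact Finset.prod_eq_zero (Finset.mem_univ k) (if_neg hk)

/-- The indicator of `Φ (y j) ≤ y' j < Φ (y j + 1)` for all `j`, for monotone `Φ`. -/
def crossing {n : ℕ} (Φ : ℤ → ℤ) (y y' : Fin n → ℤ) : ℝ :=
  ∏ j, (leInd (Φ (y j)) (y' j) - leInd (Φ (y j + 1)) (y' j))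

theorem crossing_nonneg {n : ℕ} {Φ : ℤ → ℤ} (hΦ : Monotone Φ) (y y' : Fin n → ℤ) :
    0 ≤ crossing Φ y y' :=
  Finset.prod_nonneg fun j _ => sub_nonneg.2 (leInd_antitone_left (hΦ (by omega)) _)

theorem crossing_le_one {n : ℕ} {Φ : ℤ → ℤ} (hΦ : Monotone Φ) (y y' : Fin n → ℤ) :
    crossing Φ y y' ≤ 1 :=
  Finset.prod_le_one (fun j _ => sub_nonneg.2 (leInd_antitone_left (hΦ (by omega)) _))
    fun j _ => by
      have := leInd_le_one (Φ (y j)) (y' j)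
      have := leInd_nonneg (Φ (y j + 1)) (y' j)
      linarith

theorem crossing_ne_zero {n : ℕ} {Φ : ℤ → ℤ} (hΦ : Monotone Φ) {y y' : Fin n → ℤ}
    (h : crossing Φ y y' ≠ 0) (j : Fin n) : Φ (y j) ≤ y' j ∧ y' j < Φ (y j + 1) := by
  have hj := Finset.prod_ne_zero_iff.1 h j (Finset.mem_univ j)
  have hm := hΦ (show y j ≤ y j + 1 by omega)
  by_contra hcon
  refine hj ?_
  unfold leInd
  split_ifs <;> first | exact sub_self _ | omega

theorem FlowModel.summable_mul (m : FlowModel I lam mu t a b) {f : m.Ω → ℝ}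
    (h0 : ∀ ω, 0 ≤ f ω) (h1 : ∀ ω, f ω ≤ 1) : Summable fun ω => m.p ω * f ω :=
  Summable.of_nonneg_of_le (fun ω => mul_nonneg (m.p_nonneg ω) (h0 ω))
    (fun ω => mul_le_of_le_one_right (m.p_nonneg ω) (h1 ω)) m.p_sum.summable

theorem prod_leInd_nonneg {κ : Type*} [Fintype κ] (u v : κ → ℤ) : 0 ≤ ∏ k, leInd (u k) (v k) :=
  Finset.prod_nonneg fun _ _ => leInd_nonneg _ _

theorem prod_leInd_le_one {κ : Type*} [Fintype κ] (u v : κ → ℤ) : ∏ k, leInd (u k) (v k) ≤ 1 :=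
  Finset.prod_le_one (fun _ _ => leInd_nonneg _ _) fun _ _ => leInd_le_one _ _

theorem sum_crossing {n : ℕ} (Φ : ℤ → ℤ) (y y' : Fin n → ℤ) :
    ∑ s : Finset (Fin n), (-1) ^ s.card *
      ∏ j, leInd (Φ (s.piecewise (fun j => y j + 1) y j)) (y' j) = crossing Φ y y' := by
  rw [crossing, ← sum_neg_one_pow_card_mul_prod]
  refine Finset.sum_congr rfl fun s _ => ?_
  congr 1
  refine Finset.prod_congr rfl fun j _ => ?_
  by_cases hj : j ∈ s <;> simp [hj]

theorem sum_eqInd {n : ℕ} (u x' : Fin n → ℤ) :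
    ∑ r : Finset (Fin n), (-1) ^ r.card *
      ∏ i, leInd (u i) (r.piecewise (fun i => x' i - 1) x' i) = ∏ i, eqInd (u i) (x' i) := by
  simp only [← leInd_sub_leInd_pred]
  rw [← sum_neg_one_pow_card_mul_prod]
  refine Finset.sum_congr rfl fun s _ => ?_
  congr 1
  refine Finset.prod_congr rfl fun j _ => ?_
  by_cases hj : j ∈ s <;> simp [hj]

theorem sum_neg_one_pow_card_mul_tsum {n : ℕ} {Ω : Type*} {f : Finset (Fin n) → Ω → ℝ}
    (hf : ∀ s, Summable (f s)) :
    ∑ s, (-1 : ℝ) ^ s.card * ∑' ω, f s ω = ∑' ω, ∑ s, (-1 : ℝ) ^ s.card * f s ω := by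
  rw [Summable.tsum_finsetSum fun s _ => (hf s).mul_left _]
  exact Finset.sum_congr rfl fun s _ => (tsum_mul_left).symm

/-- The differences in the two-level kernel turn the distribution function of the flow into the
probability of `Φ x = x'` and `Φ (y j) ≤ y' j < Φ (y j + 1)` for all `j`. -/
theorem FlowModel.diff_flowCDF (m : FlowModel I lam mu t a b) {n k : ℕ} {x x' : Fin k → ℤ}
    {y y' : Fin n → ℤ} (hx : ∀ i, a ≤ x i) (hx' : ∀ i, x i ≤ b) (hy : ∀ j, a ≤ y j)
    (hy' : ∀ j, y j + 1 ≤ b) :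
    (-1) ^ n * fwdDiffAll (fun y => (-1) ^ k * bwdDiffAll (fun x' =>
        flowCDF lam mu t (Sum.elim x y) (Sum.elim x' y')) x') y =
      ∑' ω, m.p ω * ((∏ i, eqInd (m.Φ ω (x i)) (x' i)) * crossing (m.Φ ω) y y') := by
  rw [neg_one_pow_mul_fwdDiffAll]
  simp only [neg_one_pow_mul_bwdDiffAll]
  have hcdf : ∀ (s : Finset (Fin n)) (r : Finset (Fin k)),
      flowCDF lam mu t (Sum.elim x (s.piecewise (fun j => y j + 1) y))
        (Sum.elim (r.piecewise (fun i => x' i - 1) x') y') =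
      ∑' ω, m.p ω * ((∏ i, leInd (m.Φ ω (x i)) (r.piecewise (fun i => x' i - 1) x' i)) *
        ∏ j, leInd (m.Φ ω (s.piecewise (fun j => y j + 1) y j)) (y' j)) := by
    intro s r
    rw [m.cdf]
    · simp only [Fintype.prod_sum_type, Sum.elim_inl, Sum.elim_inr]
    · rintro (i | j)
      · exact hx i
      · have := hy j
        by_cases hj : j ∈ s <;> simp [hj] <;> omega
    · rintro (i | j)
      · exact hx' i
      · have := hy' j
        by_cases hj : j ∈ s <;> simp [hj] <;> omega
  simp only [hcdf]
  have hsum : ∀ (s : Finset (Fin n)) (r : Finset (Fin k)), Summable fun ω => m.p ω *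
      ((∏ i, leInd (m.Φ ω (x i)) (r.piecewise (fun i => x' i - 1) x' i)) *
        ∏ j, leInd (m.Φ ω (s.piecewise (fun j => y j + 1) y j)) (y' j)) := fun s r =>
    m.summable_mul (fun ω => mul_nonneg (prod_leInd_nonneg _ _) (prod_leInd_nonneg _ _))
      fun ω => mul_le_one₀ (prod_leInd_le_one _ _) (prod_leInd_nonneg _ _) (prod_leInd_le_one _ _)
  simp only [sum_neg_one_pow_card_mul_tsum (hsum _)]
  rw [sum_neg_one_pow_card_mul_tsum fun s => summable_sum fun r _ => (hsum s r).mul_left _]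
  refine tsum_congr fun ω => ?_
  rw [← sum_eqInd, ← sum_crossing]
  simp only [Finset.mul_sum, Finset.sum_mul]
  exact Finset.sum_congr rfl fun s _ => Finset.sum_congr rfl fun r _ => by ring

/-- The Karlin-McGregor formula for the dual chain, read off the flow. The configurations
`y + 1_s` are still nondecreasing, so that Warren's formula applies to each of them, and the signed
sum over `s` acts on the rows of its determinant. -/
theorem FlowModel.tsum_crossing (h : ChainData I lam mu) (ht : 0 ≤ t)
    (m : FlowModel I lam mu t a b) {n : ℕ} {y y' : Fin n → ℤ} (hys : StrictMono y)
    (hys' : StrictMono y') (hy : ∀ j, a ≤ y j) (hy' : ∀ j, y j + 1 ≤ b) :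
    ∑' ω, m.p ω * crossing (m.Φ ω) y y' =
      Matrix.det (Matrix.of fun i j => dualDensity lam mu t (y' j) (y i)) := by
  obtain ⟨φ, hφ⟩ := h.lyapunov
  obtain ⟨ψ, hψ⟩ := h.dual_lyapunov
  have hmono : ∀ s : Finset (Fin n), Monotone (s.piecewise (fun j => y j + 1) y) := by
    intro s i j hij
    rcases hij.lt_or_eq with hlt | rfl
    · have := hys hlt
      by_cases hi : i ∈ s <;> by_cases hj : j ∈ s <;> simp [hi, hj] <;> omega
    · exact le_rfl
  have h1 : ∀ s : Finset (Fin n), ∑' ω, m.p ω *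
      ∏ j, leInd (m.Φ ω (s.piecewise (fun j => y j + 1) y j)) (y' j) =
      Matrix.det (Matrix.of (s.piecewise
        (fun i j => chainCDF lam mu t (y i + 1) (y' j) - if i < j then 1 else 0)
        (fun i j => chainCDF lam mu t (y i) (y' j) - if i < j then 1 else 0))) := by
    intro s
    rw [← m.cdf, flowCDF_eq_warrenDet h.lam_nonneg h.mu_nonneg hφ ht (hmono s) hys'.monotone,
      warrenDet]
    · congr 2
      funext i j
      by_cases hi : i ∈ s <;> simp [hi]
    · intro j
      have := hy j
      by_cases hj : j ∈ s <;> simp [hj] <;> omega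
    · intro j
      have := hy' j
      by_cases hj : j ∈ s <;> simp [hj] <;> omega
  simp only [← sum_crossing, Finset.mul_sum]
  have h2 := sum_neg_one_pow_card_mul_tsum (f := fun (s : Finset (Fin n)) ω => m.p ω *
      ∏ j, leInd (m.Φ ω (s.piecewise (fun j => y j + 1) y j)) (y' j)) fun s =>
    m.summable_mul (fun ω => prod_leInd_nonneg _ _) (fun ω => prod_leInd_le_one _ _)
  simp only [h1] at h2
  rw [sum_neg_one_pow_card_mul_det] at h2
  refine Eq.trans (tsum_congr fun ω => Finset.sum_congr rfl fun s _ => by ring) (h2.symm.trans ?_)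
  congr 2
  funext i j
  rw [dualDensity_eq_sub h.lam_nonneg h.mu_nonneg hφ hψ ht]
  simp

/-- The Karlin-McGregor formula for the chain, read off the flow. Here the signed sum acts on the
columns of the determinant in Warren's formula. -/
theorem FlowModel.tsum_eqInd (h : ChainData I lam mu) (ht : 0 ≤ t)
    (m : FlowModel I lam mu t a b) {k : ℕ} {x x' : Fin k → ℤ} (hxs : StrictMono x)
    (hxs' : StrictMono x') (hx : ∀ i, a ≤ x i) (hx' : ∀ i, x i ≤ b) :
    ∑' ω, m.p ω * ∏ i, eqInd (m.Φ ω (x i)) (x' i) =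
      Matrix.det (Matrix.of fun i j => chainDensity lam mu t (x i) (x' j)) := by
  obtain ⟨φ, hφ⟩ := h.lyapunov
  have hmono : ∀ s : Finset (Fin k), Monotone (s.piecewise (fun j => x' j - 1) x') := by
    intro s i j hij
    rcases hij.lt_or_eq with hlt | rfl
    · have := hxs' hlt
      by_cases hi : i ∈ s <;> by_cases hj : j ∈ s <;> simp [hi, hj] <;> omega
    · exact le_rfl
  have h1 : ∀ s : Finset (Fin k), ∑' ω, m.p ω *
      ∏ i, leInd (m.Φ ω (x i)) (s.piecewise (fun j => x' j - 1) x' i) =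
      Matrix.det (Matrix.of (s.piecewise
        (fun j i => chainCDF lam mu t (x i) (x' j - 1) - if i < j then 1 else 0)
        (fun j i => chainCDF lam mu t (x i) (x' j) - if i < j then 1 else 0))) := by
    intro s
    rw [← m.cdf _ _ _ hx hx', flowCDF_eq_warrenDet h.lam_nonneg h.mu_nonneg hφ ht hxs.monotone
      (hmono s), warrenDet, ← Matrix.det_transpose]
    congr 1
    ext j i
    by_cases hj : j ∈ s <;> simp [hj]
  simp only [← sum_eqInd, Finset.mul_sum]
  have h2 := sum_neg_one_pow_card_mul_tsum (f := fun (s : Finset (Fin k)) ω => m.p ω *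
      ∏ i, leInd (m.Φ ω (x i)) (s.piecewise (fun j => x' j - 1) x' i)) fun s =>
    m.summable_mul (fun ω => prod_leInd_nonneg _ _) (fun ω => prod_leInd_le_one _ _)
  simp only [h1] at h2
  rw [sum_neg_one_pow_card_mul_det] at h2
  refine Eq.trans (tsum_congr fun ω => Finset.sum_congr rfl fun s _ => by ring) (h2.symm.trans ?_)
  rw [← Matrix.det_transpose]
  congr 1
  ext i j
  simp [chainDensity_eq_sub h.lam_nonneg h.mu_nonneg ht]

end Events

/-! ### The two-level kernel -/

section TwoLevelKernel

variable {I : Set ℤ} {lam mu : ℤ → ℝ} {t : ℝ} {n : ℕ}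

theorem ChainData.nonempty_flowModel (h : ChainData I lam mu) (ht : 0 ≤ t) {a b : ℤ}
    (hab : a ≤ b) : Nonempty (FlowModel I lam mu t a b) := by
  obtain ⟨φ, hφ⟩ := h.lyapunov
  exact InterlacingChains.nonempty_flowModel h.lam_nonneg h.mu_nonneg hφ
    (fun x hx _ => h.upper x hx _ (by omega)) h.mu_mem hab ht

theorem TwoLevel.eq_of_levels {w w' : TwoLevel I n} (hx : w.x = w'.x) (hy : w.y = w'.y) :
    w = w' := by
  cases w; cases w'; cases hx; cases hy; rfl

theorem twoLevelKernel_eq {a b : ℤ} (m : FlowModel I lam mu t a b) (w w' : TwoLevel I n)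
    (ha : a ≤ w.x 0) (hb : w.x (Fin.last n) ≤ b) :
    twoLevelKernel I lam mu n t w w' =
      (∏ i, dualSymm lam mu (w'.y i)) / (∏ i, dualSymm lam mu (w.y i)) *
        ∑' ω, m.p ω * ((∏ i, eqInd (m.Φ ω (w.x i)) (w'.x i)) * crossing (m.Φ ω) w.y w'.y) := by
  have hm := w.x_strictMono.monotone
  rw [← m.diff_flowCDF]
  · rfl
  · exact fun i => ha.trans (hm (Fin.zero_le i))
  · exact fun i => (hm (Fin.le_last i)).trans hb
  · exact fun j => ha.trans ((hm (Fin.zero_le _)).trans (w.le j))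
  · exact fun j => (Int.add_one_le_of_lt (w.lt j)).trans ((hm (Fin.le_last _)).trans hb)

theorem ChainData.prod_dualSymm_pos (h : ChainData I lam mu) {y : Fin n → ℤ}
    (hy : ∀ i, y i ∈ I) : 0 < ∏ i, dualSymm lam mu (y i) :=
  Finset.prod_pos fun i _ => h.dualSymm_pos _ (hy i)

theorem prod_eqInd_mul_crossing_nonneg {a b : ℤ} (m : FlowModel I lam mu t a b) {k : ℕ}
    (x x' : Fin k → ℤ) (y y' : Fin n → ℤ) (ω : m.Ω) :
    0 ≤ (∏ i, eqInd (m.Φ ω (x i)) (x' i)) * crossing (m.Φ ω) y y' :=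
  mul_nonneg (Finset.prod_nonneg fun _ _ => eqInd_nonneg _ _) (crossing_nonneg (m.mono ω) _ _)

theorem prod_eqInd_mul_crossing_le_one {a b : ℤ} (m : FlowModel I lam mu t a b) {k : ℕ}
    (x x' : Fin k → ℤ) (y y' : Fin n → ℤ) (ω : m.Ω) :
    (∏ i, eqInd (m.Φ ω (x i)) (x' i)) * crossing (m.Φ ω) y y' ≤ 1 :=
  mul_le_one₀ (Finset.prod_le_one (fun _ _ => eqInd_nonneg _ _) fun _ _ => eqInd_le_one _ _)
    (crossing_nonneg (m.mono ω) _ _) (crossing_le_one (m.mono ω) _ _)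

theorem ChainData.twoLevelKernel_nonneg (h : ChainData I lam mu) (ht : 0 ≤ t)
    (w w' : TwoLevel I n) : 0 ≤ twoLevelKernel I lam mu n t w w' := by
  obtain ⟨m⟩ := h.nonempty_flowModel ht (w.x_strictMono.monotone (Fin.zero_le (Fin.last n)))
  rw [twoLevelKernel_eq m w w' le_rfl le_rfl]
  exact mul_nonneg (div_nonneg (h.prod_dualSymm_pos w'.y_mem).le (h.prod_dualSymm_pos w.y_mem).le)
    (tsum_nonneg fun ω => mul_nonneg (m.p_nonneg ω) (prod_eqInd_mul_crossing_nonneg m _ _ _ _ ω))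

/-- Reversibility of the dual Karlin-McGregor kernel. -/
theorem ChainData.det_dualDensity (h : ChainData I lam mu) (ht : 0 ≤ t) {y y' : Fin n → ℤ}
    (hy : ∀ i, y i ∈ I) (hy' : ∀ i, y' i ∈ I) :
    (∏ i, dualSymm lam mu (y' i)) / (∏ i, dualSymm lam mu (y i)) *
        Matrix.det (Matrix.of fun i j => dualDensity lam mu t (y' j) (y i)) =
      Matrix.det (Matrix.of fun i j => dualDensity lam mu t (y i) (y' j)) := by
  have e : (Matrix.of fun i j => dualDensity lam mu t (y i) (y' j)) =
      Matrix.of fun i j => (dualSymm lam mu (y i))⁻¹ *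
        (Matrix.of fun i j => dualSymm lam mu (y' j) *
          (Matrix.of fun i j => dualDensity lam mu t (y' j) (y i)) i j) i j := by
    ext i j
    have h1 := h.dual_reversible ht (hy i) (hy' j)
    have h2 := (h.dualSymm_pos _ (hy i)).ne'
    simp only [Matrix.of_apply]
    rw [← h1, inv_mul_cancel_left₀ h2]
  rw [e, Matrix.det_mul_column, Matrix.det_mul_row, Finset.prod_inv_distrib]
  ring

theorem ChainData.dualKmKernel_nonneg (h : ChainData I lam mu) (ht : 0 ≤ t) (y y' : Weyl I n) :
    0 ≤ dualKmKernel I lam mu n t y y' := by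
  obtain ⟨a, ha⟩ := (Set.finite_range y'.1).bddBelow
  obtain ⟨b, hb⟩ := (Set.finite_range y'.1).bddAbove
  have ha' : ∀ j, a ≤ y'.1 j := fun j => ha ⟨j, rfl⟩
  have hb' : ∀ j, y'.1 j ≤ b := fun j => hb ⟨j, rfl⟩
  obtain ⟨m⟩ := h.nonempty_flowModel ht (le_max_left a (b + 1))
  have e := m.tsum_crossing h ht y'.2.1 y.2.1 ha'
    (fun j => le_max_of_le_right (by have := hb' j; omega))
  rw [dualKmKernel, ← Matrix.det_transpose]
  refine le_of_le_of_eq ?_ e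
  exact tsum_nonneg fun ω => mul_nonneg (m.p_nonneg ω) (crossing_nonneg (m.mono ω) _ _)

/-- The `Y`-level of the two-level process is autonomous: given `Φ (y j) ≤ y' j < Φ (y j + 1)`,
the points `Φ (x i)` interlace with `y'` automatically. -/
theorem ChainData.hasSum_twoLevelKernel (h : ChainData I lam mu) (ht : 0 ≤ t)
    (w : TwoLevel I n) (y' : Weyl I n) :
    HasSum (fun w' : (TwoLevel.projY ⁻¹' {y'} : Set (TwoLevel I n)) =>
      twoLevelKernel I lam mu n t w w') (dualKmKernel I lam mu n t w.projY y') := by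
  obtain ⟨m⟩ := h.nonempty_flowModel ht (w.x_strictMono.monotone (Fin.zero_le (Fin.last n)))
  have hm := w.x_strictMono.monotone
  have hT := (m.summable_mul (fun ω => crossing_nonneg (m.mono ω) w.y y'.1)
    (fun ω => crossing_le_one (m.mono ω) w.y y'.1)).hasSum
  rw [m.tsum_crossing h ht w.y_strictMono y'.2.1 (fun j => (hm (Fin.zero_le _)).trans (w.le j))
    (fun j => (Int.add_one_le_of_lt (w.lt j)).trans (hm (Fin.le_last _)))] at hT
  have hfib := hT.tsum_fiberwise fun ω i => m.Φ ω (w.x i)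
  have e : ∀ c : Fin (n + 1) → ℤ,
      ∑' ω : ((fun ω i => m.Φ ω (w.x i)) ⁻¹' {c} : Set m.Ω), m.p ω * crossing (m.Φ ω) w.y y'.1 =
      ∑' ω, m.p ω * ((∏ i, eqInd (m.Φ ω (w.x i)) (c i)) * crossing (m.Φ ω) w.y y'.1) := by
    intro c
    rw [tsum_subtype ((fun ω i => m.Φ ω (w.x i)) ⁻¹' {c} : Set m.Ω)
      fun ω => m.p ω * crossing (m.Φ ω) w.y y'.1]
    refine tsum_congr fun ω => ?_
    rw [prod_eqInd]
    by_cases hc : (fun i => m.Φ ω (w.x i)) = c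
    · rw [if_pos hc, one_mul, Set.indicator_of_mem (by exact hc)]
    · rw [if_neg hc, zero_mul, mul_zero, Set.indicator_of_notMem (by exact hc)]
  simp only [e] at hfib
  have hinj : Function.Injective
      fun w' : (TwoLevel.projY ⁻¹' {y'} : Set (TwoLevel I n)) => w'.1.x := by
    intro w₁ w₂ hw
    refine Subtype.ext (TwoLevel.eq_of_levels hw ?_)
    have h1 : w₁.1.projY = w₂.1.projY := Eq.trans w₁.2 (Eq.symm w₂.2)
    exact congrArg Subtype.val h1
  have hzero : ∀ c, c ∉ Set.range
      (fun w' : (TwoLevel.projY ⁻¹' {y'} : Set (TwoLevel I n)) => w'.1.x) →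
      ∑' ω, m.p ω * ((∏ i, eqInd (m.Φ ω (w.x i)) (c i)) * crossing (m.Φ ω) w.y y'.1) = 0 := by
    intro c hc
    refine (tsum_congr fun ω => ?_).trans tsum_zero
    by_contra hne
    refine hc ?_
    rw [prod_eqInd] at hne
    have hcr : crossing (m.Φ ω) w.y y'.1 ≠ 0 := fun h0 => hne (by rw [h0, mul_zero, mul_zero])
    have hcw : (fun i => m.Φ ω (w.x i)) = c := by
      by_contra h0
      exact hne (by rw [if_neg h0, zero_mul, mul_zero])
    have hint := crossing_ne_zero (m.mono ω) hcr
    refine ⟨⟨⟨c, y'.1, fun i => ?_, y'.2.2, fun j => ?_, fun j => ?_⟩, rfl⟩, rfl⟩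
    · rw [← hcw]
      exact m.mem ω _ (w.x_mem i) (hm (Fin.zero_le i)) (hm (Fin.le_last i))
    · rw [← hcw]
      exact (m.mono ω (w.le j)).trans (hint j).1
    · rw [← hcw]
      exact (hint j).2.trans_le (m.mono ω (Int.add_one_le_of_lt (w.lt j)))
  have hsum := (hinj.hasSum_iff hzero).2 hfib
  have hfin := hsum.mul_left ((∏ i, dualSymm lam mu (y'.1 i)) / (∏ i, dualSymm lam mu (w.y i)))
  rw [h.det_dualDensity ht w.y_mem y'.2.2] at hfin
  refine hfin.congr_fun ?_
  intro w'
  have hy : w'.1.y = y'.1 := congrArg Subtype.val (show w'.1.projY = y' from w'.2)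
  rw [twoLevelKernel_eq m w w' le_rfl le_rfl, hy]
  rfl

/-- The set of all `y` interlacing with `x`. -/
def box (x : Weyl I (n + 1)) : Finset (Fin n → ℤ) :=
  Fintype.piFinset fun i => Finset.Ico (x.1 i.castSucc) (x.1 i.succ)

/-- The point of `W^{n,n+1}` with the given two levels. -/
def ChainData.ofBox (h : ChainData I lam mu) (x : Weyl I (n + 1)) (y : box x) : TwoLevel I n where
  x := x.1
  y := y.1
  x_mem := x.2.2
  y_mem i := h.upper _ (x.2.2 i.castSucc) _
    (Finset.mem_Ico.1 (Fintype.mem_piFinset.1 y.2 i)).1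
  le i := (Finset.mem_Ico.1 (Fintype.mem_piFinset.1 y.2 i)).1
  lt i := (Finset.mem_Ico.1 (Fintype.mem_piFinset.1 y.2 i)).2

/-- The finite set of the points of `W^{n,n+1}` above `x`. -/
def ChainData.linkSupp (h : ChainData I lam mu) (x : Weyl I (n + 1)) : Finset (TwoLevel I n) :=
  (Finset.univ : Finset (box x)).map
    ⟨h.ofBox x, fun _ _ hy => Subtype.ext (congrArg TwoLevel.y hy)⟩

theorem ChainData.mem_linkSupp (h : ChainData I lam mu) {x : Weyl I (n + 1)} {w : TwoLevel I n} :
    w ∈ h.linkSupp x ↔ w.projX = x := by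
  constructor
  · intro hw
    obtain ⟨y, _, rfl⟩ := Finset.mem_map.1 hw
    rfl
  · rintro rfl
    refine Finset.mem_map.2 ⟨⟨w.y, Fintype.mem_piFinset.2 fun i =>
      Finset.mem_Ico.2 ⟨w.le i, w.lt i⟩⟩, Finset.mem_univ _, rfl⟩

theorem ChainData.linkSupp_nonempty (h : ChainData I lam mu) (x : Weyl I (n + 1)) :
    (h.linkSupp x).Nonempty := by
  have hy : (fun i : Fin n => x.1 i.castSucc) ∈ box x := Fintype.mem_piFinset.2 fun i =>
    Finset.mem_Ico.2 ⟨le_rfl, x.2.1 Fin.castSucc_lt_succ⟩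
  exact ⟨h.ofBox x ⟨_, hy⟩, Finset.mem_map.2 ⟨_, Finset.mem_univ _, rfl⟩⟩

theorem sum_box_crossing (Φ : ℤ → ℤ) (x : Weyl I (n + 1)) (y' : Fin n → ℤ) :
    ∑ y ∈ box x, crossing Φ y y' =
      ∏ j, (leInd (Φ (x.1 j.castSucc)) (y' j) - leInd (Φ (x.1 j.succ)) (y' j)) := by
  unfold crossing box
  rw [← Finset.prod_univ_sum (fun i : Fin n => Finset.Ico (x.1 i.castSucc) (x.1 i.succ))
    (fun j a => leInd (Φ a) (y' j) - leInd (Φ (a + 1)) (y' j))]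
  refine Finset.prod_congr rfl fun j _ => ?_
  exact sum_Ico_sub (fun a => leInd (Φ a) (y' j)) (x.2.1 Fin.castSucc_lt_succ).le

/-- The basic intertwining `P Λ = Λ Q`: the sum over `y` telescopes, and on the event `Φ x = x'`
only the boundary term `1` is left. -/
theorem ChainData.sum_link_mul_twoLevelKernel (h : ChainData I lam mu) (ht : 0 ≤ t)
    (x : Weyl I (n + 1)) (w' : TwoLevel I n) :
    ∑ w ∈ h.linkSupp x, link I lam mu n x w * twoLevelKernel I lam mu n t w w' =
      kmKernel I lam mu (n + 1) t x w'.projX * ∏ i, dualSymm lam mu (w'.y i) := by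
  have hmx := x.2.1.monotone
  obtain ⟨m⟩ := h.nonempty_flowModel ht (hmx (Fin.zero_le (Fin.last n)))
  rw [ChainData.linkSupp, Finset.sum_map]
  have e : ∀ y : box x, link I lam mu n x (h.ofBox x y) *
      twoLevelKernel I lam mu n t (h.ofBox x y) w' =
      (∏ i, dualSymm lam mu (w'.y i)) * ∑' ω, m.p ω *
        ((∏ i, eqInd (m.Φ ω (x.1 i)) (w'.x i)) * crossing (m.Φ ω) y.1 w'.y) := by
    intro y
    have hpos := (h.prod_dualSymm_pos (h.ofBox x y).y_mem).ne'
    rw [twoLevelKernel_eq m (h.ofBox x y) w' le_rfl le_rfl, link,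
      if_pos (show (h.ofBox x y).projX = x from rfl), ← mul_assoc,
      mul_div_cancel₀ _ hpos]
    rfl
  refine (Finset.sum_congr rfl fun y _ => e y).trans ?_
  rw [← Finset.mul_sum, mul_comm]
  congr 1
  rw [Finset.sum_coe_sort (box x) fun y => ∑' ω, m.p ω *
        ((∏ i, eqInd (m.Φ ω (x.1 i)) (w'.x i)) * crossing (m.Φ ω) y w'.y),
    ← Summable.tsum_finsetSum fun y _ => m.summable_mul
      (prod_eqInd_mul_crossing_nonneg m _ _ _ _) (prod_eqInd_mul_crossing_le_one m _ _ _ _),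
    kmKernel]
  refine Eq.trans (tsum_congr fun ω => ?_) (m.tsum_eqInd h ht x.2.1 w'.x_strictMono
    (fun i => hmx (Fin.zero_le i)) (fun i => hmx (Fin.le_last i)))
  change _ = m.p ω * ∏ i, eqInd (m.Φ ω (x.1 i)) (w'.x i)
  rw [← Finset.mul_sum, ← Finset.mul_sum, sum_box_crossing, prod_eqInd]
  by_cases hc : (fun i => m.Φ ω (x.1 i)) = w'.x
  · rw [if_pos hc, one_mul]
    congr 1
    refine Finset.prod_eq_one fun j _ => ?_
    have h1 : m.Φ ω (x.1 j.castSucc) = w'.x j.castSucc := congrFun hc _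
    have h2 : m.Φ ω (x.1 j.succ) = w'.x j.succ := congrFun hc _
    rw [h1, h2, leInd, leInd, if_pos (w'.le j), if_neg (not_le.2 (w'.lt j)), sub_zero]
  · rw [if_neg hc, zero_mul]

theorem ChainData.kmKernel_nonneg (h : ChainData I lam mu) (ht : 0 ≤ t)
    (x x' : Weyl I (n + 1)) : 0 ≤ kmKernel I lam mu (n + 1) t x x' := by
  obtain ⟨w', hw'⟩ := h.linkSupp_nonempty x'
  rw [h.mem_linkSupp] at hw'
  have hpos := h.prod_dualSymm_pos w'.y_mem
  have hsum := h.sum_link_mul_twoLevelKernel ht x w'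
  rw [hw'] at hsum
  refine nonneg_of_mul_nonneg_left (hsum ▸ Finset.sum_nonneg fun w hw => ?_) hpos
  rw [link, if_pos (h.mem_linkSupp.1 hw)]
  exact mul_nonneg (h.prod_dualSymm_pos w.y_mem).le (h.twoLevelKernel_nonneg ht w w')

end TwoLevelKernel

/-! ### Eigenfunctions and intertwinings -/

section Intertwining

theorem hasSum_of_fiberwise {β γ : Type*} {f : β → ℝ} (hf : ∀ b, 0 ≤ f b) (g : β → γ)
    {F : γ → ℝ} {a : ℝ} (h1 : ∀ c, HasSum (fun b : (g ⁻¹' {c} : Set β) => f b) (F c))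
    (h2 : HasSum F a) : HasSum f a := by
  rw [← (Equiv.sigmaFiberEquiv g).hasSum_iff]
  have hs : Summable (f ∘ Equiv.sigmaFiberEquiv g) := by
    refine (summable_sigma_of_nonneg fun b => hf _).2 ⟨fun c => (h1 c).summable, ?_⟩
    exact h2.summable.congr fun c => (h1 c).tsum_eq.symm
  exact HasSum.sigma_of_hasSum h2 h1 hs

variable {I : Set ℤ} {lam mu : ℤ → ℝ} {n : ℕ} {h : Weyl I n → ℝ} {c t : ℝ}

theorem ChainData.hasSum_link_mul (hd : ChainData I lam mu) (x : Weyl I (n + 1))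
    (F : TwoLevel I n → ℝ) : HasSum (fun w => link I lam mu n x w * F w)
      (∑ w ∈ hd.linkSupp x, link I lam mu n x w * F w) := by
  refine hasSum_sum_of_ne_finset_zero fun w hw => ?_
  rw [link, if_neg (fun e => hw (hd.mem_linkSupp.2 e)), zero_mul]

theorem ChainData.linkFun_eq (hd : ChainData I lam mu) (x : Weyl I (n + 1)) :
    linkFun I lam mu n h x =
      ∑ w ∈ hd.linkSupp x, link I lam mu n x w * h w.projY :=
  (hd.hasSum_link_mul x fun w => h w.projY).tsum_eq

theorem ChainData.link_pos (hd : ChainData I lam mu) {x : Weyl I (n + 1)} {w : TwoLevel I n}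
    (hw : w ∈ hd.linkSupp x) : 0 < link I lam mu n x w := by
  rw [link, if_pos (hd.mem_linkSupp.1 hw)]
  exact hd.prod_dualSymm_pos w.y_mem

theorem ChainData.link_nonneg (hd : ChainData I lam mu) (x : Weyl I (n + 1)) (w : TwoLevel I n) :
    0 ≤ link I lam mu n x w := by
  by_cases hw : w ∈ hd.linkSupp x
  · exact (hd.link_pos hw).le
  · rw [link, if_neg (fun e => hw (hd.mem_linkSupp.2 e))]

theorem ChainData.linkFun_pos (hd : ChainData I lam mu) (hh : ∀ y, 0 < h y)
    (x : Weyl I (n + 1)) : 0 < linkFun I lam mu n h x := by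
  rw [hd.linkFun_eq]
  exact Finset.sum_pos (fun w hw => mul_pos (hd.link_pos hw) (hh _)) (hd.linkSupp_nonempty x)

theorem ChainData.hasSum_twoLevelKernel_mul (hd : ChainData I lam mu)
    (hh : IsPosEigenfunction (dualKmKernel I lam mu n) h c) (ht : 0 ≤ t) (w : TwoLevel I n) :
    HasSum (fun w' => twoLevelKernel I lam mu n t w w' * h w'.projY)
      (Real.exp (c * t) * h w.projY) := by
  refine hasSum_of_fiberwise (fun w' => mul_nonneg (hd.twoLevelKernel_nonneg ht w w')
    (hh.1 _).le) TwoLevel.projY (fun y' => ?_) (hh.2 t ht w.projY)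
  refine ((hd.hasSum_twoLevelKernel ht w y').mul_right (h y')).congr_fun fun w' => ?_
  rw [show w'.1.projY = y' from w'.2]

/-- The weight `P(x, x') ∏ π̂(y') ĥ(y')` that both sides of the first intertwining give to
`w' = (x', y')`, up to normalization. -/
def jointWeight (I : Set ℤ) (lam mu : ℤ → ℝ) (h : Weyl I n → ℝ) (t : ℝ) (x : Weyl I (n + 1))
    (w' : TwoLevel I n) : ℝ :=
  kmKernel I lam mu (n + 1) t x w'.projX * (link I lam mu n w'.projX w' * h w'.projY)

theorem ChainData.jointWeight_eq (hd : ChainData I lam mu) (ht : 0 ≤ t) (x : Weyl I (n + 1))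
    (w' : TwoLevel I n) : jointWeight I lam mu h t x w' =
      ∑ w ∈ hd.linkSupp x, link I lam mu n x w *
        (twoLevelKernel I lam mu n t w w' * h w'.projY) := by
  rw [jointWeight, link, if_pos rfl, ← mul_assoc, ← hd.sum_link_mul_twoLevelKernel ht,
    Finset.sum_mul]
  exact Finset.sum_congr rfl fun w _ => mul_assoc _ _ _

theorem ChainData.jointWeight_nonneg (hd : ChainData I lam mu) (hh : ∀ y, 0 < h y) (ht : 0 ≤ t)
    (x : Weyl I (n + 1)) (w' : TwoLevel I n) : 0 ≤ jointWeight I lam mu h t x w' :=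
  mul_nonneg (hd.kmKernel_nonneg ht _ _) (mul_nonneg (hd.link_nonneg _ _) (hh _).le)

theorem ChainData.hasSum_jointWeight (hd : ChainData I lam mu)
    (hh : IsPosEigenfunction (dualKmKernel I lam mu n) h c) (ht : 0 ≤ t) (x : Weyl I (n + 1)) :
    HasSum (jointWeight I lam mu h t x) (Real.exp (c * t) * linkFun I lam mu n h x) := by
  have h1 : HasSum (fun w' => ∑ w ∈ hd.linkSupp x, link I lam mu n x w *
        (twoLevelKernel I lam mu n t w w' * h w'.projY))
      (∑ w ∈ hd.linkSupp x, link I lam mu n x w * (Real.exp (c * t) * h w.projY)) :=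
    hasSum_sum fun w _ => (hd.hasSum_twoLevelKernel_mul hh ht w).mul_left _
  have e : Real.exp (c * t) * linkFun I lam mu n h x =
      ∑ w ∈ hd.linkSupp x, link I lam mu n x w * (Real.exp (c * t) * h w.projY) := by
    rw [hd.linkFun_eq, Finset.mul_sum]
    exact Finset.sum_congr rfl fun w _ => by ring
  rw [e]
  exact h1.congr_fun fun w' => hd.jointWeight_eq ht x w'

/-- Summation over the fibre of the `X`-level. -/
theorem ChainData.tsum_fiber_jointWeight (hd : ChainData I lam mu) (f : TwoLevel I n → ℝ)
    (x x' : Weyl I (n + 1)) :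
    ∑' w' : (TwoLevel.projX ⁻¹' {x'} : Set (TwoLevel I n)), jointWeight I lam mu h t x w' * f w' =
      kmKernel I lam mu (n + 1) t x x' *
        ∑ w' ∈ hd.linkSupp x', link I lam mu n x' w' * h w'.projY * f w' := by
  have e : (TwoLevel.projX ⁻¹' {x'} : Set (TwoLevel I n)) = ↑(hd.linkSupp x') := by
    ext w
    rw [Finset.mem_coe, hd.mem_linkSupp]
    rfl
  rw [tsum_congr_set_coe (fun w' => jointWeight I lam mu h t x w' * f w') e,
    Finset.tsum_subtype' (hd.linkSupp x') fun w' => jointWeight I lam mu h t x w' * f w',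
    Finset.mul_sum]
  refine Finset.sum_congr rfl fun w' hw' => ?_
  rw [jointWeight, hd.mem_linkSupp.1 hw']
  ring

theorem ChainData.isPosEigenfunction_linkFun (hd : ChainData I lam mu)
    (hh : IsPosEigenfunction (dualKmKernel I lam mu n) h c) :
    IsPosEigenfunction (kmKernel I lam mu (n + 1)) (linkFun I lam mu n h) c := by
  refine ⟨hd.linkFun_pos hh.1, fun t ht x => ?_⟩
  refine ((hd.hasSum_jointWeight hh ht x).tsum_fiberwise TwoLevel.projX).congr_fun fun x' => ?_
  have := hd.tsum_fiber_jointWeight (h := h) (t := t) (fun _ => 1) x x'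
  simp only [mul_one] at this
  rw [this, hd.linkFun_eq]

theorem ChainData.isPosEigenfunction_twoLevel (hd : ChainData I lam mu)
    (hh : IsPosEigenfunction (dualKmKernel I lam mu n) h c) :
    IsPosEigenfunction (twoLevelKernel I lam mu n) (fun w => h w.projY) c :=
  ⟨fun _ => hh.1 _, fun _ ht w => hd.hasSum_twoLevelKernel_mul hh ht w⟩

theorem ChainData.isMarkov_markovLink (hd : ChainData I lam mu) (hh : ∀ y, 0 < h y) :
    IsMarkov (markovLink I lam mu n h) := by
  intro x
  have hpos := hd.linkFun_pos hh x
  refine ⟨fun w => mul_nonneg (mul_nonneg (inv_nonneg.2 hpos.le) (hd.link_nonneg x w))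
    (hh _).le, ?_⟩
  have h1 := (hd.hasSum_link_mul x fun w => h w.projY).mul_left (linkFun I lam mu n h x)⁻¹
  rw [← hd.linkFun_eq, inv_mul_cancel₀ hpos.ne'] at h1
  exact h1.congr_fun fun w => mul_assoc _ _ _

theorem isMarkov_doob {A : Type*} {K : ℝ → A → A → ℝ} {h : A → ℝ} (hK : ∀ a b, 0 ≤ K t a b)
    (hh : IsPosEigenfunction K h c) (ht : 0 ≤ t) : IsMarkov (doob K h c t) := by
  intro a
  refine ⟨fun b => mul_nonneg (mul_nonneg (mul_nonneg (Real.exp_pos _).le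
    (inv_nonneg.2 (hh.1 a).le)) (hK a b)) (hh.1 b).le, ?_⟩
  have h1 := (hh.2 t ht a).mul_left (Real.exp (-(c * t)) * (h a)⁻¹)
  have e : Real.exp (-(c * t)) * (h a)⁻¹ * (Real.exp (c * t) * h a) = 1 := by
    rw [Real.exp_neg]
    have := (hh.1 a).ne'
    have := (Real.exp_pos (c * t)).ne'
    field_simp
  rw [e] at h1
  exact h1.congr_fun fun b => mul_assoc _ _ _

theorem act_doob {A : Type*} (K : ℝ → A → A → ℝ) (h f : A → ℝ) (c t : ℝ) (a : A) :
    act (doob K h c t) f a =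
      Real.exp (-(c * t)) * (h a)⁻¹ * ∑' b, K t a b * h b * f b := by
  rw [act, ← tsum_mul_left]
  exact tsum_congr fun b => by rw [doob]; ring

theorem ChainData.act_markovLink (hd : ChainData I lam mu) (f : TwoLevel I n → ℝ)
    (x : Weyl I (n + 1)) : act (markovLink I lam mu n h) f x =
      (linkFun I lam mu n h x)⁻¹ *
        ∑ w ∈ hd.linkSupp x, link I lam mu n x w * h w.projY * f w := by
  have h1 := ((hd.hasSum_link_mul x fun w => h w.projY * f w).mul_left
    (linkFun I lam mu n h x)⁻¹).tsum_eq
  simp only [← mul_assoc] at h1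
  simp only [act, markovLink]
  exact h1

theorem summable_mul_of_bounded {A : Type*} {K : A → ℝ} (hK : Summable K) (hK0 : ∀ a, 0 ≤ K a)
    {f : A → ℝ} (hf : IsBoundedFun f) : Summable fun a => K a * f a := by
  obtain ⟨M, hM⟩ := hf
  refine Summable.of_norm_bounded (hK.mul_right M) fun a => ?_
  rw [norm_mul, Real.norm_eq_abs, Real.norm_eq_abs, abs_of_nonneg (hK0 a)]
  exact mul_le_mul_of_nonneg_left (hM a) (hK0 a)

theorem ChainData.intertwining (hd : ChainData I lam mu)
    (hh : IsPosEigenfunction (dualKmKernel I lam mu n) h c) (ht : 0 ≤ t)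
    {f : TwoLevel I n → ℝ} (hf : IsBoundedFun f) :
    act (doob (kmKernel I lam mu (n + 1)) (linkFun I lam mu n h) c t)
        (act (markovLink I lam mu n h) f) =
      act (markovLink I lam mu n h)
        (act (doob (twoLevelKernel I lam mu n) (fun w => h w.projY) c t) f) := by
  funext x
  have hK := hd.hasSum_jointWeight hh ht x
  have hKf := summable_mul_of_bounded hK.summable (hd.jointWeight_nonneg hh.1 ht x) hf
  -- both sides integrate `f` against the weight `jointWeight`
  have hleft : ∑' x', kmKernel I lam mu (n + 1) t x x' * linkFun I lam mu n h x' *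
      act (markovLink I lam mu n h) f x' = ∑' w', jointWeight I lam mu h t x w' * f w' := by
    rw [← (hKf.hasSum.tsum_fiberwise TwoLevel.projX).tsum_eq]
    refine tsum_congr fun x' => ?_
    have hpos := (hd.linkFun_pos hh.1 x').ne'
    rw [hd.tsum_fiber_jointWeight f x x', hd.act_markovLink, mul_assoc,
      mul_inv_cancel_left₀ hpos]
  have hright : ∑' w', jointWeight I lam mu h t x w' * f w' =
      ∑ w ∈ hd.linkSupp x, link I lam mu n x w *
        ∑' w', twoLevelKernel I lam mu n t w w' * h w'.projY * f w' := by
    have hs : ∀ w, Summable fun w' => twoLevelKernel I lam mu n t w w' * h w'.projY * f w' :=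
      fun w => summable_mul_of_bounded (hd.hasSum_twoLevelKernel_mul hh ht w).summable
        (fun w' => mul_nonneg (hd.twoLevelKernel_nonneg ht w w') (hh.1 _).le) hf
    refine Eq.trans (tsum_congr fun w' => ?_)
      (hasSum_sum fun w _ => ((hs w).hasSum.mul_left (link I lam mu n x w))).tsum_eq
    rw [hd.jointWeight_eq ht, Finset.sum_mul]
    exact Finset.sum_congr rfl fun w _ => by ring
  rw [act_doob, hleft, hright, hd.act_markovLink, Finset.mul_sum, Finset.mul_sum]
  refine Finset.sum_congr rfl fun w _ => ?_
  have hpos := (hh.1 w.projY).ne'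
  rw [act_doob]
  field_simp

/-- On functions of the `Y`-level the two-level process acts as the dual one. -/
theorem ChainData.act_doob_projY (hd : ChainData I lam mu)
    (hh : IsPosEigenfunction (dualKmKernel I lam mu n) h c) (ht : 0 ≤ t)
    {g : Weyl I n → ℝ} (hg : IsBoundedFun g) (w : TwoLevel I n) :
    act (doob (twoLevelKernel I lam mu n) (fun w => h w.projY) c t) (fun w => g w.projY) w =
      act (doob (dualKmKernel I lam mu n) h c t) g w.projY := by
  rw [act_doob, act_doob]
  congr 1
  have hs := summable_mul_of_bounded (hd.hasSum_twoLevelKernel_mul hh ht w).summable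
    (fun w' => mul_nonneg (hd.twoLevelKernel_nonneg ht w w') (hh.1 _).le)
    (f := fun w => g w.projY) (hg.imp fun M hM w => hM w.projY)
  rw [← (hs.hasSum.tsum_fiberwise TwoLevel.projY).tsum_eq]
  refine tsum_congr fun y' => ?_
  rw [← ((hd.hasSum_twoLevelKernel ht w y').mul_right (h y' * g y')).tsum_eq.trans
    (mul_assoc _ _ _).symm]
  refine tsum_congr fun w' => ?_
  rw [show w'.1.projY = y' from w'.2, mul_assoc]

end Intertwining

end InterlacingChains

end

open InterlacingChains in
theorem mainTheorem2 (I : Set ℤ) (lam mu : ℤ → ℝ) (hI : IsChainOn I lam mu) (n : ℕ)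
    (h : Weyl I n → ℝ) (c : ℝ) (hh : IsPosEigenfunction (dualKmKernel I lam mu n) h c) :
    -- the transformed objects are well defined
    IsPosEigenfunction (kmKernel I lam mu (n + 1)) (linkFun I lam mu n h) c ∧
    IsPosEigenfunction (twoLevelKernel I lam mu n) (fun w => h w.projY) c ∧
    IsMarkov (markovLink I lam mu n h) ∧
    ∀ t : ℝ, 0 ≤ t →
      IsMarkov (doob (kmKernel I lam mu (n + 1)) (linkFun I lam mu n h) c t) ∧
      IsMarkov (doob (twoLevelKernel I lam mu n) (fun w => h w.projY) c t) ∧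
      IsMarkov (doob (dualKmKernel I lam mu n) h c t) ∧
      -- first intertwining
      (∀ f : TwoLevel I n → ℝ, IsBoundedFun f →
        act (doob (kmKernel I lam mu (n + 1)) (linkFun I lam mu n h) c t)
            (act (markovLink I lam mu n h) f) =
          act (markovLink I lam mu n h)
            (act (doob (twoLevelKernel I lam mu n) (fun w => h w.projY) c t) f)) ∧
      -- second intertwining, with the link as a kernel to the lower level
      (∀ g : Weyl I n → ℝ, IsBoundedFun g →
        act (doob (kmKernel I lam mu (n + 1)) (linkFun I lam mu n h) c t)
            (act (markovLink I lam mu n h) (fun w => g w.projY)) =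
          act (markovLink I lam mu n h)
            (fun w => act (doob (dualKmKernel I lam mu n) h c t) g w.projY)) := by
  have hd := hI.chainData
  have hP := hd.isPosEigenfunction_linkFun hh
  have hQ := hd.isPosEigenfunction_twoLevel hh
  refine ⟨hP, hQ, hd.isMarkov_markovLink hh.1, fun t ht =>
    ⟨isMarkov_doob (hd.kmKernel_nonneg ht) hP ht, isMarkov_doob (hd.twoLevelKernel_nonneg ht) hQ ht,
      isMarkov_doob (hd.dualKmKernel_nonneg ht) hh ht, fun f hf => hd.intertwining hh ht hf,
      fun g hg => ?_⟩⟩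
  rw [hd.intertwining hh ht (f := fun w => g w.projY) (hg.imp fun M hM w => hM w.projY)]
  congr 1
  funext w
  exact hd.act_doob_projY hh ht hg w
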